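/- **Setting.** A generalized triangulation of a closed connected oriented surface $M$ is obtained from finitely many oriented triangles by identifying their sides in pairs, reversing orientation; triangles may be glued to themselves and vertices of any degree are allowed. Its dual conical Regge polytope has as vertices $\rho^0(j)$ the barycentres of the triangles, as edges $\rho^1(h)$ the arcs joining the barycentres of adjacent triangles through the midpoint of the common side, and as 2-cells $\rho^2(k)$ the dual cells of the vertices $\sigma^0(k)$ of the triangulation. Its 1-skeleton is a trivalent ribbon graph $\Gamma$, and the two halves of each edge (the parts inside the two adjacent triangles) have given positive lengths; $L(\rho^1(h))$ is the sum of the two half-lengths and $L(\partial\rho^2(k))$ is the sum of the lengths of the edges around $\rho^2(k)$, an edge with this cell on both sides being counted twice. (If the triangles are Euclidean and a side of length $l_1$ lies in a triangle with sides $l_1,l_2,l_3$, the half-length in that triangle is $\frac16\sqrt{2l_2^2+2l_3^2-l_1^2}$; the statement holds for arbitrary positive half-lengths, that is, for every trivalent metric ribbon graph.) **Gluing.** Let $\delta>0$ satisfy $2\delta^{3/2}\le L(\rho^1(h))$ for all edges. Number the three half-edges at each $\rho^0(j)$ counterclockwise by $\alpha=1,2,3$ and the edges around each $\rho^2(k)$,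 with the cell on their left, counterclockwise by $\nu=1,\dots,q(k)$. Take the disks $U_{\rho^0(j)}=\{|w|<\delta\}$, the strips $U_{\rho^1(h)}=\{0<\operatorname{Re}z<L(\rho^1(h))\}$ (reversing the orientation of the edge replaces $z$ by $L(\rho^1(h))-z$) and the unit disks $U_{\rho^2(k)}=\{|\zeta|<1\}$, and glue them by $$w=e^{2\pi i(\alpha-1)/3}z^{2/3},\qquad \zeta=\exp\Big(\frac{2\pi i}{L(\partial\rho^2(k))}\Big(\sum_{\beta<\nu}L(\rho^1(h_\beta))+z\Big)\Big),$$ where in the first formula the edge is oriented away from $\rho^0(j)$ and $z$ lies in its strip, in the second the edge is oriented so that $\rho^2(k)$ is on its left and $z$ lies in its strip with $\operatorname{Im}z>0$, and where $U_{\rho^0(j)}$ and $U_{\rho^2(k)}$ are glued by these two formulas with the same $z$, $\operatorname{Re}z\ge0$, $\operatorname{Im}z>0$. **Proposition.** (1) The glued space $X$ is a compact connected Hausdorff second countable space on which there is a complex structure $\mathcal C$, making $X$ a Riemann surface, for which all the coordinates $w,z,\zeta$ are holomorphic charts. The centres $w=0$ of the vertex disks are pairwise distinct, the points $\zeta=0$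 (the punctures) are pairwise distinct, and the complement of the punctures is connected. (2) There is a meromorphic quadratic differential $\psi$ on $X$ which is $dz^2$ on every strip, $\frac94\,w\,dw^2$ on every vertex disk and $-\frac{L(\partial\rho^2(k))^2}{4\pi^2\zeta^2}\,d\zeta^2$ on every disk $U_{\rho^2(k)}$. It has a simple zero at each trivalent vertex $\rho^0(j)$ (the point $w=0$), a double pole at each puncture, and neither zeros nor poles elsewhere. (3) There is a homeomorphism $M\to X$ that maps each vertex $\sigma^0(k)$ of the triangulation to the puncture of $U_{\rho^2(k)}$, each barycentre $\rho^0(j)$ to $w=0$ in $U_{\rho^0(j)}$, each half-edge of $\Gamma$, with constant speed, onto the corresponding part of the real segment of its strip, and each open 2-cell $\rho^2(k)$ into $U_{\rho^2(k)}$. So the construction defines a punctured Riemann surface $((M;N_0),\mathcal C)$ on $(M;N_0)=M\setminus\{\sigma^0(k)\}$. (4) The surface is canonical: for an isomorphism of ribbon graphs, preserving edge lengths, between two such polytopes (in particular the identity of one polytope) and for any choices of $\delta$, of the numberings, and of complex structures as in (1), there is a unique biholomorphic map between the glued surfaces that is the identity in corresponding strip coordinates $z$ and sends the centres of vertex disks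 and the punctures to the corresponding ones. -/

import Mathlib

open Set Filter Topology
open scoped Manifold ContDiff

universe u

noncomputable section

/-!  Generalized (semi-simplicial) triangulations of closed oriented surfaces.  -/

/-- A generalized triangulation of a closed connected oriented surface, with finite set `D` of
oriented triangle sides. `rot` sends a side to the next side, counterclockwise, of the same
triangle, and `opp` sends a side to the side (of the same or another triangle) that it is glued
to. Triangles may be glued to themselves and vertices of any degree are allowed.

The dual ribbon graph has the same data: the side `d` is crossed by the half-edge, starting at the
barycentre of the triangle of `d`, of the dual edge; `rot` is then the counterclockwise order of the
three half-edges at a vertex and `opp` exchanges the two half-edges of an edge. -/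
structure Triangulation (D : Type u) where
  rot : Equiv.Perm D
  opp : Equiv.Perm D
  rot_cube : ∀ d, rot (rot (rot d)) = d
  rot_ne : ∀ d, rot d ≠ d
  opp_opp : ∀ d, opp (opp d) = d
  opp_ne : ∀ d, opp d ≠ d
  nonempty : Nonempty D
  connected : ∀ d d' : D, ∃ g ∈ Subgroup.closure {rot, opp}, g d = d'

namespace Triangulation

variable {D : Type u} (T : Triangulation D)

/-- The triangles of `T`, that is, the trivalent vertices of the dual graph. -/
def Vertex : Type u := Quotient (Equiv.Perm.SameCycle.setoid T.rot)

/-- The vertex at which the half-edge `d` starts. -/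
def vertex (d : D) : T.Vertex := Quotient.mk (Equiv.Perm.SameCycle.setoid T.rot) d

/-- The half-edge that follows `d` in the counterclockwise boundary of the 2-cell on the left
of `d`. -/
def next : Equiv.Perm D := T.rot⁻¹ * T.opp

/-- The 2-cells of the dual polytope, that is, the vertices of the triangulation. -/
def Cell : Type u := Quotient (Equiv.Perm.SameCycle.setoid T.next)

/-- The 2-cell on the left of the half-edge `d`. -/
def cell (d : D) : T.Cell := Quotient.mk (Equiv.Perm.SameCycle.setoid T.next) d

/-- Gluing of triangles. A point of a triangle is given by one of its sides `d` and barycentric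
coordinates with respect to the initial end of `d`, the terminal end of `d` and the
vertex opposite to `d`. -/
inductive SideGlue : (Σ _ : D, stdSimplex ℝ (Fin 3)) → (Σ _ : D, stdSimplex ℝ (Fin 3)) → Prop
  | rotate (d : D) (x y : stdSimplex ℝ (Fin 3))
      (h : ∀ i, (y : Fin 3 → ℝ) i = (x : Fin 3 → ℝ) (i + 1)) :
      SideGlue ⟨d, x⟩ ⟨T.rot d, y⟩
  | side (d : D) (x y : stdSimplex ℝ (Fin 3)) (hx : (x : Fin 3 → ℝ) 2 = 0)
      (h : ∀ i, (y : Fin 3 → ℝ) i = (x : Fin 3 → ℝ) (Equiv.swap 0 1 i)) :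
      SideGlue ⟨d, x⟩ ⟨T.opp d, y⟩

/-- The triangulated surface `M`. -/
def Realization : Type u := Quot T.SideGlue

instance : TopologicalSpace T.Realization :=
  inferInstanceAs (TopologicalSpace (Quot T.SideGlue))

/-- The point of `M` with barycentric coordinates `x` in the triangle of the side `d`. -/
def point (d : D) (x : stdSimplex ℝ (Fin 3)) : T.Realization := Quot.mk _ ⟨d, x⟩

end Triangulation

/-- A (generalized) Regge triangulation: every triangle is a Euclidean triangle. -/
structure ReggeTriangulation (D : Type u) extends Triangulation D where
  sideLength : D → ℝ
  sideLength_pos : ∀ d, 0 < sideLength d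
  sideLength_opp : ∀ d, sideLength (opp d) = sideLength d
  triangle : ∀ d, sideLength d < sideLength (rot d) + sideLength (rot (rot d))

/-- A (generalized) conical Regge polytope: the dual cell complex of a triangulation with a metric
on (the edge refinement of) its 1-skeleton, a trivalent metric ribbon graph. `halfLength d` is the
length of the part of the edge of `d` inside the triangle of `d`. -/
structure ConicalPolytope (D : Type u) extends Triangulation D where
  halfLength : D → ℝ
  halfLength_pos : ∀ d, 0 < halfLength d

/-- The conical Regge polytope barycentrically dual to a Regge triangulation: the half-edge `d`
joins the barycentre of a Euclidean triangle to the midpoint of the side `d`. -/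
def ReggeTriangulation.dual {D : Type u} (T : ReggeTriangulation D) : ConicalPolytope D where
  toTriangulation := T.toTriangulation
  halfLength d := 1 / 6 * √(2 * T.sideLength (T.rot d) ^ 2 +
    2 * T.sideLength (T.rot (T.rot d)) ^ 2 - T.sideLength d ^ 2)
  halfLength_pos d := by
    have h1 := T.triangle d
    have h0 := T.sideLength_pos d
    have : 0 < 2 * T.sideLength (T.rot d) ^ 2 +
        2 * T.sideLength (T.rot (T.rot d)) ^ 2 - T.sideLength d ^ 2 := by
      nlinarith [sq_nonneg (T.sideLength (T.rot d) - T.sideLength (T.rot (T.rot d)))]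
    positivity

namespace ConicalPolytope

variable {D : Type u} (P : ConicalPolytope D)

/-- The length of the edge containing the half-edge `d`. -/
def length (d : D) : ℝ := P.halfLength d + P.halfLength (P.opp d)

/-- The perimeter of a 2-cell (an edge with the cell on both sides is counted twice). -/
def perimeter (c : P.Cell) : ℝ := ∑ᶠ (d : D) (_ : P.cell d = c), P.length d

/-- The auxiliary choices in the gluing construction: a small radius `δ` and a first edge at each
vertex and around each 2-cell. -/
structure Labelling where
  δ : ℝ
  δ_pos : 0 < δ
  δ_small : ∀ d, 2 * δ ^ (3 / 2 : ℝ) ≤ P.length d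
  vertexBase : P.Vertex → D
  vertex_vertexBase : ∀ v, P.vertex (vertexBase v) = v
  cellBase : P.Cell → D
  cell_cellBase : ∀ c, P.cell (cellBase c) = c

/-- Indices of the coordinate patches. Each edge gives two patches, one for each of its
orientations. -/
inductive Patch
  | vertex (v : P.Vertex)
  | edge (d : D)
  | cell (c : P.Cell)

namespace Labelling

variable {P} (A : P.Labelling)

/-- The domains of the uniformizing coordinates `w`, `z`, `ζ`. -/
def domain : P.Patch → Set ℂ
  | .vertex _ => {w | ‖w‖ < A.δ}
  | .edge d => {z | 0 < z.re ∧ z.re < P.length d}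
  | .cell _ => {ζ | ‖ζ‖ < 1}

/-- `α - 1`, when `d` is the `α`-th half-edge at its vertex, counted counterclockwise. -/
def vertexIndex (d : D) : ℕ := sInf {n | (P.rot ^ n) (A.vertexBase (P.vertex d)) = d}

/-- `ν - 1`, when `d` is the `ν`-th half-edge around its 2-cell, counted counterclockwise. -/
def cellIndex (d : D) : ℕ := sInf {n | (P.next ^ n) (A.cellBase (P.cell d)) = d}

/-- `w = e^{2πi(α-1)/3} z^{2/3}`. -/
def toVertex (d : D) (z : ℂ) : ℂ :=
  Complex.exp (2 * Real.pi * Complex.I * A.vertexIndex d / 3) * z ^ (2 / 3 : ℂ)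

/-- `ζ = exp((2πi / L(∂ρ²)) (L(h₁) + ⋯ + L(h_{ν-1}) + z))`. -/
def toCell (d : D) (z : ℂ) : ℂ :=
  Complex.exp (2 * Real.pi * Complex.I / P.perimeter (P.cell d) *
    (∑ i ∈ Finset.range (A.cellIndex d),
      (P.length ((P.next ^ i) (A.cellBase (P.cell d))) : ℂ) + z))

/-- The disjoint union of the patches. -/
abbrev Pieces : Type u := Σ i : P.Patch, A.domain i

/-- The identifications. The strip coordinates of the two orientations of an edge are related by
`z ↦ L - z`. -/
inductive Glue : A.Pieces → A.Pieces → Prop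
  | flip (d : D) (z : A.domain (.edge d)) (z' : A.domain (.edge (P.opp d)))
      (h : (z' : ℂ) = P.length d - z) :
      Glue ⟨_, z⟩ ⟨_, z'⟩
  | edgeVertex (d : D) (z : A.domain (.edge d)) (w : A.domain (.vertex (P.vertex d)))
      (h : (w : ℂ) = A.toVertex d z) :
      Glue ⟨_, z⟩ ⟨_, w⟩
  | edgeCell (d : D) (z : A.domain (.edge d)) (ζ : A.domain (.cell (P.cell d)))
      (him : 0 < (z : ℂ).im) (h : (ζ : ℂ) = A.toCell d z) :
      Glue ⟨_, z⟩ ⟨_, ζ⟩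
  | vertexCell (d : D) (z : ℂ) (hre : 0 ≤ z.re) (him : 0 < z.im)
      (w : A.domain (.vertex (P.vertex d))) (ζ : A.domain (.cell (P.cell d)))
      (hw : (w : ℂ) = A.toVertex d z) (hζ : (ζ : ℂ) = A.toCell d z) :
      Glue ⟨_, w⟩ ⟨_, ζ⟩

/-- The space obtained by gluing the patches, with the quotient topology. -/
def Surface : Type u := Quot A.Glue

instance : TopologicalSpace A.Surface := inferInstanceAs (TopologicalSpace (Quot A.Glue))

/-- The inclusion of a patch. -/
def patchMap (i : P.Patch) (z : A.domain i) : A.Surface := Quot.mk _ ⟨i, z⟩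

/-- The point `w = 0` of a vertex disk. -/
def vertexPoint (v : P.Vertex) : A.Surface :=
  A.patchMap (.vertex v) ⟨0, by simpa [domain] using A.δ_pos⟩

/-- The point `ζ = 0` of the disk of a 2-cell. -/
def puncture (c : P.Cell) : A.Surface :=
  A.patchMap (.cell c) ⟨0, by simp [domain]⟩

/-- `e` is the uniformizing coordinate of the patch `i`, as a chart of the glued space. -/
def IsPatchChart (i : P.Patch) (e : OpenPartialHomeomorph A.Surface ℂ) : Prop :=
  e.target = A.domain i ∧ ∀ z : A.domain i, e.symm z = A.patchMap i z

/-- The given atlas is a complex structure on the glued space for which all the uniformizing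
coordinates are holomorphic charts. -/
structure IsComplexStructure [ChartedSpace ℂ A.Surface] : Prop where
  isManifold : IsManifold 𝓘(ℂ) ω A.Surface
  patchChart : ∀ i, ∃ e ∈ IsManifold.maximalAtlas 𝓘(ℂ) ω A.Surface, A.IsPatchChart i e

/-- The coefficient of `ψ` in the patches: `dz²` on strips, `(9/4) w dw²` on vertex disks and
`-(L(∂ρ²)² / (4π²ζ²)) dζ²` on the disks of 2-cells. -/
def quadCoeff (_ : P.Labelling) : P.Patch → ℂ → ℂ
  | .vertex _ => fun w => 9 / 4 * w
  | .edge _ => fun _ => 1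
  | .cell c => fun ζ => -((P.perimeter c : ℂ) ^ 2 / (4 * (Real.pi : ℂ) ^ 2 * ζ ^ 2))

end Labelling

end ConicalPolytope

/-- A meromorphic quadratic differential on a Riemann surface: in every holomorphic chart an
expression `f(z) dz²` with `f` meromorphic, compatible with changes of charts. (The values of `f`
on a discrete set carry no information.) -/
structure MeromorphicQuadraticDifferential (X : Type*) [TopologicalSpace X]
    [ChartedSpace ℂ X] where
  coeff : OpenPartialHomeomorph X ℂ → ℂ → ℂ
  meromorphic : ∀ e ∈ IsManifold.maximalAtlas 𝓘(ℂ) ω X, MeromorphicOn (coeff e) e.target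
  compat : ∀ e ∈ IsManifold.maximalAtlas 𝓘(ℂ) ω X, ∀ e' ∈ IsManifold.maximalAtlas 𝓘(ℂ) ω X,
    ∀ p ∈ e.source ∩ e'.source,
      ∀ᶠ z in 𝓝[≠] (e p), coeff e z = coeff e' (e' (e.symm z)) * deriv (e' ∘ e.symm) z ^ 2

/-- The order of a meromorphic quadratic differential at a point: positive at zeros, negative
at poles. -/
def MeromorphicQuadraticDifferential.order {X : Type*} [TopologicalSpace X] [ChartedSpace ℂ X]
    (ψ : MeromorphicQuadraticDifferential X) (p : X) : WithTop ℤ :=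
  meromorphicOrderAt (ψ.coeff (chartAt ℂ p)) (chartAt ℂ p p)

end

/-! The difficulty is to control the quotient: the identifications generate an equivalence relation,
and one must know that it makes no unexpected identifications. This is done with normal forms. Every
glued point is a point of a cell disk, a point of the real segment of a strip, or a vertex centre;
`core` computes this form from coordinates in any patch, and `core_eq_of_glue` checks its invariance
under the generating identifications. The form therefore descends to the surface, and equality of
glued points can be read off from coordinates. Two tilings lie behind this. At a vertex, `z ^ (2 /
3)` folds the upper half-planes of the three half-edges into sectors of angle `2π/3` that fill the
disk without overlap (`exists_toVertex`, `toVertex_inj`). Around a cell, the half-open edges fill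
the interval from `0` to the perimeter, and the exponential wraps the half-strips over them onto the
punctured disk (`exists_toCell`, `toCell_inj`).

The analysis is local. Each identification is made by two holomorphic germs of nonzero derivative in
a common parameter, along which the two coefficients of `ψ` give the same expression. This property,
`Linked`, is an equivalence relation, hence it holds for all pairs of coordinates of one point
(`linked_of_glued_eq`). It yields at once that the patches are open, that coordinate changes are
holomorphic and that `ψ` is well defined. Strips are connected to each other through vertex disks
and are dense, which gives connectedness, also without the punctures.

For the topology, `M` and the glued space are covered by the same rectangles with parameters `(d, a,
r)`: position along an edge and distance from the puncture (`realizationPoint`, `stripPoint`). The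
map matching these parameters is continuous and bijective, hence a homeomorphism, since `M` is
compact and the target is Hausdorff. Compactness of the glued space comes from the same map.

For canonicity, a change of labelling multiplies each `w` and each `ζ` by a constant and leaves `z`
unchanged. The resulting correspondence of points (`Corresponds`) is the graph of a biholomorphic
map, which is unique because the strips are dense. -/

noncomputable section

/-! ### Combinatorics of the permutations `rot`, `opp` and `next`. -/

namespace Triangulation

variable {D : Type u} (T : Triangulation D)

lemma rot_next (d : D) : T.rot (T.next d) = T.opp d := by
  simp [next]

lemma next_opp_rot (d : D) : T.next (T.opp (T.rot d)) = d := by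
  simp [next, T.opp_opp]

lemma vertex_eq_iff {d d' : D} : T.vertex d = T.vertex d' ↔ T.rot.SameCycle d d' :=
  Quotient.eq (r := Equiv.Perm.SameCycle.setoid T.rot)

lemma cell_eq_iff {d d' : D} : T.cell d = T.cell d' ↔ T.next.SameCycle d d' :=
  Quotient.eq (r := Equiv.Perm.SameCycle.setoid T.next)

lemma vertex_rot (d : D) : T.vertex (T.rot d) = T.vertex d := by
  rw [vertex_eq_iff, Equiv.Perm.sameCycle_apply_left]

lemma cell_next (d : D) : T.cell (T.next d) = T.cell d := by
  rw [cell_eq_iff, Equiv.Perm.sameCycle_apply_left]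

lemma vertex_next (d : D) : T.vertex (T.next d) = T.vertex (T.opp d) := by
  rw [← T.vertex_rot, T.rot_next]

lemma cell_opp_rot (d : D) : T.cell (T.opp (T.rot d)) = T.cell d := by
  rw [← T.cell_next, T.next_opp_rot]

lemma exists_vertex (v : T.Vertex) : ∃ d, T.vertex d = v := Quotient.exists_rep v

lemma exists_cell (c : T.Cell) : ∃ d, T.cell d = c := Quotient.exists_rep c

lemma rot_pow_three : T.rot ^ 3 = 1 := by
  ext d
  simpa [pow_succ] using T.rot_cube d

/-- Since `rot` has order dividing three and no fixed point, it acts freely as a group of order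
three. -/
lemma rot_pow_eq_self {n : ℕ} {d : D} : (T.rot ^ n) d = d ↔ 3 ∣ n := by
  have key : (T.rot ^ n) d = (T.rot ^ (n % 3)) d := by
    conv_lhs => rw [← Nat.div_add_mod n 3, pow_add, pow_mul, T.rot_pow_three]
    simp
  rw [key, Nat.dvd_iff_mod_eq_zero]
  have h3 : n % 3 < 3 := Nat.mod_lt _ (by norm_num)
  generalize n % 3 = k at *
  have h1 := T.rot_ne d
  interval_cases k
  · simp
  · simpa using h1
  · simp only [pow_two, Equiv.Perm.mul_apply]
    constructor
    · intro h
      have h2 := T.rot_cube d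
      rw [h] at h2
      exact absurd h2 h1
    · omega

lemma rot_pow_eq_iff {m n : ℕ} {d : D} : (T.rot ^ m) d = (T.rot ^ n) d ↔ (m : ℤ) ≡ n [ZMOD 3] := by
  wlog h : m ≤ n generalizing m n
  · rw [eq_comm, this (le_of_not_ge h)]
    exact ⟨Int.ModEq.symm, Int.ModEq.symm⟩
  obtain ⟨k, rfl⟩ := Nat.exists_eq_add_of_le h
  rw [pow_add, Equiv.Perm.mul_apply, Equiv.apply_eq_iff_eq, eq_comm, T.rot_pow_eq_self,
    Int.modEq_iff_dvd]
  push_cast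
  rw [add_sub_cancel_left]
  norm_cast

/-- The integer exponent is reduced modulo three, so a natural exponent is available even when `D`
is infinite. -/
lemma exists_rot_pow {d d' : D} (h : T.vertex d = T.vertex d') : ∃ n : ℕ, (T.rot ^ n) d = d' := by
  obtain ⟨i, hi⟩ := T.vertex_eq_iff.1 h
  have h3 : (T.rot : Equiv.Perm D) ^ (3 : ℤ) = 1 := by
    exact_mod_cast T.rot_pow_three
  refine ⟨(i % 3).toNat, ?_⟩
  rw [← hi, ← zpow_natCast, Int.toNat_of_nonneg (Int.emod_nonneg _ (by norm_num))]
  conv_rhs => rw [← Int.mul_ediv_add_emod i 3, zpow_add, zpow_mul, h3]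
  simp

end Triangulation

/-! ### Directions at a vertex and positions around a cell. -/

namespace ConicalPolytope

variable {D : Type u} {P : ConicalPolytope D}

lemma length_pos (d : D) : 0 < P.length d :=
  add_pos (P.halfLength_pos _) (P.halfLength_pos _)

lemma length_opp (d : D) : P.length (P.opp d) = P.length d := by
  simp [length, P.opp_opp, add_comm]

lemma halfLength_lt (d : D) : P.halfLength d < P.length d := by
  simpa [length] using P.halfLength_pos (P.opp d)

namespace Labelling

variable (A : P.Labelling)

lemma rot_pow_vertexIndex (d : D) :
    (P.rot ^ (A.vertexIndex d)) (A.vertexBase (P.vertex d)) = d :=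
  Nat.sInf_mem (s := {n | (P.rot ^ n) (A.vertexBase (P.vertex d)) = d})
    (P.exists_rot_pow (A.vertex_vertexBase _))

/-- The direction `e^{2πi(α-1)/3}` of the half-edge `d` in the disk of its vertex. -/
def phase (d : D) : ℂ := Complex.exp (2 * Real.pi * Complex.I * A.vertexIndex d / 3)

lemma toVertex_eq (d : D) (z : ℂ) : A.toVertex d z = A.phase d * z ^ (2 / 3 : ℂ) := rfl

lemma exp_third_eq_iff {m n : ℤ} :
    Complex.exp (2 * Real.pi * Complex.I * m / 3) = Complex.exp (2 * Real.pi * Complex.I * n / 3) ↔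
      m ≡ n [ZMOD 3] := by
  rw [Complex.exp_eq_exp_iff_exists_int, Int.modEq_comm, Int.modEq_iff_dvd]
  have hpi : (Real.pi : ℂ) ≠ 0 := by exact_mod_cast Real.pi_ne_zero
  constructor
  · rintro ⟨k, hk⟩
    refine ⟨k, ?_⟩
    have : (2 * Real.pi * Complex.I) * ((m : ℂ) - n - 3 * k) = 0 := by linear_combination 3 * hk
    have := (mul_eq_zero.1 this).resolve_left (by simp [hpi])
    have h2 : (m : ℂ) - n = 3 * k := by linear_combination this
    exact_mod_cast h2
  · rintro ⟨k, hk⟩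
    refine ⟨k, ?_⟩
    have h2 : (m : ℂ) - n = 3 * k := by exact_mod_cast hk
    linear_combination (2 * Real.pi * Complex.I / 3) * h2

/-- The index of a half-edge matters only modulo three, and there it increases by one under `rot`.
This avoids a case distinction for the last half-edge. -/
lemma phase_rot (d : D) :
    A.phase (P.rot d) = Complex.exp (2 * Real.pi * Complex.I / 3) * A.phase d := by
  have h : ((A.vertexIndex (P.rot d) : ℕ) : ℤ) ≡ (A.vertexIndex d + 1 : ℕ) [ZMOD 3] := by
    rw [← P.rot_pow_eq_iff (d := A.vertexBase (P.vertex d)), add_comm, pow_add,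
      Equiv.Perm.mul_apply, A.rot_pow_vertexIndex, ← P.vertex_rot, A.rot_pow_vertexIndex]
    simp
  have := exp_third_eq_iff.2 h
  rw [phase, phase, ← Complex.exp_add]
  push_cast at this
  rw [this]
  congr 1
  ring

lemma phase_inj {d d' : D} (h : P.vertex d = P.vertex d') (hp : A.phase d = A.phase d') :
    d = d' := by
  have : ((A.vertexIndex d : ℕ) : ℤ) ≡ (A.vertexIndex d' : ℕ) [ZMOD 3] := by
    rw [← exp_third_eq_iff]
    simpa [phase] using hp
  rw [← P.rot_pow_eq_iff (d := A.vertexBase (P.vertex d)), A.rot_pow_vertexIndex, h,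
    A.rot_pow_vertexIndex] at this
  exact this

lemma norm_phase (d : D) : ‖A.phase d‖ = 1 := by
  rw [phase, Complex.norm_exp]
  simp

lemma phase_ne_zero (d : D) : A.phase d ≠ 0 := Complex.exp_ne_zero _

lemma phase_pow_three (d : D) : A.phase d ^ 3 = 1 := by
  rw [phase, ← Complex.exp_nat_mul, Complex.exp_eq_one_iff]
  exact ⟨A.vertexIndex d, by push_cast; ring⟩

/-- The number of edges around a 2-cell. -/
def cellSize (c : P.Cell) : ℕ := Function.minimalPeriod P.next (A.cellBase c)

/-- The `i`-th partial sum of the lengths of the edges around a 2-cell. -/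
def partialSum (c : P.Cell) (n : ℕ) : ℝ :=
  ∑ i ∈ Finset.range n, P.length ((P.next ^ i) (A.cellBase c))

/-- The position of the origin of `d` in the boundary of its 2-cell. -/
def cellStart (d : D) : ℝ := A.partialSum (P.cell d) (A.cellIndex d)

lemma toCell_eq (d : D) (z : ℂ) : A.toCell d z =
    Complex.exp (2 * Real.pi * Complex.I / P.perimeter (P.cell d) * (A.cellStart d + z)) := by
  simp [toCell, cellStart, partialSum]

lemma partialSum_succ (c : P.Cell) (n : ℕ) : A.partialSum c (n + 1) =
    A.partialSum c n + P.length ((P.next ^ n) (A.cellBase c)) :=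
  Finset.sum_range_succ _ _

lemma partialSum_strictMono (c : P.Cell) : StrictMono (A.partialSum c) :=
  strictMono_nat_of_lt_succ fun n => by
    rw [partialSum_succ]
    exact lt_add_of_pos_right _ (length_pos _)

lemma partialSum_zero (c : P.Cell) : A.partialSum c 0 = 0 := by simp [partialSum]

lemma next_pow_cellSize (c : P.Cell) :
    (P.next ^ (A.cellSize c)) (A.cellBase c) = A.cellBase c := by
  rw [← Equiv.Perm.iterate_eq_pow]
  exact Function.iterate_minimalPeriod

lemma next_pow_inj {c : P.Cell} {m n : ℕ} (hm : m < A.cellSize c) (hn : n < A.cellSize c)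
    (h : (P.next ^ m) (A.cellBase c) = (P.next ^ n) (A.cellBase c)) : m = n := by
  rw [← Equiv.Perm.iterate_eq_pow, ← Equiv.Perm.iterate_eq_pow] at h
  exact (Function.iterate_eq_iterate_iff_of_lt_minimalPeriod hm hn).1 h

lemma cell_next_pow (d : D) (n : ℕ) : P.cell ((P.next ^ n) d) = P.cell d := by
  rw [P.cell_eq_iff, Equiv.Perm.sameCycle_pow_left]

lemma cellStart_nonneg (d : D) : 0 ≤ A.cellStart d := by
  rw [cellStart, ← A.partialSum_zero (P.cell d)]
  exact (A.partialSum_strictMono _).monotone (Nat.zero_le _)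

/-- The modulus depends only on the height above the edge: real segments go to the unit circle, the
upper half-strip into the open disk. -/
lemma norm_toCell (d : D) (z : ℂ) :
    ‖A.toCell d z‖ = Real.exp (-(2 * Real.pi / P.perimeter (P.cell d)) * z.im) := by
  rw [toCell_eq, Complex.norm_exp]
  congr 1
  have : (2 * Real.pi * Complex.I / P.perimeter (P.cell d) * (A.cellStart d + z) : ℂ) =
      ((2 * Real.pi / P.perimeter (P.cell d) : ℝ) : ℂ) * (Complex.I * (A.cellStart d + z)) := by
    push_cast
    ring
  rw [this, Complex.re_ofReal_mul]
  simp

variable [Finite D]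

lemma cellSize_pos (c : P.Cell) : 0 < A.cellSize c :=
  Function.minimalPeriod_pos_of_mem_periodicPts (P.next.injective.mem_periodicPts _)

lemma exists_next_pow {c : P.Cell} {d : D} (h : P.cell d = c) :
    ∃ n < A.cellSize c, (P.next ^ n) (A.cellBase c) = d := by
  obtain ⟨n, hn⟩ := (P.cell_eq_iff.1 ((A.cell_cellBase c).trans h.symm)).exists_nat_pow_eq
  refine ⟨n % A.cellSize c, Nat.mod_lt _ (A.cellSize_pos c), ?_⟩
  rw [← hn, ← Equiv.Perm.iterate_eq_pow, ← Equiv.Perm.iterate_eq_pow]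
  exact Function.iterate_mod_minimalPeriod_eq

lemma next_pow_cellIndex (d : D) :
    (P.next ^ (A.cellIndex d)) (A.cellBase (P.cell d)) = d := by
  obtain ⟨n, -, hn⟩ := A.exists_next_pow (d := d) rfl
  exact Nat.sInf_mem (s := {n | (P.next ^ n) (A.cellBase (P.cell d)) = d}) ⟨n, hn⟩

lemma cellIndex_lt (d : D) : A.cellIndex d < A.cellSize (P.cell d) := by
  obtain ⟨n, h, hn⟩ := A.exists_next_pow (d := d) rfl
  exact (Nat.sInf_le (show n ∈ {n | (P.next ^ n) (A.cellBase (P.cell d)) = d} from hn)).trans_lt h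

lemma cellIndex_eq {c : P.Cell} {n : ℕ} (hn : n < A.cellSize c) :
    A.cellIndex ((P.next ^ n) (A.cellBase c)) = n := by
  have hc : P.cell ((P.next ^ n) (A.cellBase c)) = c := by
    rw [cell_next_pow, A.cell_cellBase]
  have h1 := A.next_pow_cellIndex ((P.next ^ n) (A.cellBase c))
  have h2 := A.cellIndex_lt ((P.next ^ n) (A.cellBase c))
  rw [hc] at h1 h2
  exact A.next_pow_inj h2 hn h1

/-- One period of `next`, started at the base, lists each half-edge of the cell exactly once. An
edge with the cell on both sides appears through its two half-edges. -/
lemma perimeter_eq (c : P.Cell) : P.perimeter c = A.partialSum c (A.cellSize c) := by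
  have h : {d | P.cell d = c} =
      (fun i => (P.next ^ i) (A.cellBase c)) '' (Finset.range (A.cellSize c) : Set ℕ) := by
    ext d
    simp only [mem_ofPred_eq, Finset.coe_range, mem_image, mem_Iio]
    constructor
    · exact A.exists_next_pow
    · rintro ⟨n, -, rfl⟩
      rw [cell_next_pow, A.cell_cellBase]
  have h2 : P.perimeter c = ∑ᶠ d ∈ {d | P.cell d = c}, P.length d := rfl
  rw [h2, h, finsum_mem_image, finsum_mem_coe_finset]
  · rfl
  · intro m hm n hn hmn
    exact A.next_pow_inj (by simpa using hm) (by simpa using hn) hmn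

lemma cellStart_add_length (d : D) :
    A.cellStart d + P.length d = A.partialSum (P.cell d) (A.cellIndex d + 1) := by
  rw [partialSum_succ, A.next_pow_cellIndex, cellStart]

lemma cellStart_add_length_le (d : D) :
    A.cellStart d + P.length d ≤ P.perimeter (P.cell d) := by
  rw [cellStart_add_length, A.perimeter_eq]
  exact (A.partialSum_strictMono _).monotone (A.cellIndex_lt d)

lemma perimeter_pos (A : P.Labelling) (c : P.Cell) : 0 < P.perimeter c := by
  rw [A.perimeter_eq, ← A.partialSum_zero c]
  exact A.partialSum_strictMono _ (A.cellSize_pos c)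

lemma perimeter_ne_zero (A : P.Labelling) (c : P.Cell) : (P.perimeter c : ℂ) ≠ 0 := by
  exact_mod_cast (A.perimeter_pos c).ne'

/-- The second alternative is the last edge before the base, where the index returns to zero and the
position drops by one full turn. -/
lemma cellStart_next (d : D) : A.cellStart (P.next d) = A.cellStart d + P.length d ∨
    A.cellStart (P.next d) = A.cellStart d + P.length d - P.perimeter (P.cell d) := by
  have h : (P.next ^ (A.cellIndex d + 1)) (A.cellBase (P.cell d)) = P.next d := by
    rw [add_comm, pow_add, Equiv.Perm.mul_apply, A.next_pow_cellIndex, pow_one]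
  rcases (Nat.succ_le_of_lt (A.cellIndex_lt d)).lt_or_eq with hlt | heq
  · left
    have := A.cellIndex_eq hlt
    rw [Nat.succ_eq_add_one, h] at this
    rw [cellStart, this, P.cell_next, cellStart_add_length]
  · right
    have hb : P.next d = A.cellBase (P.cell d) := by
      rw [← h, ← Nat.succ_eq_add_one, heq, A.next_pow_cellSize]
    have := A.cellIndex_eq (A.cellSize_pos (P.cell d))
    rw [pow_zero, Equiv.Perm.one_apply, ← hb] at this
    rw [cellStart, this, P.cell_next, cellStart_add_length, ← Nat.succ_eq_add_one, heq,
      A.perimeter_eq, partialSum_zero, sub_self]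

lemma cellStart_separated {d d' : D} (hc : P.cell d = P.cell d')
    (h : A.cellIndex d < A.cellIndex d') : A.cellStart d + P.length d ≤ A.cellStart d' := by
  rw [cellStart_add_length, cellStart, hc]
  exact (A.partialSum_strictMono _).monotone h

/-- The edges occupy disjoint half-open intervals; excluding the right end of each decides to which
edge a corner belongs. -/
lemma eq_of_cellStart_add {d d' : D} (hc : P.cell d = P.cell d') {a a' : ℝ} (ha : 0 ≤ a)
    (ha' : 0 ≤ a') (hal : a < P.length d) (hal' : a' < P.length d')
    (h : A.cellStart d + a = A.cellStart d' + a') : d = d' ∧ a = a' := by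
  have hd : d = d' := by
    rcases lt_trichotomy (A.cellIndex d) (A.cellIndex d') with hlt | heq | hgt
    · linarith [A.cellStart_separated hc hlt]
    · rw [← A.next_pow_cellIndex d, ← A.next_pow_cellIndex d', heq, hc]
    · linarith [A.cellStart_separated hc.symm hgt]
  subst hd
  exact ⟨rfl, by linarith⟩

lemma exists_cellStart_add (c : P.Cell) {t : ℝ} (h0 : 0 ≤ t) (h1 : t < P.perimeter c) :
    ∃ d, P.cell d = c ∧ ∃ a, 0 ≤ a ∧ a < P.length d ∧ A.cellStart d + a = t := by
  classical
  have hex : ∃ n, t < A.partialSum c (n + 1) := by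
    refine ⟨A.cellSize c, h1.trans_le ?_⟩
    rw [A.perimeter_eq]
    exact (A.partialSum_strictMono c).monotone (Nat.le_succ _)
  have hlt := Nat.find_spec hex
  have hmin := fun m => Nat.find_min hex (m := m)
  -- The first `n` whose next partial sum exceeds `t`: minimality puts `t` in the `n`-th half-open
  -- interval.
  set n := Nat.find hex
  have hn : A.partialSum c n ≤ t := by
    rcases Nat.eq_zero_or_pos n with h | h
    · rwa [h, partialSum_zero]
    · have := hmin (n - 1) (by omega)
      rw [Nat.sub_add_cancel h] at this
      exact not_lt.1 this
  have hs : n < A.cellSize c := by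
    by_contra hcon
    have := (A.partialSum_strictMono c).monotone (not_lt.1 hcon)
    rw [← A.perimeter_eq] at this
    linarith
  have hc : P.cell ((P.next ^ n) (A.cellBase c)) = c := by
    rw [cell_next_pow, A.cell_cellBase]
  refine ⟨(P.next ^ n) (A.cellBase c), hc, t - A.partialSum c n, by linarith, ?_, ?_⟩
  · rw [partialSum_succ] at hlt
    linarith
  · rw [cellStart, hc, A.cellIndex_eq hs]
    ring

/-- The cell coordinate continues across a corner, because the jump by a perimeter in
`cellStart_next` is a period of the exponential. -/
lemma toCell_next (d : D) (z : ℂ) : A.toCell (P.next d) z = A.toCell d (P.length d + z) := by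
  rw [toCell_eq, toCell_eq, P.cell_next, Complex.exp_eq_exp_iff_exists_int]
  have hL := A.perimeter_ne_zero (P.cell d)
  rcases A.cellStart_next d with h | h
  · refine ⟨0, ?_⟩
    rw [h]
    push_cast
    ring
  · refine ⟨-1, ?_⟩
    rw [h]
    push_cast
    field_simp
    ring

lemma norm_toCell_lt_one {d : D} {z : ℂ} : ‖A.toCell d z‖ < 1 ↔ 0 < z.im := by
  have := A.perimeter_pos (P.cell d)
  rw [norm_toCell, Real.exp_lt_one_iff, neg_mul, neg_lt_zero, mul_pos_iff_of_pos_left]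
  positivity

lemma toCell_inj {d d' : D} (hc : P.cell d = P.cell d') {z z' : ℂ} (h0 : 0 ≤ z.re)
    (h0' : 0 ≤ z'.re) (h1 : z.re < P.length d) (h1' : z'.re < P.length d')
    (h : A.toCell d z = A.toCell d' z') : d = d' ∧ z = z' := by
  rw [toCell_eq, toCell_eq, ← hc, Complex.exp_eq_exp_iff_exists_int] at h
  obtain ⟨n, hn⟩ := h
  have hL := A.perimeter_ne_zero (P.cell d)
  have hpi : (2 * Real.pi * Complex.I : ℂ) ≠ 0 := Complex.two_pi_I_ne_zero
  have key : (A.cellStart d + z : ℂ) = A.cellStart d' + z' + n * P.perimeter (P.cell d) := by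
    have h2 := mul_left_cancel₀ hpi (b := (A.cellStart d + z : ℂ))
      (c := A.cellStart d' + z' + n * P.perimeter (P.cell d)) (by
        field_simp at hn
        linear_combination (2 * Real.pi * Complex.I) * hn)
    exact h2
  have hre := congrArg Complex.re key
  have him := congrArg Complex.im key
  simp only [Complex.add_re, Complex.add_im, Complex.ofReal_re, Complex.ofReal_im,
    Complex.mul_re, Complex.mul_im, Complex.intCast_re, Complex.intCast_im] at hre him
  have e1 := A.cellStart_add_length_le d
  have e2 := A.cellStart_add_length_le d'
  rw [← hc] at e2
  have e3 := A.cellStart_nonneg d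
  have e4 := A.cellStart_nonneg d'
  have hp := A.perimeter_pos (P.cell d)
  -- Both positions lie in the interval from `0` to the perimeter, right end excluded, so they
  -- cannot differ by a nonzero number of turns.
  have hn0 : n = 0 := by
    have u1 : (n : ℝ) < 1 := by
      by_contra hcon
      nlinarith [mul_le_mul_of_nonneg_right (not_lt.1 hcon) hp.le]
    have u2 : (-1 : ℝ) < n := by
      by_contra hcon
      nlinarith [mul_le_mul_of_nonneg_right (not_lt.1 hcon) hp.le]
    have u1' : n < 1 := by exact_mod_cast u1
    have u2' : -1 < n := by exact_mod_cast u2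
    omega
  rw [hn0] at hre him
  obtain ⟨hd, hr⟩ := A.eq_of_cellStart_add hc h0 h0' h1 h1' (by simpa using hre)
  exact ⟨hd, Complex.ext hr (by simpa using him)⟩

lemma exists_toCell (c : P.Cell) {ζ : ℂ} (h0 : ζ ≠ 0) : ∃ d, P.cell d = c ∧
    ∃ z : ℂ, 0 ≤ z.re ∧ z.re < P.length d ∧ A.toCell d z = ζ := by
  have hp := A.perimeter_pos c
  set u : ℂ := Complex.log ζ / (2 * Real.pi * Complex.I / P.perimeter c) with hu
  have hpi : (2 * Real.pi * Complex.I : ℂ) ≠ 0 := Complex.two_pi_I_ne_zero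
  have hL := A.perimeter_ne_zero c
  -- The logarithm of `ζ`, rescaled, is determined modulo the perimeter; its real part is reduced to
  -- the fundamental interval, where it selects the edge.
  obtain ⟨d, hd, a, ha0, ha1, ha⟩ := A.exists_cellStart_add c
    (toIcoMod_mem_Ico hp 0 u.re).1 (by simpa using (toIcoMod_mem_Ico hp 0 u.re).2)
  refine ⟨d, hd, ⟨a, u.im⟩, ha0, ha1, ?_⟩
  have h1 : ((A.cellStart d : ℂ) + (⟨a, u.im⟩ : ℂ)) =
      u - (toIcoDiv hp 0 u.re : ℤ) * P.perimeter c := by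
    apply Complex.ext
    · have := toIcoMod_add_toIcoDiv_zsmul hp 0 u.re
      simp only [zsmul_eq_mul] at this
      simp
      linarith
    · simp
  rw [toCell_eq, hd, h1]
  have h2 : (2 * Real.pi * Complex.I / P.perimeter c *
      (u - (toIcoDiv hp 0 u.re : ℤ) * P.perimeter c) : ℂ) =
      Complex.log ζ - (toIcoDiv hp 0 u.re : ℤ) * (2 * Real.pi * Complex.I) := by
    rw [hu]
    field_simp
  rw [h2, Complex.exp_periodic.sub_int_mul_eq, Complex.exp_log h0]

end Labelling

end ConicalPolytope

/-! ### The local model `z ^ (2 / 3)` at a vertex, and derivatives of the gluing maps. -/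

/-- The closed upper half-plane without the ray `(-∞, 0]`. -/
def IsUpperPoint (z : ℂ) : Prop := 0 < z.im ∨ z.im = 0 ∧ 0 < z.re

lemma IsUpperPoint.mem_slitPlane {z : ℂ} (h : IsUpperPoint z) : z ∈ Complex.slitPlane := by
  rw [Complex.mem_slitPlane_iff]
  rcases h with h | h
  · exact Or.inr h.ne'
  · exact Or.inl h.2

lemma IsUpperPoint.ne_zero {z : ℂ} (h : IsUpperPoint z) : z ≠ 0 := Complex.slitPlane_ne_zero h.mem_slitPlane

lemma IsUpperPoint.im_nonneg {z : ℂ} (h : IsUpperPoint z) : 0 ≤ z.im := by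
  rcases h with h | h
  · exact h.le
  · exact h.1.ge

lemma IsUpperPoint.arg_nonneg {z : ℂ} (h : IsUpperPoint z) : 0 ≤ z.arg :=
  Complex.arg_nonneg_iff.2 h.im_nonneg

lemma IsUpperPoint.arg_lt_pi {z : ℂ} (h : IsUpperPoint z) : z.arg < Real.pi := by
  refine lt_of_le_of_ne (Complex.arg_le_pi z) fun hz => ?_
  rw [Complex.arg_eq_pi_iff] at hz
  rcases h with h | h <;> linarith [h, hz.1, hz.2]

namespace ConicalPolytope

namespace Labelling

variable {D : Type u} {P : ConicalPolytope D} (A : P.Labelling)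

/-- Shrinking the argument by `2/3` keeps it in the range of the principal branch, so the exponents
multiply. -/
lemma cpow_two_thirds_cpow (z : ℂ) : (z ^ (2 / 3 : ℂ)) ^ (3 / 2 : ℂ) = z := by
  have e : (Complex.log z * (2 / 3 : ℂ)).im = z.arg * (2 / 3) := by
    have : (2 / 3 : ℂ) = ((2 / 3 : ℝ) : ℂ) := by push_cast; rfl
    rw [this, mul_comm, Complex.im_ofReal_mul, Complex.log_im, mul_comm]
  rw [← Complex.cpow_mul]
  · norm_num
  · rw [e]
    linarith [Complex.neg_pi_lt_arg z, Real.pi_pos]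
  · rw [e]
    linarith [Complex.arg_le_pi z, Real.pi_pos]

lemma toVertex_zero (d : D) : A.toVertex d 0 = 0 := by
  rw [toVertex_eq, Complex.zero_cpow (by norm_num), mul_zero]

lemma toVertex_injective (d : D) : Function.Injective (A.toVertex d) := fun z z' h => by
  rw [toVertex_eq, toVertex_eq] at h
  rw [← cpow_two_thirds_cpow z, mul_left_cancel₀ (A.phase_ne_zero d) h, cpow_two_thirds_cpow]

lemma norm_toVertex (d : D) (z : ℂ) : ‖A.toVertex d z‖ = ‖z‖ ^ (2 / 3 : ℝ) := by
  have : (2 / 3 : ℂ) = ((2 / 3 : ℝ) : ℂ) := by push_cast; rfl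
  rw [toVertex_eq, norm_mul, norm_phase, one_mul, this, Complex.norm_cpow_real]

/-- The radius of the half-disks in the strips that are glued to the vertex disks. -/
def radius : ℝ := A.δ ^ (3 / 2 : ℝ)

lemma radius_pos : 0 < A.radius := Real.rpow_pos_of_pos A.δ_pos _

lemma two_radius_le (d : D) : 2 * A.radius ≤ P.length d := A.δ_small d

lemma norm_toVertex_lt {d : D} {z : ℂ} {ε : ℝ} (hε : 0 ≤ ε) :
    ‖A.toVertex d z‖ < ε ↔ ‖z‖ < ε ^ (3 / 2 : ℝ) := by
  rw [norm_toVertex, ← Real.rpow_lt_rpow_iff (x := ‖z‖ ^ (2 / 3 : ℝ)) (z := 3 / 2)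
    (by positivity) hε (by norm_num), ← Real.rpow_mul (norm_nonneg _)]
  norm_num

lemma toVertex_mem {d : D} {z : ℂ} (v : P.Vertex) :
    A.toVertex d z ∈ A.domain (.vertex v) ↔ ‖z‖ < A.radius :=
  A.norm_toVertex_lt A.δ_pos.le

/-- The hypothesis says that the argument of `z` is in `(0, π]`. Passing to `-z` lowers it by `π`,
hence that of the power by `2π/3`, which the phase of `rot d` restores. This is how neighbouring
strips fit together around a vertex. -/
lemma toVertex_rot {d : D} {z : ℂ} (h : 0 < z.im ∨ z.im = 0 ∧ z.re < 0) :
    A.toVertex (P.rot d) (-z) = A.toVertex d z := by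
  have hz : z ≠ 0 := by
    rintro rfl
    simp at h
  have harg := Complex.arg_neg_eq_arg_sub_pi_iff.2 h
  rw [toVertex_eq, toVertex_eq, phase_rot, Complex.cpow_def_of_ne_zero hz,
    Complex.cpow_def_of_ne_zero (neg_ne_zero.2 hz)]
  have hlog : Complex.log (-z) = Complex.log z - Real.pi * Complex.I := by
    rw [Complex.log, Complex.log, harg, norm_neg]
    push_cast
    ring
  rw [hlog, mul_right_comm, ← Complex.exp_add, mul_comm]
  congr 2
  ring

lemma phase_rot_pow (d : D) (n : ℕ) : A.phase ((P.rot ^ n) d) =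
    Complex.exp (2 * Real.pi * Complex.I * n / 3) * A.phase d := by
  induction n with
  | zero => simp
  | succ n ih =>
    rw [add_comm, pow_add, Equiv.Perm.mul_apply, pow_one, phase_rot, ih, ← mul_assoc,
      ← Complex.exp_add]
    congr 2
    push_cast
    ring

lemma exists_toVertex (v : P.Vertex) {w : ℂ} (hw : w ≠ 0) :
    ∃ d, P.vertex d = v ∧ ∃ z, IsUpperPoint z ∧ A.toVertex d z = w := by
  obtain ⟨d₀, rfl⟩ := P.exists_vertex v
  have hpi := Real.pi_pos
  set u := w / A.phase d₀ with hu
  have hu0 : u ≠ 0 := div_ne_zero hw (A.phase_ne_zero _)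
  -- `k` is the sector of `w`, counted from the direction of `d₀`, and `φ` is the remaining angle
  -- inside this sector.
  set k := ⌊u.arg / (2 * Real.pi / 3)⌋ with hk
  set φ := u.arg - k * (2 * Real.pi / 3) with hφ
  have hφ0 : 0 ≤ φ := by
    have := Int.floor_le (u.arg / (2 * Real.pi / 3))
    rw [le_div_iff₀ (by positivity), ← hk] at this
    linarith
  have hφ1 : φ < 2 * Real.pi / 3 := by
    have := Int.lt_floor_add_one (u.arg / (2 * Real.pi / 3))
    rw [div_lt_iff₀ (by positivity), ← hk] at this
    linarith
  have hphase : A.phase ((P.rot ^ (k % 3).toNat) d₀) =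
      Complex.exp (2 * Real.pi * Complex.I * k / 3) * A.phase d₀ := by
    rw [phase_rot_pow]
    congr 1
    have : (((k % 3).toNat : ℤ) : ℂ) = ((k % 3).toNat : ℂ) := by norm_cast
    rw [← this, exp_third_eq_iff, Int.toNat_of_nonneg (Int.emod_nonneg _ (by norm_num))]
    exact Int.mod_modEq k 3
  -- The logarithm of the required `z`; its imaginary part lies in `[0, π)`, which makes `z` an
  -- upper point and the logarithm principal.
  set l : ℂ := ⟨3 / 2 * Real.log ‖u‖, 3 / 2 * φ⟩ with hl
  have hlog : Complex.log (Complex.exp l) = l := by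
    apply Complex.log_exp <;> simp only [hl] <;> linarith
  refine ⟨(P.rot ^ (k % 3).toNat) d₀, ?_, Complex.exp l, ?_, ?_⟩
  · rw [P.vertex_eq_iff, Equiv.Perm.sameCycle_pow_left]
  · rw [IsUpperPoint, Complex.exp_re, Complex.exp_im]
    rcases hφ0.eq_or_lt with h | h
    · right
      simp [hl, ← h, Real.exp_pos]
    · left
      refine mul_pos (Real.exp_pos _) (Real.sin_pos_of_pos_of_lt_pi ?_ ?_) <;>
        simp only [hl] <;> linarith
  · rw [toVertex_eq, hphase, Complex.cpow_def_of_ne_zero (Complex.exp_ne_zero _), hlog,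
      mul_right_comm, ← Complex.exp_add]
    have : 2 * Real.pi * Complex.I * k / 3 + l * (2 / 3) = Complex.log u := by
      apply Complex.ext
      · have : (2 * Real.pi * Complex.I * k / 3 + l * (2 / 3) : ℂ).re = 2 / 3 * l.re := by
          have e : (2 * Real.pi * Complex.I * k / 3 + l * (2 / 3) : ℂ) =
            ((2 * Real.pi * k / 3 : ℝ) : ℂ) * Complex.I + ((2 / 3 : ℝ) : ℂ) * l := by
            push_cast; ring
          rw [e, Complex.add_re, Complex.re_ofReal_mul, Complex.re_ofReal_mul]
          simp
        rw [this, Complex.log_re, hl]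
        ring
      · have : (2 * Real.pi * Complex.I * k / 3 + l * (2 / 3) : ℂ).im =
            2 * Real.pi * k / 3 + 2 / 3 * l.im := by
          have e : (2 * Real.pi * Complex.I * k / 3 + l * (2 / 3) : ℂ) =
            ((2 * Real.pi * k / 3 : ℝ) : ℂ) * Complex.I + ((2 / 3 : ℝ) : ℂ) * l := by
            push_cast; ring
          rw [e, Complex.add_im, Complex.im_ofReal_mul, Complex.im_ofReal_mul]
          simp
        rw [this, Complex.log_im, hl]
        simp only [hφ]
        ring
    rw [this, Complex.exp_log hu0, hu, div_mul_cancel₀ _ (A.phase_ne_zero _)]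

/-- Comparing arguments, those of `z` and `z'` differ by an integer multiple of `π`. Both are in
`[0, π)`, so the multiple is zero and the indices agree modulo three. -/
lemma toVertex_inj {d d' : D} (hv : P.vertex d = P.vertex d') {z z' : ℂ} (hz : IsUpperPoint z)
    (hz' : IsUpperPoint z') (h : A.toVertex d z = A.toVertex d' z') : d = d' ∧ z = z' := by
  have hpi := Real.pi_pos
  have h0 := h
  rw [toVertex_eq, toVertex_eq, phase, phase, Complex.cpow_def_of_ne_zero hz.ne_zero,
    Complex.cpow_def_of_ne_zero hz'.ne_zero, ← Complex.exp_add, ← Complex.exp_add,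
    Complex.exp_eq_exp_iff_exists_int] at h
  obtain ⟨n, hn⟩ := h
  have him : 2 * Real.pi * A.vertexIndex d / 3 + 2 / 3 * z.arg =
      2 * Real.pi * A.vertexIndex d' / 3 + 2 / 3 * z'.arg + n * (2 * Real.pi) := by
    have e (m : ℕ) (x : ℂ) : (2 * Real.pi * Complex.I * m / 3 + Complex.log x * (2 / 3) : ℂ).im =
        2 * Real.pi * m / 3 + 2 / 3 * x.arg := by
      have e : (2 * Real.pi * Complex.I * m / 3 + Complex.log x * (2 / 3) : ℂ) =
        ((2 * Real.pi * m / 3 : ℝ) : ℂ) * Complex.I + ((2 / 3 : ℝ) : ℂ) * Complex.log x := by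
        push_cast; ring
      rw [e, Complex.add_im, Complex.im_ofReal_mul, Complex.im_ofReal_mul]
      simp [Complex.log_im]
    have e2 : ((n : ℂ) * (2 * Real.pi * Complex.I)).im = n * (2 * Real.pi) := by
      have : ((n : ℂ) * (2 * Real.pi * Complex.I)) = ((n * (2 * Real.pi) : ℝ) : ℂ) * Complex.I := by
        push_cast; ring
      rw [this, Complex.im_ofReal_mul]
      simp
    have := congrArg Complex.im hn
    rwa [Complex.add_im _ ((n : ℂ) * (2 * Real.pi * Complex.I)), e, e, e2] at this
  have hk : z.arg - z'.arg =
      Real.pi * ((A.vertexIndex d' - A.vertexIndex d + 3 * n : ℤ) : ℝ) := by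
    push_cast
    linarith
  have hk0 : (A.vertexIndex d' - A.vertexIndex d + 3 * n : ℤ) = 0 := by
    have b1 := hz.arg_nonneg
    have b2 := hz'.arg_nonneg
    have b3 := hz.arg_lt_pi
    have b4 := hz'.arg_lt_pi
    generalize (A.vertexIndex d' - A.vertexIndex d + 3 * n : ℤ) = m at *
    have u1 : (m : ℝ) < 1 := by
      by_contra hcon
      nlinarith [mul_le_mul_of_nonneg_left (not_lt.1 hcon) hpi.le]
    have u2 : (-1 : ℝ) < m := by
      by_contra hcon
      nlinarith [mul_le_mul_of_nonneg_left (not_lt.1 hcon) hpi.le]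
    have u1' : m < 1 := by exact_mod_cast u1
    have u2' : -1 < m := by exact_mod_cast u2
    omega
  have hd : d = d' := by
    apply A.phase_inj hv
    have : ((A.vertexIndex d : ℕ) : ℤ) ≡ (A.vertexIndex d' : ℕ) [ZMOD 3] :=
      Int.modEq_iff_dvd.2 ⟨-n, by linarith⟩
    simpa [phase] using exp_third_eq_iff.2 this
  subst hd
  exact ⟨rfl, A.toVertex_injective d h0⟩

lemma hasDerivAt_toVertex (d : D) {z : ℂ} (hz : z ∈ Complex.slitPlane) :
    HasDerivAt (A.toVertex d) (A.phase d * (2 / 3 * z ^ (2 / 3 - 1 : ℂ))) z := by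
  have h : A.toVertex d = fun z => A.phase d * z ^ (2 / 3 : ℂ) := rfl
  rw [h]
  convert! (((hasDerivAt_id z).cpow_const (c := 2 / 3) hz).const_mul (A.phase d)) using 1
  simp

lemma analyticAt_toVertex (d : D) {z : ℂ} (hz : z ∈ Complex.slitPlane) :
    AnalyticAt ℂ (A.toVertex d) z :=
  analyticAt_const.mul (analyticAt_id.cpow analyticAt_const hz)

lemma deriv_toVertex_ne_zero (d : D) {z : ℂ} (hz : z ∈ Complex.slitPlane) :
    deriv (A.toVertex d) z ≠ 0 := by
  rw [(A.hasDerivAt_toVertex d hz).deriv]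
  refine mul_ne_zero (A.phase_ne_zero d) (mul_ne_zero (by norm_num) ?_)
  rw [Complex.cpow_def_of_ne_zero (Complex.slitPlane_ne_zero hz)]
  exact Complex.exp_ne_zero _

/-- Here `w dw²` is cubic in the phase, whose cube is one, and `9/4` cancels the square of the
exponent `2/3`. Thus the vertex expression pulls back to `dz²`. -/
lemma quadCoeff_toVertex (d : D) (v : P.Vertex) {z : ℂ} (hz : z ∈ Complex.slitPlane) :
    A.quadCoeff (.vertex v) (A.toVertex d z) * deriv (A.toVertex d) z ^ 2 = 1 := by
  have h0 := Complex.slitPlane_ne_zero hz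
  rw [(A.hasDerivAt_toVertex d hz).deriv]
  have e : z ^ (2 / 3 : ℂ) * (z ^ (2 / 3 - 1 : ℂ) * z ^ (2 / 3 - 1 : ℂ)) = 1 := by
    rw [← Complex.cpow_add _ _ h0, ← Complex.cpow_add _ _ h0]
    norm_num
  simp only [quadCoeff, toVertex_eq]
  linear_combination z ^ (2 / 3 : ℂ) * (z ^ (2 / 3 - 1 : ℂ)) ^ 2 * A.phase_pow_three d + e

lemma tendsto_toVertex_zero (d : D) : Tendsto (A.toVertex d) (𝓝 0) (𝓝 0) := by
  rw [Metric.tendsto_nhds_nhds]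
  intro ε hε
  refine ⟨ε ^ (3 / 2 : ℝ), Real.rpow_pos_of_pos hε _, fun z hz => ?_⟩
  rw [dist_zero_right] at hz ⊢
  exact (A.norm_toVertex_lt hε.le).2 hz

lemma hasDerivAt_toCell (d : D) (z : ℂ) : HasDerivAt (A.toCell d)
    (A.toCell d z * (2 * Real.pi * Complex.I / P.perimeter (P.cell d))) z := by
  have h : A.toCell d = fun z => Complex.exp (2 * Real.pi * Complex.I /
    P.perimeter (P.cell d) * (A.cellStart d + z)) := funext (A.toCell_eq d)
  rw [h]
  have := (((hasDerivAt_id z).const_add (A.cellStart d : ℂ)).const_mul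
    (2 * Real.pi * Complex.I / P.perimeter (P.cell d) : ℂ)).cexp
  simpa using this

lemma toCell_ne_zero (d : D) (z : ℂ) : A.toCell d z ≠ 0 := Complex.exp_ne_zero _

lemma analyticAt_toCell (d : D) (z : ℂ) : AnalyticAt ℂ (A.toCell d) z := by
  have h : Differentiable ℂ (A.toCell d) := fun z => (A.hasDerivAt_toCell d z).differentiableAt
  exact h.analyticAt z

lemma continuous_toCell (d : D) : Continuous (A.toCell d) :=
  continuous_iff_continuousAt.2 fun z => (A.analyticAt_toCell d z).continuousAt

lemma deriv_toCell_ne_zero [Finite D] (d : D) (z : ℂ) : deriv (A.toCell d) z ≠ 0 := by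
  rw [(A.hasDerivAt_toCell d z).deriv]
  exact mul_ne_zero (A.toCell_ne_zero d z)
    (div_ne_zero Complex.two_pi_I_ne_zero (A.perimeter_ne_zero _))

/-- The logarithmic derivative of `ζ` is the constant `2πi/L`, so `dζ²/ζ²` is a constant multiple of
`dz²`. -/
lemma quadCoeff_toCell [Finite D] (d : D) (z : ℂ) :
    A.quadCoeff (.cell (P.cell d)) (A.toCell d z) * deriv (A.toCell d) z ^ 2 = 1 := by
  rw [(A.hasDerivAt_toCell d z).deriv]
  have h1 := A.perimeter_ne_zero (P.cell d)
  have h2 := A.toCell_ne_zero d z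
  have h3 : (Real.pi : ℂ) ≠ 0 := by exact_mod_cast Real.pi_ne_zero
  simp only [quadCoeff]
  field_simp
  rw [Complex.I_sq]
  ring

end Labelling

end ConicalPolytope

/-! ### Normal forms, and which coordinates describe the same glued point. -/

namespace ConicalPolytope

variable {D : Type u} {P : ConicalPolytope D}

namespace Labelling

variable (A : P.Labelling)

lemma nonempty_surface : Nonempty A.Surface :=
  ⟨A.vertexPoint (P.vertex P.nonempty.some)⟩

open Classical in
/-- The point of the glued space with coordinate `z` in the patch `i`, with a default value when
`z` is not in the domain of the patch. -/
def glued (i : P.Patch) (z : ℂ) : A.Surface :=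
  if h : z ∈ A.domain i then A.patchMap i ⟨z, h⟩ else A.nonempty_surface.some

lemma glued_of_mem {i : P.Patch} {z : ℂ} (h : z ∈ A.domain i) :
    A.glued i z = A.patchMap i ⟨z, h⟩ := dif_pos h

lemma glued_coe {i : P.Patch} (z : A.domain i) : A.glued i z = A.patchMap i z :=
  A.glued_of_mem z.2

lemma zero_mem_vertex (v : P.Vertex) : (0 : ℂ) ∈ A.domain (.vertex v) := by
  simpa [domain] using A.δ_pos

lemma zero_mem_cell (c : P.Cell) : (0 : ℂ) ∈ A.domain (.cell c) := by simp [domain]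

lemma glued_vertex_zero (v : P.Vertex) : A.glued (.vertex v) 0 = A.vertexPoint v :=
  A.glued_of_mem (A.zero_mem_vertex v)

lemma glued_cell_zero (c : P.Cell) : A.glued (.cell c) 0 = A.puncture c :=
  A.glued_of_mem (A.zero_mem_cell c)

lemma mem_edge {d : D} {z : ℂ} : z ∈ A.domain (.edge d) ↔ 0 < z.re ∧ z.re < P.length d := Iff.rfl

lemma mem_cell {c : P.Cell} {z : ℂ} : z ∈ A.domain (.cell c) ↔ ‖z‖ < 1 := Iff.rfl

lemma mem_vertex {v : P.Vertex} {z : ℂ} : z ∈ A.domain (.vertex v) ↔ ‖z‖ < A.δ := Iff.rfl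

lemma flip_mem {d : D} {z : ℂ} (h : z ∈ A.domain (.edge d)) :
    (P.length d - z : ℂ) ∈ A.domain (.edge (P.opp d)) := by
  rw [mem_edge] at *
  simp [length_opp]
  exact ⟨h.2, h.1⟩

lemma glued_flip {d : D} {z : ℂ} (h : z ∈ A.domain (.edge d)) :
    A.glued (.edge d) z = A.glued (.edge (P.opp d)) (P.length d - z) := by
  rw [A.glued_of_mem h, A.glued_of_mem (A.flip_mem h)]
  exact Quot.sound (Glue.flip d _ _ rfl)

lemma glued_edge_vertex {d : D} {z : ℂ} (h : z ∈ A.domain (.edge d)) (hz : ‖z‖ < A.radius) :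
    A.glued (.edge d) z = A.glued (.vertex (P.vertex d)) (A.toVertex d z) := by
  rw [A.glued_of_mem h, A.glued_of_mem ((A.toVertex_mem _).2 hz)]
  exact Quot.sound (Glue.edgeVertex d _ _ rfl)

/-- This is where the bound on `δ` enters: the half-disks at the two ends of an edge stay on
opposite sides of its midpoint. -/
lemma re_lt_length_of_norm_lt {z : ℂ} (hz : ‖z‖ < A.radius) (d : D) : |z.re| < P.length d / 2 := by
  have h1 := Complex.abs_re_le_norm z
  have h2 := A.two_radius_le d
  linarith

variable [Finite D]

lemma toCell_mem {d : D} {z : ℂ} (c : P.Cell) :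
    A.toCell d z ∈ A.domain (.cell c) ↔ 0 < z.im := A.norm_toCell_lt_one

lemma glued_edge_cell {d : D} {z : ℂ} (h : z ∈ A.domain (.edge d)) (hz : 0 < z.im) :
    A.glued (.edge d) z = A.glued (.cell (P.cell d)) (A.toCell d z) := by
  rw [A.glued_of_mem h, A.glued_of_mem ((A.toCell_mem _).2 hz)]
  exact Quot.sound (Glue.edgeCell d _ _ hz rfl)

lemma glued_cell_next (d : D) (z : ℂ) :
    A.glued (.cell (P.cell (P.next d))) (A.toCell (P.next d) z) =
      A.glued (.cell (P.cell d)) (A.toCell d (P.length d + z)) := by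
  rw [A.toCell_next, P.cell_next]

lemma glued_cell_opp_rot (d : D) (z : ℂ) :
    A.glued (.cell (P.cell d)) (A.toCell d z) = A.glued (.cell (P.cell (P.opp (P.rot d))))
      (A.toCell (P.opp (P.rot d)) (P.length (P.rot d) + z)) := by
  have h := A.glued_cell_next (P.opp (P.rot d)) z
  rwa [P.next_opp_rot, length_opp] at h

/-- The generating identification requires `0 ≤ z.re`. On the other side, the point is reached
through the strip of `rot d`, where it has coordinate `-z`, and the flip of that strip leads back to
the same cell. -/
lemma glued_vertex_cell {d : D} {z : ℂ} (hi : 0 < z.im) (hz : ‖z‖ < A.radius) :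
    A.glued (.vertex (P.vertex d)) (A.toVertex d z) =
      A.glued (.cell (P.cell d)) (A.toCell d z) := by
  have hm := (A.toVertex_mem (d := d) (P.vertex d)).2 hz
  rcases le_or_gt 0 z.re with hr | hr
  · rw [A.glued_of_mem hm, A.glued_of_mem ((A.toCell_mem _).2 hi)]
    exact Quot.sound (Glue.vertexCell d z hr hi _ _ rfl rfl)
  · have hb := abs_lt.1 (A.re_lt_length_of_norm_lt hz (P.rot d))
    have hpos := length_pos (P := P) (P.rot d)
    have hmem : -z ∈ A.domain (.edge (P.rot d)) := by
      rw [mem_edge, Complex.neg_re]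
      constructor <;> linarith
    have h1 := A.glued_edge_vertex hmem (by rwa [norm_neg])
    rw [P.vertex_rot, A.toVertex_rot (Or.inl hi)] at h1
    have hflip := A.flip_mem hmem
    rw [sub_neg_eq_add] at hflip
    rw [← h1, A.glued_flip hmem, sub_neg_eq_add, A.glued_edge_cell hflip (by simpa using hi),
      ← A.glued_cell_opp_rot]

end Labelling

/-- Normal forms of the points of the glued space: a vertex, a point of an open edge given by its
positions from both ends, or a point of the disk of a 2-cell. -/
inductive Core (P : ConicalPolytope D)
  | vertex (v : P.Vertex)
  | edge (e : Sym2 (D × ℝ))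
  | cell (c : P.Cell) (ζ : ℂ)

namespace Labelling

variable (A : P.Labelling)

open Classical in
/-- The normal form of the point of the closed upper half of the strip of `d` with
coordinate `z`. -/
def upperCore (d : D) (z : ℂ) : P.Core :=
  if 0 < z.im then .cell (P.cell d) (A.toCell d z)
  else .edge s((d, z.re), (P.opp d, P.length d - z.re))

lemma upperCore_of_im_pos {d : D} {z : ℂ} (h : 0 < z.im) :
    A.upperCore d z = .cell (P.cell d) (A.toCell d z) := if_pos h

lemma upperCore_of_im_eq {d : D} {z : ℂ} (h : z.im = 0) :
    A.upperCore d z = .edge s((d, z.re), (P.opp d, P.length d - z.re)) := if_neg h.not_gt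

lemma upperCore_flip {d : D} {z : ℂ} (h : z.im = 0) :
    A.upperCore (P.opp d) (P.length d - z) = A.upperCore d z := by
  rw [upperCore_of_im_eq _ h, upperCore_of_im_eq _ (by simp [h]), Sym2.eq_swap]
  simp [P.opp_opp, length_opp]

open Classical in
/-- The normal form of the point with coordinate `z` in a patch. -/
def core : P.Patch → ℂ → P.Core
  | .cell c, ζ => .cell c ζ
  | .edge d, z => if 0 ≤ z.im then A.upperCore d z else A.upperCore (P.opp d) (P.length d - z)
  | .vertex v, w => if h : w = 0 then .vertex v else
      A.upperCore (A.exists_toVertex v h).choose (A.exists_toVertex v h).choose_spec.2.choose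

lemma core_edge_of_nonneg {d : D} {z : ℂ} (h : 0 ≤ z.im) :
    A.core (.edge d) z = A.upperCore d z := if_pos h

lemma core_edge_of_neg {d : D} {z : ℂ} (h : z.im < 0) :
    A.core (.edge d) z = A.upperCore (P.opp d) (P.length d - z) := if_neg h.not_ge

lemma core_cell (c : P.Cell) (ζ : ℂ) : A.core (.cell c) ζ = .cell c ζ := rfl

lemma core_vertex_zero (v : P.Vertex) : A.core (.vertex v) 0 = .vertex v := dif_pos rfl

/-- By `toVertex_inj` the half-edge and upper point chosen in `core` are the only possible ones. -/
lemma core_toVertex {d : D} {z : ℂ} (h : IsUpperPoint z) :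
    A.core (.vertex (P.vertex d)) (A.toVertex d z) = A.upperCore d z := by
  have h0 : A.toVertex d z ≠ 0 := by
    rw [← A.toVertex_zero d]
    exact (A.toVertex_injective d).ne h.ne_zero
  have h1 := (A.exists_toVertex (P.vertex d) h0).choose_spec
  obtain ⟨e1, e2⟩ := A.toVertex_inj h1.1 h1.2.choose_spec.1 h h1.2.choose_spec.2
  rw [core, dif_neg h0, e2, e1]

lemma exists_upper_of_mem_vertex {v : P.Vertex} {w : ℂ} (h : w ∈ A.domain (.vertex v))
    (h0 : w ≠ 0) : ∃ d z, P.vertex d = v ∧ IsUpperPoint z ∧ ‖z‖ < A.radius ∧ A.toVertex d z = w ∧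
      A.core (.vertex v) w = A.upperCore d z := by
  obtain ⟨d, rfl, z, hu, rfl⟩ := A.exists_toVertex v h0
  exact ⟨d, z, rfl, hu, (A.toVertex_mem _).1 h, rfl, A.core_toVertex hu⟩

lemma upperCore_ne_vertex {d : D} {z : ℂ} {v : P.Vertex} : A.upperCore d z ≠ .vertex v := by
  rw [upperCore]
  split_ifs <;> simp

lemma core_eq_vertex {i : P.Patch} {z : ℂ} {v : P.Vertex} (h : A.core i z = .vertex v) :
    i = .vertex v ∧ z = 0 := by
  cases i with
  | vertex v' =>
    by_cases h0 : z = 0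
    · subst h0
      rw [core_vertex_zero] at h
      simp at h
      simp [h]
    · rw [core, dif_neg h0] at h
      exact (A.upperCore_ne_vertex h).elim
  | edge d =>
    rw [core] at h
    split_ifs at h <;> exact (A.upperCore_ne_vertex h).elim
  | cell c => cases h

/-- The exponential never vanishes, so no other patch reaches a puncture. -/
lemma core_eq_cell_zero {i : P.Patch} {z : ℂ} {c : P.Cell} (h : A.core i z = .cell c 0) :
    i = .cell c ∧ z = 0 := by
  have hu (d : D) (z : ℂ) : A.upperCore d z ≠ .cell c 0 := by
    rw [upperCore]
    split_ifs
    · simp only [ne_eq, Core.cell.injEq, not_and]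
      exact fun _ => A.toCell_ne_zero d z
    · simp
  cases i with
  | vertex v' =>
    rw [core] at h
    split_ifs at h
    exact (hu _ _ h).elim
  | edge d =>
    rw [core] at h
    split_ifs at h <;> exact (hu _ _ h).elim
  | cell c =>
    rw [core_cell] at h
    simp at h
    simp [h]

lemma exists_glued (p : A.Surface) : ∃ i, ∃ z ∈ A.domain i, A.glued i z = p := by
  obtain ⟨⟨i, z⟩, rfl⟩ := Quot.exists_rep p
  exact ⟨i, z, z.2, A.glued_coe z⟩

variable [Finite D]

lemma upperCore_opp_rot {d : D} {z : ℂ} (h : 0 < z.im) : A.upperCore d z =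
    A.upperCore (P.opp (P.rot d)) (P.length (P.rot d) + z) := by
  rw [upperCore_of_im_pos _ h, upperCore_of_im_pos _ (by simpa using h)]
  have e := A.toCell_next (P.opp (P.rot d)) z
  rw [P.next_opp_rot, length_opp] at e
  rw [e, P.cell_opp_rot]

lemma core_eq_of_glue {x y : A.Pieces} (h : A.Glue x y) : A.core x.1 x.2 = A.core y.1 y.2 := by
  induction h with
  | flip d z z' h =>
    simp only [h]
    rcases lt_trichotomy (z : ℂ).im 0 with hi | hi | hi
    · rw [core_edge_of_neg _ hi, core_edge_of_nonneg _ (by simpa using hi.le)]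
    · rw [core_edge_of_nonneg _ hi.ge, core_edge_of_nonneg _ (by simp [hi]), upperCore_flip _ hi]
    · rw [core_edge_of_nonneg _ hi.le, core_edge_of_neg _ (by simpa using hi), P.opp_opp,
        length_opp, sub_sub_cancel]
  | edgeVertex d z w h =>
    simp only [h]
    rcases le_or_gt 0 (z : ℂ).im with hi | hi
    · have hu : IsUpperPoint z := by
        rcases hi.eq_or_lt with h0 | h0
        · exact Or.inr ⟨h0.symm, z.2.1⟩
        · exact Or.inl h0
      rw [core_edge_of_nonneg _ hi, core_toVertex _ hu]
    -- A point below the half-edge `rot e` lies in the sector of `e`, with upper coordinate `-z`;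
    -- there the cell is the one to the left of `opp (rot e)`.
    · obtain ⟨e, rfl⟩ := P.rot.surjective d
      have hn : 0 < (-z : ℂ).im := by simpa using hi
      have h1 := A.toVertex_rot (d := e) (Or.inl hn)
      rw [neg_neg] at h1
      rw [core_edge_of_neg _ hi, P.vertex_rot, h1, core_toVertex _ (Or.inl hn),
        A.upperCore_opp_rot hn, sub_eq_add_neg]
  | edgeCell d z ζ him h =>
    simp only [h]
    rw [core_edge_of_nonneg _ him.le, upperCore_of_im_pos _ him, core_cell]
  | vertexCell d z hre him w ζ hw hζ =>
    simp only [hw, hζ]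
    rw [core_toVertex _ (Or.inl him), upperCore_of_im_pos _ him, core_cell]

/-- The normal form of a point of the glued space. -/
def surfaceCore : A.Surface → P.Core :=
  Quot.lift (fun x => A.core x.1 x.2) fun _ _ h => A.core_eq_of_glue h

lemma surfaceCore_glued {i : P.Patch} {z : ℂ} (h : z ∈ A.domain i) :
    A.surfaceCore (A.glued i z) = A.core i z := by
  rw [A.glued_of_mem h]
  rfl

lemma core_eq_of_glued_eq {i j : P.Patch} {z z' : ℂ} (h : z ∈ A.domain i) (h' : z' ∈ A.domain j)
    (he : A.glued i z = A.glued j z') : A.core i z = A.core j z' := by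
  rw [← A.surfaceCore_glued h, he, A.surfaceCore_glued h']

/-- Above the edge the cell coordinate determines the strip and `z`, by `toCell_inj`. On the edge
the unordered pair forgets exactly the orientation, whence the second alternative. -/
lemma upperCore_eq {d d' : D} {z z' : ℂ} (h0 : 0 ≤ z.re) (h1 : z.re < P.length d)
    (h0' : 0 ≤ z'.re) (h1' : z'.re < P.length d') (hi : 0 ≤ z.im) (hi' : 0 ≤ z'.im)
    (h : A.upperCore d z = A.upperCore d' z') :
    (d = d' ∧ z = z') ∨ (z.im = 0 ∧ z'.im = 0 ∧ d' = P.opp d ∧ z' = P.length d - z) := by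
  rcases hi.eq_or_lt with e | hp <;> rcases hi'.eq_or_lt with e' | hp'
  · rw [upperCore_of_im_eq _ e.symm, upperCore_of_im_eq _ e'.symm] at h
    simp only [Core.edge.injEq, Sym2.eq_iff, Prod.mk.injEq] at h
    rcases h with ⟨⟨hd, hr⟩, -⟩ | ⟨⟨hd, hr⟩, hd', hr'⟩
    · exact Or.inl ⟨hd, Complex.ext hr (by rw [← e, ← e'])⟩
    · refine Or.inr ⟨e.symm, e'.symm, hd'.symm, Complex.ext ?_ ?_⟩
      · simp [hr']
      · simp [← e, ← e']
  · rw [upperCore_of_im_eq _ e.symm, upperCore_of_im_pos _ hp'] at h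
    cases h
  · rw [upperCore_of_im_pos _ hp, upperCore_of_im_eq _ e'.symm] at h
    cases h
  · rw [upperCore_of_im_pos _ hp, upperCore_of_im_pos _ hp'] at h
    simp only [Core.cell.injEq] at h
    exact Or.inl (A.toCell_inj h.1 h0 h0' h1 h1' h.2)

lemma eq_or_flip_of_glued_edge_eq {d d' : D} {z z' : ℂ} (h : z ∈ A.domain (.edge d))
    (h' : z' ∈ A.domain (.edge d')) (he : A.glued (.edge d) z = A.glued (.edge d') z') :
    (d = d' ∧ z = z') ∨ (d' = P.opp d ∧ z' = P.length d - z) := by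
  -- Normal forms are given directly in closed upper halves; a lower point is first moved there by
  -- reversing its edge.
  have key : ∀ {d d' : D} {z z' : ℂ}, z ∈ A.domain (.edge d) → z' ∈ A.domain (.edge d') →
      0 ≤ z.im → 0 ≤ z'.im → A.glued (.edge d) z = A.glued (.edge d') z' →
      (d = d' ∧ z = z') ∨ (d' = P.opp d ∧ z' = P.length d - z) := by
    intro d d' z z' h h' hi hi' he
    have hc := A.core_eq_of_glued_eq h h' he
    rw [core_edge_of_nonneg _ hi, core_edge_of_nonneg _ hi'] at hc
    rcases A.upperCore_eq h.1.le h.2 h'.1.le h'.2 hi hi' hc with h | h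
    · exact Or.inl h
    · exact Or.inr h.2.2
  rcases le_or_gt 0 z.im with hi | hi <;> rcases le_or_gt 0 z'.im with hi' | hi'
  · exact key h h' hi hi' he
  · rw [A.glued_flip h'] at he
    rcases key h (A.flip_mem h') hi (by simpa using hi'.le) he with ⟨e1, e2⟩ | ⟨e1, e2⟩
    · right
      rw [e1, e2, P.opp_opp, length_opp]
      simp
    · left
      have e3 := P.opp.injective e1
      subst e3
      exact ⟨rfl, by linear_combination e2⟩
  · rw [A.glued_flip h] at he
    rcases key (A.flip_mem h) h' (by simpa using hi.le) hi' he with ⟨e1, e2⟩ | ⟨e1, e2⟩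
    · exact Or.inr ⟨e1.symm, e2.symm⟩
    · left
      rw [P.opp_opp] at e1
      rw [length_opp] at e2
      exact ⟨e1.symm, by linear_combination -e2⟩
  · rw [A.glued_flip h, A.glued_flip h'] at he
    rcases key (A.flip_mem h) (A.flip_mem h') (by simpa using hi.le) (by simpa using hi'.le) he
      with ⟨e1, e2⟩ | ⟨e1, e2⟩
    · left
      have e3 := P.opp.injective e1
      subst e3
      exact ⟨rfl, by linear_combination -e2⟩
    · right
      have e3 := P.opp.injective e1
      rw [length_opp] at e2
      subst e3
      rw [length_opp] at e2
      exact ⟨rfl, by linear_combination -e2⟩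

lemma eq_of_glued_cell_eq {c c' : P.Cell} {ζ ζ' : ℂ} (h : ζ ∈ A.domain (.cell c))
    (h' : ζ' ∈ A.domain (.cell c')) (he : A.glued (.cell c) ζ = A.glued (.cell c') ζ') :
    c = c' ∧ ζ = ζ' := by
  have := A.core_eq_of_glued_eq h h' he
  rw [core_cell, core_cell] at this
  simpa using this

lemma of_glued_edge_eq_cell {d : D} {c : P.Cell} {z ζ : ℂ} (h : z ∈ A.domain (.edge d))
    (h' : ζ ∈ A.domain (.cell c)) (he : A.glued (.edge d) z = A.glued (.cell c) ζ) :
    (0 < z.im ∧ P.cell d = c ∧ A.toCell d z = ζ) ∨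
      (z.im < 0 ∧ P.cell (P.opp d) = c ∧ A.toCell (P.opp d) (P.length d - z) = ζ) := by
  have hc := A.core_eq_of_glued_eq h h' he
  rw [core_cell] at hc
  rcases lt_trichotomy z.im 0 with hi | hi | hi
  · rw [core_edge_of_neg _ hi, upperCore_of_im_pos _ (by simpa using hi)] at hc
    simp only [Core.cell.injEq] at hc
    exact Or.inr ⟨hi, hc⟩
  · rw [core_edge_of_nonneg _ hi.ge, upperCore_of_im_eq _ hi] at hc
    cases hc
  · rw [core_edge_of_nonneg _ hi.le, upperCore_of_im_pos _ hi] at hc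
    simp only [Core.cell.injEq] at hc
    exact Or.inl ⟨hi, hc⟩

/-- A point of a vertex disk is in the closed upper half of a strip, near one of its ends. -/
lemma exists_upperCore_eq {d : D} {z : ℂ} (hu : IsUpperPoint z) (hz : ‖z‖ < A.radius) :
    (0 ≤ z.re ∧ z.re < P.length d / 2) ∨ (z.re < 0 ∧ 0 < z.im ∧
      A.upperCore d z = A.upperCore (P.opp (P.rot d)) (P.length (P.rot d) + z) ∧
      P.length (P.rot d) / 2 < (P.length (P.rot d) + z).re) := by
  have h1 := abs_lt.1 (A.re_lt_length_of_norm_lt hz d)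
  have h2 := abs_lt.1 (A.re_lt_length_of_norm_lt hz (P.rot d))
  rcases le_or_gt 0 z.re with h | h
  · exact Or.inl ⟨h, h1.2⟩
  · have hi : 0 < z.im := by
      rcases hu with hu | hu
      · exact hu
      · linarith [hu.2]
    refine Or.inr ⟨h, hi, A.upperCore_opp_rot hi, ?_⟩
    simp only [Complex.add_re, Complex.ofReal_re]
    linarith

/-- A point near a vertex is near the start or near the end of a closed upper half-strip. The
midpoint separates these cases, and within each case the normal form determines the half-edge. Hence
vertex disks are disjoint and embedded. -/
lemma eq_of_upperCore_eq {d d' : D} {z z' : ℂ} (hu : IsUpperPoint z) (hu' : IsUpperPoint z')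
    (hz : ‖z‖ < A.radius) (hz' : ‖z'‖ < A.radius) (h : A.upperCore d z = A.upperCore d' z') :
    d = d' ∧ z = z' := by
  have hl := length_pos (P := P)
  have him (e : D) (z : ℂ) : (P.length e + z : ℂ).im = z.im := by simp
  have key : ∀ {d d' : D} {z z' : ℂ}, 0 ≤ z.re → z.re < P.length d / 2 → z'.re < 0 → 0 ≤ z.im →
      0 < z'.im → A.upperCore d z = A.upperCore (P.opp (P.rot d')) (P.length (P.rot d') + z') →
      P.length (P.rot d') / 2 < (P.length (P.rot d') + z').re → False := by
    intro d d' z z' h1 h2 h3 hi hi' he h4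
    have := hl d
    have := hl (P.rot d')
    rcases A.upperCore_eq h1 (by linarith) (by linarith)
      (by rw [length_opp]; simp [h3]) hi (by rw [him]; exact hi'.le) he with ⟨e1, e2⟩ | ⟨e1, e2, -⟩
    · rw [← e2] at h4
      rw [e1, length_opp] at h2
      linarith
    · rw [him] at e2
      linarith
  rcases A.exists_upperCore_eq (d := d) hu hz with ⟨a1, a2⟩ | ⟨a1, a2, a3, a4⟩ <;>
  rcases A.exists_upperCore_eq (d := d') hu' hz' with ⟨b1, b2⟩ | ⟨b1, b2, b3, b4⟩
  · have := hl d
    have := hl d'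
    rcases A.upperCore_eq a1 (by linarith) b1 (by linarith) hu.im_nonneg hu'.im_nonneg h with
      e | ⟨-, -, e1, e2⟩
    · exact e
    · rw [e1, length_opp, e2] at b2
      simp at b2
      linarith
  · rw [b3] at h
    exact (key a1 a2 b1 hu.im_nonneg b2 h b4).elim
  · rw [a3] at h
    exact (key b1 b2 a1 hu'.im_nonneg a2 h.symm a4).elim
  · rw [a3, b3] at h
    have := hl (P.rot d)
    have := hl (P.rot d')
    rcases A.upperCore_eq (by linarith) (by rw [length_opp]; simp [a1]) (by linarith)
      (by rw [length_opp]; simp [b1]) (by rw [him]; exact a2.le) (by rw [him]; exact b2.le) h with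
      ⟨e1, e2⟩ | ⟨e1, -⟩
    · have := P.rot.injective (P.opp.injective e1)
      subst this
      exact ⟨rfl, by linear_combination e2⟩
    · rw [him] at e1
      linarith

lemma of_glued_eq_vertexPoint {i : P.Patch} {z : ℂ} (h : z ∈ A.domain i) {v : P.Vertex}
    (he : A.glued i z = A.vertexPoint v) : i = .vertex v ∧ z = 0 := by
  rw [← glued_vertex_zero] at he
  have := A.core_eq_of_glued_eq h (A.zero_mem_vertex v) he
  rw [core_vertex_zero] at this
  exact A.core_eq_vertex this

lemma of_glued_eq_puncture {i : P.Patch} {z : ℂ} (h : z ∈ A.domain i) {c : P.Cell}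
    (he : A.glued i z = A.puncture c) : i = .cell c ∧ z = 0 := by
  rw [← glued_cell_zero] at he
  have := A.core_eq_of_glued_eq h (A.zero_mem_cell c) he
  rw [core_cell] at this
  exact A.core_eq_cell_zero this

lemma eq_of_glued_vertex_eq {v v' : P.Vertex} {w w' : ℂ} (h : w ∈ A.domain (.vertex v))
    (h' : w' ∈ A.domain (.vertex v')) (he : A.glued (.vertex v) w = A.glued (.vertex v') w') :
    v = v' ∧ w = w' := by
  by_cases h0 : w = 0
  · subst h0
    rw [glued_vertex_zero] at he
    have := A.of_glued_eq_vertexPoint h' he.symm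
    simp only [Patch.vertex.injEq] at this
    exact ⟨this.1.symm, this.2.symm⟩
  by_cases h0' : w' = 0
  · subst h0'
    rw [glued_vertex_zero] at he
    have := A.of_glued_eq_vertexPoint h he
    simpa only [Patch.vertex.injEq] using this
  have hc := A.core_eq_of_glued_eq h h' he
  obtain ⟨d, z, rfl, hu, hz, rfl, e⟩ := A.exists_upper_of_mem_vertex h h0
  obtain ⟨d', z', rfl, hu', hz', rfl, e'⟩ := A.exists_upper_of_mem_vertex h' h0'
  rw [e, e'] at hc
  obtain ⟨rfl, rfl⟩ := A.eq_of_upperCore_eq hu hu' hz hz' hc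
  exact ⟨rfl, rfl⟩

lemma glued_injOn (i : P.Patch) : Set.InjOn (A.glued i) (A.domain i) := fun z h z' h' he => by
  cases i with
  | vertex v => exact (A.eq_of_glued_vertex_eq h h' he).2
  | edge d =>
    rcases A.eq_or_flip_of_glued_edge_eq h h' he with e | e
    · exact e.2
    · exact (P.opp_ne d e.1.symm).elim
  | cell c => exact (A.eq_of_glued_cell_eq h h' he).2

/-- Only this trace of the overlap is needed for separation: the modulus of `w` measures the
distance of `z` from one end of its edge. -/
lemma norm_eq_of_glued_vertex_eq_edge {v : P.Vertex} {d : D} {w z : ℂ}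
    (h : w ∈ A.domain (.vertex v)) (h' : z ∈ A.domain (.edge d))
    (he : A.glued (.vertex v) w = A.glued (.edge d) z) :
    ‖w‖ = ‖z‖ ^ (2 / 3 : ℝ) ∨ ‖w‖ = ‖(P.length d - z : ℂ)‖ ^ (2 / 3 : ℝ) := by
  have key : ∀ {d : D} {z : ℂ}, z ∈ A.domain (.edge d) → 0 ≤ z.im →
      A.glued (.vertex v) w = A.glued (.edge d) z →
      ‖w‖ = ‖z‖ ^ (2 / 3 : ℝ) ∨ ‖w‖ = ‖(P.length d - z : ℂ)‖ ^ (2 / 3 : ℝ) := by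
    intro d z h' hi he
    have h0 : w ≠ 0 := by
      rintro rfl
      rw [glued_vertex_zero] at he
      cases (A.of_glued_eq_vertexPoint h' he.symm).1
    have hc := A.core_eq_of_glued_eq h h' he
    obtain ⟨d', z', rfl, hu, hz, rfl, e⟩ := A.exists_upper_of_mem_vertex h h0
    have := length_pos (P := P) d'
    have := length_pos (P := P) (P.rot d')
    rw [norm_toVertex]
    rw [e, core_edge_of_nonneg _ hi] at hc
    rcases A.exists_upperCore_eq (d := d') hu hz with ⟨a1, a2⟩ | ⟨a1, a2, a3, a4⟩
    · rcases A.upperCore_eq a1 (by linarith) h'.1.le h'.2 hu.im_nonneg hi hc with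
        ⟨-, e⟩ | ⟨-, -, e1, e2⟩
      · rw [e]; exact Or.inl rfl
      · right
        rw [e1, e2, length_opp, sub_sub_cancel]
    · rw [a3] at hc
      rcases A.upperCore_eq (by linarith) (by rw [length_opp]; simp [a1]) h'.1.le h'.2
        (by simpa using a2.le) hi hc with ⟨e1, e2⟩ | ⟨e1, -⟩
      · right
        rw [← e1, ← e2, length_opp, sub_add_cancel_left, norm_neg]
      · simp at e1
        linarith
  rcases le_or_gt 0 z.im with hi | hi
  · exact key h' hi he
  · rw [A.glued_flip h'] at he
    have := key (A.flip_mem h') (by simpa using hi.le) he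
    rwa [length_opp, sub_sub_cancel, or_comm] at this

lemma of_glued_vertex_eq_cell {v : P.Vertex} {c : P.Cell} {w ζ : ℂ}
    (h : w ∈ A.domain (.vertex v)) (h' : ζ ∈ A.domain (.cell c))
    (he : A.glued (.vertex v) w = A.glued (.cell c) ζ) :
    ∃ d z, P.cell d = c ∧ A.toVertex d z = w ∧ A.toCell d z = ζ := by
  have h0 : w ≠ 0 := by
    rintro rfl
    rw [glued_vertex_zero] at he
    cases (A.of_glued_eq_vertexPoint h' he.symm).1
  have hc := A.core_eq_of_glued_eq h h' he
  obtain ⟨d, z, rfl, hu, hz, rfl, e⟩ := A.exists_upper_of_mem_vertex h h0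
  rw [e, core_cell] at hc
  rcases hu with hu | hu
  · rw [upperCore_of_im_pos _ hu] at hc
    simp only [Core.cell.injEq] at hc
    exact ⟨d, z, hc.1, rfl, hc.2⟩
  · rw [upperCore_of_im_eq _ hu.1] at hc
    cases hc

/-- Every point of the glued space is a point of the disk of a 2-cell, of the real segment of a
strip, or the centre of a vertex disk. -/
lemma exists_cell_or_edge_or_vertex (p : A.Surface) :
    (∃ c, ∃ ζ ∈ A.domain (.cell c), A.glued (.cell c) ζ = p) ∨
    (∃ d, ∃ t : ℝ, (t : ℂ) ∈ A.domain (.edge d) ∧ A.glued (.edge d) t = p) ∨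
    ∃ v, A.vertexPoint v = p := by
  obtain ⟨i, z, h, rfl⟩ := A.exists_glued p
  cases i with
  | vertex v =>
    by_cases h0 : z = 0
    · subst h0
      exact Or.inr (Or.inr ⟨v, (A.glued_vertex_zero v).symm⟩)
    obtain ⟨d, z, rfl, hu, hz, rfl, e⟩ := A.exists_upper_of_mem_vertex h h0
    rcases hu with hu | hu
    · exact Or.inl ⟨P.cell d, _, (A.toCell_mem _).2 hu, (A.glued_vertex_cell hu hz).symm⟩
    · have hm : z ∈ A.domain (.edge d) := by
        refine ⟨hu.2, ?_⟩
        have := abs_lt.1 (A.re_lt_length_of_norm_lt hz d)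
        linarith [length_pos (P := P) d]
      have hr : ((z.re : ℝ) : ℂ) = z := Complex.ext rfl hu.1.symm
      refine Or.inr (Or.inl ⟨d, z.re, ?_, ?_⟩)
      · rwa [hr]
      · rw [hr, A.glued_edge_vertex hm hz]
  | edge d =>
    rcases lt_trichotomy z.im 0 with hi | hi | hi
    · have hi' : 0 < (P.length d - z : ℂ).im := by simpa using hi
      exact Or.inl ⟨_, _, (A.toCell_mem _).2 hi',
        by rw [A.glued_flip h, A.glued_edge_cell (A.flip_mem h) hi']⟩
    · have hr : ((z.re : ℝ) : ℂ) = z := Complex.ext rfl hi.symm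
      exact Or.inr (Or.inl ⟨d, z.re, by rwa [hr], by rw [hr]⟩)
    · exact Or.inl ⟨_, _, (A.toCell_mem _).2 hi, (A.glued_edge_cell h hi).symm⟩
  | cell c => exact Or.inl ⟨c, z, h, rfl⟩

end Labelling

end ConicalPolytope

/-! ### Holomorphic transitions and the charts given by the patches. -/

/-- A holomorphic germ with non-zero derivative has a holomorphic right inverse germ. -/
lemma AnalyticAt.exists_right_inverse {f : ℂ → ℂ} {z : ℂ} (hf : AnalyticAt ℂ f z)
    (hd : deriv f z ≠ 0) : ∃ r : ℂ → ℂ, AnalyticAt ℂ r (f z) ∧ r (f z) = z ∧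
      ∀ᶠ w in 𝓝 (f z), f (r w) = w :=
  ⟨hf.hasStrictDerivAt.localInverse _ _ _ hd, hf.analyticAt_localInverse hd,
    HasStrictFDerivAt.localInverse_apply_image ..,
    (hf.hasStrictDerivAt.hasStrictFDerivAt_equiv hd).eventually_right_inverse⟩

namespace ConicalPolytope

namespace Labelling

variable {D : Type u} {P : ConicalPolytope D} (A : P.Labelling)

lemma isOpen_domain (i : P.Patch) : IsOpen (A.domain i) := by
  cases i with
  | vertex v => exact isOpen_lt continuous_norm continuous_const
  | edge d =>
    exact (isOpen_lt continuous_const Complex.continuous_re).inter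
      (isOpen_lt Complex.continuous_re continuous_const)
  | cell c => exact isOpen_lt continuous_norm continuous_const

lemma nonempty_domain (i : P.Patch) : Nonempty (A.domain i) := by
  cases i with
  | vertex v => exact ⟨⟨0, A.zero_mem_vertex v⟩⟩
  | edge d =>
    have := length_pos (P := P) d
    exact ⟨⟨(P.length d / 2 : ℝ), by simp [mem_edge]; linarith⟩⟩
  | cell c => exact ⟨⟨0, A.zero_mem_cell c⟩⟩

lemma continuous_patchMap (i : P.Patch) : Continuous (A.patchMap i) :=
  continuous_quot_mk.comp continuous_sigmaMk

lemma continuousOn_glued (i : P.Patch) : ContinuousOn (A.glued i) (A.domain i) := by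
  rw [continuousOn_iff_continuous_domRestrict]
  convert! A.continuous_patchMap i using 1
  ext z
  exact A.glued_coe z

lemma continuousAt_glued {i : P.Patch} {z : ℂ} (h : z ∈ A.domain i) :
    ContinuousAt (A.glued i) z :=
  (A.continuousOn_glued i).continuousAt ((A.isOpen_domain i).mem_nhds h)

/-- Near two points of patches, given by their coordinates, the patches are identified by
holomorphic germs with a common parameter, compatibly with the quadratic differential. -/
def Linked (i : P.Patch) (x : ℂ) (j : P.Patch) (y : ℂ) : Prop :=
  ∃ (f g : ℂ → ℂ) (z₀ : ℂ), AnalyticAt ℂ f z₀ ∧ AnalyticAt ℂ g z₀ ∧ deriv f z₀ ≠ 0 ∧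
    deriv g z₀ ≠ 0 ∧ f z₀ = x ∧ g z₀ = y ∧ ∀ᶠ z in 𝓝 z₀, f z ∈ A.domain i ∧ g z ∈ A.domain j ∧
      A.glued i (f z) = A.glued j (g z) ∧
      A.quadCoeff i (f z) * deriv f z ^ 2 = A.quadCoeff j (g z) * deriv g z ^ 2

variable {A}

lemma Linked.refl {i : P.Patch} {x : ℂ} (h : x ∈ A.domain i) : A.Linked i x i x := by
  refine ⟨id, id, x, analyticAt_id, analyticAt_id, by simp, by simp, rfl, rfl, ?_⟩
  filter_upwards [(A.isOpen_domain i).mem_nhds h] with z hz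
  exact ⟨hz, hz, rfl, rfl⟩

lemma Linked.symm {i j : P.Patch} {x y : ℂ} (h : A.Linked i x j y) : A.Linked j y i x := by
  obtain ⟨f, g, z, h1, h2, h3, h4, h5, h6, h7⟩ := h
  refine ⟨g, f, z, h2, h1, h4, h3, h6, h5, ?_⟩
  filter_upwards [h7] with w hw
  exact ⟨hw.2.1, hw.1, hw.2.2.1.symm, hw.2.2.2.symm⟩

/-- The coordinate of the second patch as a function of that of the first one. -/
lemma Linked.exists_transition {i j : P.Patch} {x y : ℂ} (h : A.Linked i x j y) :
    ∃ g : ℂ → ℂ, AnalyticAt ℂ g x ∧ deriv g x ≠ 0 ∧ g x = y ∧ ∀ᶠ z in 𝓝 x, z ∈ A.domain i ∧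
      g z ∈ A.domain j ∧ A.glued i z = A.glued j (g z) ∧
      A.quadCoeff i z = A.quadCoeff j (g z) * deriv g z ^ 2 := by
  obtain ⟨f, g, z, hf, hg, hf', hg', rfl, rfl, h⟩ := h
  obtain ⟨r, hr, hrz, hfr⟩ := hf.exists_right_inverse hf'
  -- The chain rule for `f ∘ r = id` makes the two derivatives reciprocal; this turns the symmetric
  -- identity of coefficients into a transformation law.
  have key : ∀ {w}, AnalyticAt ℂ r w → f (r w) = w → AnalyticAt ℂ f (r w) →
      (∀ᶠ w in 𝓝 w, f (r w) = w) → deriv f (r w) * deriv r w = 1 := by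
    intro w h1 h2 h3 h4
    have h5 := (h3.differentiableAt.hasDerivAt).comp w h1.differentiableAt.hasDerivAt
    have h6 : HasDerivAt (f ∘ r) 1 w :=
      (hasDerivAt_id w).congr_of_eventuallyEq (by filter_upwards [h4] with u hu using hu)
    exact h5.unique h6
  have hgr : AnalyticAt ℂ (g ∘ r) (f z) := AnalyticAt.comp (by rwa [hrz]) hr
  have hchain : ∀ {w}, AnalyticAt ℂ g (r w) → AnalyticAt ℂ r w →
      deriv (g ∘ r) w = deriv g (r w) * deriv r w := fun h1 h2 =>
    deriv_comp _ h1.differentiableAt h2.differentiableAt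
  have htends : Tendsto r (𝓝 (f z)) (𝓝 z) := by
    have := hr.continuousAt.tendsto
    rwa [hrz] at this
  refine ⟨g ∘ r, hgr, ?_, by simp [hrz], ?_⟩
  · rw [hchain (by rwa [hrz]) hr, hrz]
    refine mul_ne_zero hg' fun h0 => ?_
    have := key hr (by rw [hrz]) (by rwa [hrz]) hfr
    rw [h0, mul_zero] at this
    exact zero_ne_one this
  · filter_upwards [htends.eventually h, htends.eventually hf.eventually_analyticAt,
      htends.eventually hg.eventually_analyticAt, hr.eventually_analyticAt,
      hfr.eventually_nhds] with w hw hfw hgw hrw hev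
    have e := hev.self_of_nhds
    rw [e] at hw
    refine ⟨hw.1, hw.2.1, hw.2.2.1, ?_⟩
    have h1 := key hrw e hfw hev
    rw [hchain hgw hrw, mul_pow, ← mul_assoc, Function.comp_apply, ← hw.2.2.2, mul_assoc, ← mul_pow,
      h1, one_pow, mul_one]

lemma Linked.trans {i j k : P.Patch} {x y z : ℂ} (h : A.Linked i x j y) (h' : A.Linked j y k z) :
    A.Linked i x k z := by
  obtain ⟨r, hr, hr', hry, hev⟩ := h'.exists_transition
  obtain ⟨f, g, z₀, hf, hg, hf', hg', rfl, rfl, h⟩ := h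
  have hchain : ∀ {w}, AnalyticAt ℂ r (g w) → AnalyticAt ℂ g w →
      deriv (r ∘ g) w = deriv r (g w) * deriv g w := fun h1 h2 =>
    deriv_comp _ h1.differentiableAt h2.differentiableAt
  refine ⟨f, r ∘ g, z₀, hf, hr.comp hg, hf', ?_, rfl, hry, ?_⟩
  · rw [hchain hr hg]
    exact mul_ne_zero hr' hg'
  · filter_upwards [h, hg.continuousAt.eventually hev, hg.eventually_analyticAt,
      hg.continuousAt.eventually hr.eventually_analyticAt] with w h1 h2 h3 h4
    refine ⟨h1.1, h2.2.1, h1.2.2.1.trans h2.2.2.1, ?_⟩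
    rw [h1.2.2.2, h2.2.2.2, hchain h4 h3, Function.comp_apply]
    ring

/-- Stated for every chart with the property, not only for `chart`, so that it also serves for the
arbitrary complex structures in the canonicity statement. -/
lemma IsPatchChart.symm_eq_glued {i : P.Patch} {e : OpenPartialHomeomorph A.Surface ℂ}
    (he : A.IsPatchChart i e) {z : ℂ} (h : z ∈ A.domain i) : e.symm z = A.glued i z := by
  rw [A.glued_of_mem h]
  exact he.2 ⟨z, h⟩

lemma IsPatchChart.glued_mem_source {i : P.Patch} {e : OpenPartialHomeomorph A.Surface ℂ}
    (he : A.IsPatchChart i e) {z : ℂ} (h : z ∈ A.domain i) : A.glued i z ∈ e.source := by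
  rw [← he.symm_eq_glued h]
  exact e.map_target (by rwa [he.1])

lemma IsPatchChart.apply_glued {i : P.Patch} {e : OpenPartialHomeomorph A.Surface ℂ}
    (he : A.IsPatchChart i e) {z : ℂ} (h : z ∈ A.domain i) : e (A.glued i z) = z := by
  rw [← he.symm_eq_glued h]
  exact e.right_inv (by rwa [he.1])

lemma IsPatchChart.exists_of_mem_source {i : P.Patch} {e : OpenPartialHomeomorph A.Surface ℂ}
    (he : A.IsPatchChart i e) {p : A.Surface} (hp : p ∈ e.source) :
    e p ∈ A.domain i ∧ A.glued i (e p) = p := by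
  have h : e p ∈ A.domain i := by
    rw [← he.1]
    exact e.map_source hp
  exact ⟨h, by rw [← he.symm_eq_glued h, e.left_inv hp]⟩

variable [Finite D]

lemma linked_of_glue {x y : A.Pieces} (h : A.Glue x y) : A.Linked x.1 x.2 y.1 y.2 := by
  induction h with
  | flip d z z' h =>
    simp only [h]
    have hd (w : ℂ) : HasDerivAt (fun z : ℂ => (P.length d : ℂ) - z) (-1) w :=
      (hasDerivAt_id w).const_sub _
    refine ⟨id, fun z => P.length d - z, z, analyticAt_id, analyticAt_const.sub analyticAt_id,
      by simp, by rw [(hd _).deriv]; simp, rfl, rfl, ?_⟩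
    filter_upwards [(A.isOpen_domain _).mem_nhds z.2] with w hw
    refine ⟨hw, A.flip_mem hw, A.glued_flip hw, ?_⟩
    rw [(hd _).deriv, deriv_id]
    simp [quadCoeff]
  | edgeVertex d z w h =>
    have hs {z : ℂ} (hz : z ∈ A.domain (.edge d)) : z ∈ Complex.slitPlane := Or.inl hz.1
    have hz : ‖(z : ℂ)‖ < A.radius := (A.toVertex_mem (d := d) (P.vertex d)).1 (h ▸ w.2)
    simp only [h]
    refine ⟨id, A.toVertex d, z, analyticAt_id, A.analyticAt_toVertex d (hs z.2), by simp,
      A.deriv_toVertex_ne_zero d (hs z.2), rfl, rfl, ?_⟩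
    filter_upwards [(A.isOpen_domain _).mem_nhds z.2,
      (isOpen_lt continuous_norm continuous_const).mem_nhds hz] with u hu hr
    refine ⟨hu, (A.toVertex_mem _).2 hr, A.glued_edge_vertex hu hr, ?_⟩
    rw [A.quadCoeff_toVertex d _ (hs hu), deriv_id]
    simp [quadCoeff]
  | edgeCell d z ζ him h =>
    simp only [h]
    refine ⟨id, A.toCell d, z, analyticAt_id, A.analyticAt_toCell d _, by simp,
      A.deriv_toCell_ne_zero d _, rfl, rfl, ?_⟩
    filter_upwards [(A.isOpen_domain _).mem_nhds z.2,
      (isOpen_lt continuous_const Complex.continuous_im).mem_nhds him] with u hu hi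
    refine ⟨hu, (A.toCell_mem _).2 hi, A.glued_edge_cell hu hi, ?_⟩
    rw [A.quadCoeff_toCell d, deriv_id]
    simp [quadCoeff]
  | vertexCell d z hre him w ζ hw hζ =>
    have hs {z : ℂ} (hz : 0 < z.im) : z ∈ Complex.slitPlane := Or.inr hz.ne'
    have hz : ‖(z : ℂ)‖ < A.radius := (A.toVertex_mem (d := d) (P.vertex d)).1 (hw ▸ w.2)
    simp only [hw, hζ]
    refine ⟨A.toVertex d, A.toCell d, z, A.analyticAt_toVertex d (hs him),
      A.analyticAt_toCell d _, A.deriv_toVertex_ne_zero d (hs him),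
      A.deriv_toCell_ne_zero d _, rfl, rfl, ?_⟩
    filter_upwards [(isOpen_lt continuous_norm continuous_const).mem_nhds hz,
      (isOpen_lt continuous_const Complex.continuous_im).mem_nhds him] with u hr hi
    refine ⟨(A.toVertex_mem _).2 hr, (A.toCell_mem _).2 hi, A.glued_vertex_cell hi hr, ?_⟩
    rw [A.quadCoeff_toCell d, A.quadCoeff_toVertex d _ (hs hi)]

/-- Equality in the quotient is a chain of generating identifications, and being linked is
reflexive, symmetric and transitive. -/
lemma linked_of_glued_eq {i j : P.Patch} {x y : ℂ} (hx : x ∈ A.domain i) (hy : y ∈ A.domain j)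
    (h : A.glued i x = A.glued j y) : A.Linked i x j y := by
  rw [A.glued_of_mem hx, A.glued_of_mem hy] at h
  have key : ∀ {x y : A.Pieces}, Relation.EqvGen A.Glue x y → A.Linked x.1 x.2 y.1 y.2 := by
    intro x y h
    induction h with
    | rel x y h => exact linked_of_glue h
    | refl x => exact Linked.refl x.2.2
    | symm x y _ ih => exact ih.symm
    | trans x y z _ _ ih ih' => exact ih.trans ih'
  exact key (Quot.eqvGen_exact h)

variable (A)

/-- Openness is tested on the preimage in each patch. Near a point of this preimage the transition
germ is continuous, keeps nearby points in `U`, and is compatible with the gluing. -/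
lemma isOpen_glued_image {i : P.Patch} {U : Set ℂ} (hU : IsOpen U) (hi : U ⊆ A.domain i) :
    IsOpen (A.glued i '' U) := by
  refine isOpen_coinduced.2 (isOpen_sigma_iff.2 fun j => ?_)
  rw [isOpen_iff_mem_nhds]
  rintro y ⟨x, hx, hxy⟩
  replace hxy : A.glued i x = A.glued j y := hxy.trans (A.glued_coe y).symm
  obtain ⟨g, hg, -, hgx, hev⟩ := (linked_of_glued_eq y.2 (hi hx) hxy.symm).exists_transition
  have hmem : ∀ᶠ z in 𝓝 (y : ℂ), g z ∈ U :=
    hg.continuousAt.eventually (by rw [hgx]; exact hU.mem_nhds hx)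
  have hcoe : Tendsto (Subtype.val : A.domain j → ℂ) (𝓝 y) (𝓝 y) :=
    continuous_subtype_val.continuousAt
  filter_upwards [hcoe.eventually hmem, hcoe.eventually hev] with z hz hz'
  exact ⟨g z, hz, hz'.2.2.1.symm.trans (A.glued_coe z)⟩

lemma patchMap_injective (i : P.Patch) : Function.Injective (A.patchMap i) := fun z z' h => by
  rw [← A.glued_coe, ← A.glued_coe] at h
  exact Subtype.ext (A.glued_injOn i z.2 z'.2 h)

lemma isOpenMap_patchMap (i : P.Patch) : IsOpenMap (A.patchMap i) := fun U hU => by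
  have h := A.isOpen_glued_image (U := Subtype.val '' U)
    ((A.isOpen_domain i).isOpenEmbedding_subtypeVal.isOpenMap U hU)
    (i := i) (by rintro _ ⟨z, -, rfl⟩; exact z.2)
  convert! h using 1
  ext p
  simp only [mem_image, exists_exists_and_eq_and]
  exact exists_congr fun z => by rw [A.glued_coe]

lemma isOpenEmbedding_patchMap (i : P.Patch) : Topology.IsOpenEmbedding (A.patchMap i) :=
  .of_continuous_injective_isOpenMap (A.continuous_patchMap i) (A.patchMap_injective i)
    (A.isOpenMap_patchMap i)

/-- The uniformizing coordinate of a patch as a chart of the glued space. -/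
def chart (i : P.Patch) : OpenPartialHomeomorph A.Surface ℂ :=
  haveI := A.nonempty_domain i
  ((A.isOpenEmbedding_patchMap i).toOpenPartialHomeomorph).symm.trans
    ((⟨A.domain i, A.isOpen_domain i⟩ : TopologicalSpace.Opens ℂ).openPartialHomeomorphSubtypeCoe
      (A.nonempty_domain i))

lemma chart_target (i : P.Patch) : (A.chart i).target = A.domain i := by
  simp [chart]

lemma chart_symm_coe (i : P.Patch) (z : A.domain i) : (A.chart i).symm z = A.patchMap i z := by
  have := A.nonempty_domain i
  have h := ((⟨A.domain i, A.isOpen_domain i⟩ :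
    TopologicalSpace.Opens ℂ).openPartialHomeomorphSubtypeCoe
      (A.nonempty_domain i)).left_inv (x := z) (by simp)
  simp only [TopologicalSpace.Opens.openPartialHomeomorphSubtypeCoe_coe] at h
  simp only [chart, OpenPartialHomeomorph.coe_trans_symm, Function.comp_apply,
    OpenPartialHomeomorph.symm_symm, Topology.IsOpenEmbedding.toOpenPartialHomeomorph_apply]
  exact congrArg _ h

lemma isPatchChart_chart (i : P.Patch) : A.IsPatchChart i (A.chart i) :=
  ⟨A.chart_target i, A.chart_symm_coe i⟩

variable {A}

/-- Transitions between patch charts are holomorphic and compatible with the coefficients of the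
quadratic differential. -/
lemma IsPatchChart.transition {i j : P.Patch} {e e' : OpenPartialHomeomorph A.Surface ℂ}
    (he : A.IsPatchChart i e) (he' : A.IsPatchChart j e') {z : ℂ} (hz : z ∈ e.target)
    (hz' : e.symm z ∈ e'.source) : AnalyticAt ℂ (e' ∘ e.symm) z ∧
      A.quadCoeff i z = A.quadCoeff j (e' (e.symm z)) * deriv (e' ∘ e.symm) z ^ 2 := by
  rw [he.1] at hz
  obtain ⟨h1, h2⟩ := he'.exists_of_mem_source hz'
  obtain ⟨g, hg, -, hgz, hev⟩ := (linked_of_glued_eq hz h1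
    (by rw [h2, he.symm_eq_glued hz])).exists_transition
  have heq : (e' ∘ e.symm) =ᶠ[𝓝 z] g := by
    filter_upwards [hev] with w hw
    rw [Function.comp_apply, he.symm_eq_glued hw.1, hw.2.2.1, he'.apply_glued hw.2.1]
  refine ⟨hg.congr heq.symm, ?_⟩
  rw [heq.deriv_eq, hev.self_of_nhds.2.2.2]
  rw [hgz]

end Labelling

end ConicalPolytope

/-! ### Connectedness, separation, and density of the strips. -/

namespace ConicalPolytope

namespace Labelling

variable {D : Type u} {P : ConicalPolytope D} (A : P.Labelling)

lemma norm_toCell_of_im_eq_zero {d : D} {z : ℂ} (h : z.im = 0) : ‖A.toCell d z‖ = 1 := by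
  rw [norm_toCell, h, mul_zero, Real.exp_zero]

lemma norm_toVertex_lt_rpow {d : D} {z : ℂ} {ρ : ℝ} (hρ : 0 ≤ ρ) :
    ‖A.toVertex d z‖ < ρ ^ (2 / 3 : ℝ) ↔ ‖z‖ < ρ := by
  rw [A.norm_toVertex_lt (by positivity), ← Real.rpow_mul hρ]
  norm_num

lemma exists_small_edge_mem (d : D) : ∃ x : ℝ, 0 < x ∧ ∀ y : ℝ, 0 < y → y < x →
    (y : ℂ) ∈ A.domain (.edge d) ∧ ‖(y : ℂ)‖ < A.radius := by
  refine ⟨A.radius, A.radius_pos, fun y h0 h1 => ?_⟩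
  have h2 := A.two_radius_le d
  have h3 := A.radius_pos
  rw [mem_edge, Complex.ofReal_re, Complex.norm_real, Real.norm_of_nonneg h0.le]
  exact ⟨⟨h0, by linarith⟩, h1⟩

lemma isPreconnected_glued_image {i : P.Patch} (h : Convex ℝ (A.domain i)) :
    IsPreconnected (A.glued i '' A.domain i) :=
  h.isPreconnected.image _ (A.continuousOn_glued i)

lemma convex_edge (d : D) : Convex ℝ (A.domain (.edge d)) :=
  (convex_halfSpace_re_gt 0).inter (convex_halfSpace_re_lt _)

lemma convex_vertex (v : P.Vertex) : Convex ℝ (A.domain (.vertex v)) := by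
  have : A.domain (.vertex v) = Metric.ball 0 A.δ := by
    ext w
    rw [mem_ball_zero_iff]
    rfl
  rw [this]
  exact convex_ball _ _

/-- Each set is a strip joined to its initial vertex disk. Sets of `d` and `rot d` meet at the
vertex, those of `d` and `opp d` along the common strip, and transitivity of the group generated by
`rot` and `opp` provides chains. -/
lemma isPreconnected_edges_union_vertices : IsPreconnected (⋃ d,
    (A.glued (.edge d) '' A.domain (.edge d) ∪
      A.glued (.vertex (P.vertex d)) '' A.domain (.vertex (P.vertex d)))) := by
  set S : D → Set A.Surface := fun d => A.glued (.edge d) '' A.domain (.edge d) ∪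
      A.glued (.vertex (P.vertex d)) '' A.domain (.vertex (P.vertex d)) with hS
  have hsymm : Std.Symm fun d d' => (S d ∩ S d').Nonempty :=
    ⟨fun d d' h => by rwa [inter_comm]⟩
  have hgen : ∀ g ∈ Subgroup.closure {P.rot, P.opp}, ∀ d,
      Relation.ReflTransGen (fun d d' => (S d ∩ S d').Nonempty) d (g d) := by
    intro g hg
    induction hg using Subgroup.closure_induction with
    | mem x hx =>
      intro d
      refine Relation.ReflTransGen.single ?_
      rcases hx with rfl | rfl
      · refine ⟨A.vertexPoint (P.vertex d), Or.inr ?_, Or.inr ?_⟩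
        · exact ⟨0, A.zero_mem_vertex _, A.glued_vertex_zero _⟩
        · exact ⟨0, A.zero_mem_vertex _, by rw [P.vertex_rot, A.glued_vertex_zero]⟩
      · obtain ⟨x, hx, hx'⟩ := A.exists_small_edge_mem d
        have h := (hx' (x / 2) (by linarith) (by linarith)).1
        exact ⟨_, Or.inl ⟨_, h, rfl⟩, Or.inl ⟨_, A.flip_mem h, (A.glued_flip h).symm⟩⟩
    | one => exact fun d => Relation.ReflTransGen.refl
    | mul x y _ _ hx hy => exact fun d => (hy d).trans (hx (y d))
    | inv x _ hx =>
      intro d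
      -- The chain from `x⁻¹ d` to `d` is run backwards, since meeting is a symmetric relation.
      have := hx (x⁻¹ d)
      rw [show x (x⁻¹ d) = d from x.apply_symm_apply d] at this
      exact Std.Symm.symm _ _ this
  refine IsPreconnected.iUnion_of_reflTransGen (fun d => ?_) fun d d' => ?_
  · obtain ⟨x, hx, hx'⟩ := A.exists_small_edge_mem d
    obtain ⟨h1, h2⟩ := hx' (x / 2) (by linarith) (by linarith)
    exact (A.isPreconnected_glued_image (A.convex_edge d)).union _ ⟨_, h1, rfl⟩
      ⟨_, (A.toVertex_mem _).2 h2, (A.glued_edge_vertex h1 h2).symm⟩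
      (A.isPreconnected_glued_image (A.convex_vertex _))
  · obtain ⟨g, hg, rfl⟩ := P.connected d d'
    exact hgen g hg d

variable [Finite D]

lemma separated_of_disjoint {i j : P.Patch} {U V : Set ℂ} (hU : IsOpen U) (hV : IsOpen V)
    {x y : ℂ} (hx : x ∈ A.domain i) (hy : y ∈ A.domain j) (hxU : x ∈ U) (hyV : y ∈ V)
    (h : ∀ x ∈ A.domain i, x ∈ U → ∀ y ∈ A.domain j, y ∈ V → A.glued i x ≠ A.glued j y) :
    SeparatedNhds {A.glued i x} {A.glued j y} := by
  refine ⟨A.glued i '' (A.domain i ∩ U), A.glued j '' (A.domain j ∩ V),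
    A.isOpen_glued_image ((A.isOpen_domain i).inter hU) inter_subset_left,
    A.isOpen_glued_image ((A.isOpen_domain j).inter hV) inter_subset_left,
    singleton_subset_iff.2 ⟨x, ⟨hx, hxU⟩, rfl⟩, singleton_subset_iff.2 ⟨y, ⟨hy, hyV⟩, rfl⟩, ?_⟩
  rw [Set.disjoint_left]
  rintro _ ⟨x', hx', rfl⟩ ⟨y', hy', he⟩
  exact h x' hx'.1 hx'.2 y' hy'.1 hy'.2 he.symm

lemma separated_of_ne {i : P.Patch} {x y : ℂ} (hx : x ∈ A.domain i) (hy : y ∈ A.domain i)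
    (hne : A.glued i x ≠ A.glued i y) : SeparatedNhds {A.glued i x} {A.glued i y} := by
  obtain ⟨U, V, hU, hV, hxU, hyV, hd⟩ := t2_separation (fun h => hne (congrArg _ h) : x ≠ y)
  refine A.separated_of_disjoint hU hV hx hy hxU hyV fun x' h1 h2 y' h3 h4 he => ?_
  have := A.glued_injOn i h1 h3 he
  exact Set.disjoint_left.1 hd h2 (this ▸ h4)

lemma separated_cell_edge {c : P.Cell} {d : D} {ζ : ℂ} {t : ℝ} (hζ : ζ ∈ A.domain (.cell c))
    (ht : (t : ℂ) ∈ A.domain (.edge d)) :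
    SeparatedNhds {A.glued (.cell c) ζ} {A.glued (.edge d) t} := by
  rw [mem_cell] at hζ
  obtain ⟨r, hr, hr1⟩ := exists_between hζ
  -- Real points of a strip have cell coordinates of modulus one, so both cell coordinates stay
  -- above `r` near `t`. Both are needed because the two halves of the strip may belong to different
  -- cells.
  refine A.separated_of_disjoint (U := {ζ | ‖ζ‖ < r})
    (V := {z | r < ‖A.toCell d z‖} ∩ {z | r < ‖A.toCell (P.opp d) (P.length d - z)‖})
    (isOpen_lt continuous_norm continuous_const)
    ((isOpen_lt continuous_const (A.continuous_toCell d).norm).inter (isOpen_lt continuous_const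
      ((A.continuous_toCell _).comp (continuous_const.sub continuous_id)).norm)) hζ ht hr ?_ ?_
  · constructor
    · rwa [mem_ofPred_eq, norm_toCell_of_im_eq_zero _ (Complex.ofReal_im t)]
    · rwa [mem_ofPred_eq, norm_toCell_of_im_eq_zero]
      simp
  · intro ζ' h1 h2 z h3 h4 he
    rcases A.of_glued_edge_eq_cell h3 h1 he.symm with ⟨-, -, e⟩ | ⟨-, -, e⟩
    · have := h4.1
      rw [mem_ofPred_eq, e] at this
      exact lt_asymm this h2
    · have := h4.2
      rw [mem_ofPred_eq, e] at this
      exact lt_asymm this h2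

lemma separated_cell_vertex {c : P.Cell} {v : P.Vertex} {ζ : ℂ} (hζ : ζ ∈ A.domain (.cell c)) :
    SeparatedNhds {A.glued (.cell c) ζ} {A.glued (.vertex v) 0} := by
  rw [mem_cell] at hζ
  obtain ⟨r, hr, hr1⟩ := exists_between hζ
  -- Finiteness of `D` gives one neighbourhood of the vertex that serves for all half-edges.
  have hev : ∀ᶠ z : ℂ in 𝓝 0, ∀ d, r < ‖A.toCell d z‖ := by
    rw [eventually_all]
    intro d
    refine (isOpen_lt continuous_const (A.continuous_toCell d).norm).mem_nhds ?_
    rwa [mem_ofPred_eq, norm_toCell_of_im_eq_zero _ Complex.zero_im]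
  obtain ⟨ρ, hρ, hball⟩ := Metric.eventually_nhds_iff.1 hev
  refine A.separated_of_disjoint (U := {ζ | ‖ζ‖ < r}) (V := {w | ‖w‖ < ρ ^ (2 / 3 : ℝ)})
    (isOpen_lt continuous_norm continuous_const) (isOpen_lt continuous_norm continuous_const)
    hζ (A.zero_mem_vertex v) hr (by simpa using Real.rpow_pos_of_pos hρ _) ?_
  intro ζ' h1 h2 w h3 h4 he
  obtain ⟨d, z, -, rfl, rfl⟩ := A.of_glued_vertex_eq_cell h3 h1 he.symm
  have h5 := (A.norm_toVertex_lt_rpow hρ.le).1 h4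
  exact lt_asymm (hball (by rwa [dist_zero_right]) d) h2

lemma separated_edge_vertex {d : D} {v : P.Vertex} {t : ℝ}
    (ht : (t : ℂ) ∈ A.domain (.edge d)) :
    SeparatedNhds {A.glued (.edge d) t} {A.glued (.vertex v) 0} := by
  have ht' := ht
  rw [mem_edge, Complex.ofReal_re] at ht'
  -- `m` is less than the distances from `t` to both ends of the edge; the vertex neighbourhood is
  -- the image of the radius-`m` half-disks.
  obtain ⟨m, hm0, hm⟩ := exists_between (lt_min ht'.1 (sub_pos.2 ht'.2))
  rw [lt_min_iff] at hm
  refine A.separated_of_disjoint (U := {z | m < ‖z‖} ∩ {z | m < ‖(P.length d - z : ℂ)‖})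
    (V := {w | ‖w‖ < m ^ (2 / 3 : ℝ)})
    ((isOpen_lt continuous_const continuous_norm).inter (isOpen_lt continuous_const
      (continuous_const.sub continuous_id).norm)) (isOpen_lt continuous_norm continuous_const)
    ht (A.zero_mem_vertex v) ?_ (by simpa using Real.rpow_pos_of_pos hm0 _) ?_
  · constructor
    · rw [mem_ofPred_eq, Complex.norm_real]
      exact hm.1.trans_le (Real.le_norm_self t)
    · rw [mem_ofPred_eq, ← Complex.ofReal_sub, Complex.norm_real]
      exact hm.2.trans_le (Real.le_norm_self _)
  · intro z h1 h2 w h3 h4 he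
    have h2a : m < ‖z‖ := h2.1
    have h2b : m < ‖(P.length d - z : ℂ)‖ := h2.2
    rw [mem_ofPred_eq] at h4
    rcases A.norm_eq_of_glued_vertex_eq_edge h3 h1 he.symm with e | e
    · rw [e, Real.rpow_lt_rpow_iff (norm_nonneg _) hm0.le (by norm_num)] at h4
      exact lt_asymm h4 h2a
    · rw [e, Real.rpow_lt_rpow_iff (norm_nonneg _) hm0.le (by norm_num)] at h4
      exact lt_asymm h4 h2b

lemma t2Space : T2Space A.Surface := by
  refine ⟨fun p q hne => ?_⟩
  have key : SeparatedNhds {p} {q} := by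
    rcases A.exists_cell_or_edge_or_vertex p with
      ⟨c, ζ, h, rfl⟩ | ⟨d, t, h, rfl⟩ | ⟨v, rfl⟩ <;>
    rcases A.exists_cell_or_edge_or_vertex q with
      ⟨c', ζ', h', rfl⟩ | ⟨d', t', h', rfl⟩ | ⟨v', rfl⟩
    · by_cases hc : c = c'
      · subst hc
        exact A.separated_of_ne h h' hne
      · exact A.separated_of_disjoint isOpen_univ isOpen_univ h h' (mem_univ _) (mem_univ _)
          fun x h1 _ y h3 _ he => hc (A.eq_of_glued_cell_eq h1 h3 he).1
    · exact A.separated_cell_edge h h'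
    · rw [← glued_vertex_zero]
      exact A.separated_cell_vertex h
    · exact (A.separated_cell_edge h' h).symm
    · by_cases hd : d' = d
      · subst hd
        exact A.separated_of_ne h h' hne
      by_cases hd' : d' = P.opp d
      · subst hd'
        rw [A.glued_flip h] at hne ⊢
        exact A.separated_of_ne (A.flip_mem h) h' hne
      · refine A.separated_of_disjoint isOpen_univ isOpen_univ h h' (mem_univ _) (mem_univ _)
          fun x h1 _ y h3 _ he => ?_
        rcases A.eq_or_flip_of_glued_edge_eq h1 h3 he with e | e
        · exact hd e.1.symm
        · exact hd' e.1
    · rw [← glued_vertex_zero]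
      exact A.separated_edge_vertex h
    · rw [← glued_vertex_zero]
      exact (A.separated_cell_vertex h').symm
    · rw [← glued_vertex_zero]
      exact (A.separated_edge_vertex h').symm
    · rw [← glued_vertex_zero, ← glued_vertex_zero] at hne ⊢
      refine A.separated_of_disjoint isOpen_univ isOpen_univ (A.zero_mem_vertex v)
        (A.zero_mem_vertex v') (mem_univ _) (mem_univ _) fun x h1 _ y h3 _ he => ?_
      exact hne (by rw [(A.eq_of_glued_vertex_eq h1 h3 he).1])
  obtain ⟨u, v, hu, hv, hpu, hqv, hd⟩ := key
  exact ⟨u, v, hu, hv, singleton_subset_iff.1 hpu, singleton_subset_iff.1 hqv, hd⟩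

lemma vertexPoint_injective : Function.Injective A.vertexPoint := fun v v' h => by
  rw [← glued_vertex_zero] at h
  simpa using (A.of_glued_eq_vertexPoint (A.zero_mem_vertex v) h).1

lemma puncture_injective : Function.Injective A.puncture := fun c c' h => by
  rw [← glued_cell_zero] at h
  simpa using (A.of_glued_eq_puncture (A.zero_mem_cell c) h).1

/-- The points of the strips are dense. -/
lemma dense_edges : Dense (⋃ d, A.glued (.edge d) '' A.domain (.edge d)) := by
  intro p
  have hW {d : D} {z : ℂ} (h : z ∈ A.domain (.edge d)) :
      A.glued (.edge d) z ∈ ⋃ d, A.glued (.edge d) '' A.domain (.edge d) :=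
    mem_iUnion.2 ⟨d, z, h, rfl⟩
  rcases A.exists_cell_or_edge_or_vertex p with ⟨c, ζ, h, rfl⟩ | ⟨d, t, h, rfl⟩ | ⟨v, rfl⟩
  · have key : ∀ ζ ∈ A.domain (.cell c), ζ ≠ 0 → A.glued (.cell c) ζ ∈
        closure (⋃ d, A.glued (.edge d) '' A.domain (.edge d)) := by
      intro ζ h h0
      obtain ⟨d, rfl, z, hz0, hz1, rfl⟩ := A.exists_toCell c h0
      have hi := (A.toCell_mem _).1 h
      have hlim : Tendsto (fun x : ℝ => A.glued (.cell (P.cell d)) (A.toCell d (z + x)))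
          (𝓝[>] 0) (𝓝 (A.glued (.cell (P.cell d)) (A.toCell d z))) := by
        have h1 : Tendsto (fun x : ℝ => A.toCell d (z + x)) (𝓝[>] 0) (𝓝 (A.toCell d z)) := by
          have : Continuous fun x : ℝ => A.toCell d (z + x) :=
            (A.continuous_toCell d).comp (by fun_prop)
          have := this.tendsto 0
          simp only [Complex.ofReal_zero, add_zero] at this
          exact this.mono_left nhdsWithin_le_nhds
        exact (A.continuousAt_glued h).tendsto.comp h1
      -- Only the corner lines with zero real part lie outside the open strips; a small positive
      -- shift moves such a point inside.
      refine mem_closure_of_tendsto hlim ?_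
      filter_upwards [Ioo_mem_nhdsGT (sub_pos.2 hz1)] with x hx
      have hm : z + x ∈ A.domain (.edge d) := by
        rw [mem_edge, Complex.add_re, Complex.ofReal_re]
        constructor <;> linarith [hx.1, hx.2]
      rw [← A.glued_edge_cell hm (by simpa using hi)]
      exact hW hm
    by_cases h0 : ζ = 0
    · subst h0
      have hlim : Tendsto (A.glued (.cell c)) (𝓝[≠] 0) (𝓝 (A.glued (.cell c) 0)) :=
        (A.continuousAt_glued h).tendsto.mono_left nhdsWithin_le_nhds
      refine isClosed_closure.mem_of_tendsto hlim ?_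
      filter_upwards [self_mem_nhdsWithin,
        mem_nhdsWithin_of_mem_nhds ((A.isOpen_domain (.cell c)).mem_nhds h)] with ζ h1 h2
      exact key ζ h2 h1
    · exact key ζ h h0
  · exact subset_closure (hW h)
  · obtain ⟨d, rfl⟩ := P.exists_vertex v
    obtain ⟨x, hx, hx'⟩ := A.exists_small_edge_mem d
    have hlim : Tendsto (fun y : ℝ => A.glued (.vertex (P.vertex d)) (A.toVertex d y))
        (𝓝[>] 0) (𝓝 (A.vertexPoint (P.vertex d))) := by
      rw [← glued_vertex_zero]
      have h1 : Tendsto (fun y : ℝ => (y : ℂ)) (𝓝[>] 0) (𝓝 0) := by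
        have := Complex.continuous_ofReal.tendsto 0
        rw [Complex.ofReal_zero] at this
        exact this.mono_left nhdsWithin_le_nhds
      exact (A.continuousAt_glued (A.zero_mem_vertex _)).tendsto.comp
        ((A.tendsto_toVertex_zero d).comp h1)
    refine mem_closure_of_tendsto hlim ?_
    filter_upwards [Ioo_mem_nhdsGT hx] with y hy
    obtain ⟨h1, h2⟩ := hx' y hy.1 hy.2
    rw [← A.glued_edge_vertex h1 h2]
    exact hW h1

/-- A set between a connected set and its closure is connected. This treats the whole surface and
the complement of the punctures together. -/
lemma isConnected_of_subset {Y : Set A.Surface} (hY : ⋃ d,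
    (A.glued (.edge d) '' A.domain (.edge d) ∪
      A.glued (.vertex (P.vertex d)) '' A.domain (.vertex (P.vertex d))) ⊆ Y) :
    IsConnected Y := by
  refine ⟨⟨A.vertexPoint (P.vertex P.nonempty.some), hY (mem_iUnion.2 ⟨_, Or.inr
    ⟨0, A.zero_mem_vertex _, A.glued_vertex_zero _⟩⟩)⟩,
    A.isPreconnected_edges_union_vertices.subset_closure hY fun p _ => ?_⟩
  exact closure_mono (iUnion_mono fun d => subset_union_left) (A.dense_edges p)

lemma connectedSpace : ConnectedSpace A.Surface :=
  connectedSpace_iff_univ.2 (A.isConnected_of_subset (subset_univ _))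

lemma isConnected_compl_punctures : IsConnected (range A.puncture)ᶜ := by
  refine A.isConnected_of_subset (iUnion_subset fun d => union_subset ?_ ?_)
  · rintro _ ⟨z, h, rfl⟩ ⟨c, hc⟩
    cases (A.of_glued_eq_puncture h hc.symm).1
  · rintro _ ⟨z, h, rfl⟩ ⟨c, hc⟩
    cases (A.of_glued_eq_puncture h hc.symm).1

end Labelling

end ConicalPolytope

/-! ### The complex structure and the quadratic differential. -/

section Transition

variable {X : Type*} [TopologicalSpace X] {e e' e'' : OpenPartialHomeomorph X ℂ} {z : ℂ}

lemma eventually_symm_mem_source (hz : z ∈ e.target) (h : e.symm z ∈ e'.source) :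
    ∀ᶠ w in 𝓝 z, w ∈ e.target ∧ e.symm w ∈ e'.source :=
  (e.open_target.eventually_mem hz).and
    ((e.continuousAt_symm hz).eventually (e'.open_source.mem_nhds h))

lemma deriv_transition_comp (hz : z ∈ e.target) (h : e.symm z ∈ e'.source)
    (h1 : DifferentiableAt ℂ (e'' ∘ e'.symm) (e' (e.symm z)))
    (h2 : DifferentiableAt ℂ (e' ∘ e.symm) z) : deriv (e'' ∘ e.symm) z =
      deriv (e'' ∘ e'.symm) (e' (e.symm z)) * deriv (e' ∘ e.symm) z := by
  have : (e'' ∘ e.symm) =ᶠ[𝓝 z] (e'' ∘ e'.symm) ∘ (e' ∘ e.symm) := by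
    filter_upwards [eventually_symm_mem_source hz h] with w hw
    simp [e'.left_inv hw.2]
  rw [this.deriv_eq]
  exact deriv_comp (h₂ := e'' ∘ e'.symm) (h := e' ∘ e.symm) z h1 h2

lemma analyticAt_transition [ChartedSpace ℂ X] [IsManifold 𝓘(ℂ) ω X]
    (he : e ∈ IsManifold.maximalAtlas 𝓘(ℂ) ω X) (he' : e' ∈ IsManifold.maximalAtlas 𝓘(ℂ) ω X)
    (hz : z ∈ e.target) (h : e.symm z ∈ e'.source) : AnalyticAt ℂ (e' ∘ e.symm) z := by
  have := (contMDiffAt_of_mem_maximalAtlas he' h).comp z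
    (contMDiffAt_symm_of_mem_maximalAtlas he hz)
  exact this.contDiffAt.analyticAt

end Transition

namespace ConicalPolytope

namespace Labelling

variable {D : Type u} {P : ConicalPolytope D} (A : P.Labelling)

lemma meromorphicAt_quadCoeff_comp (i : P.Patch) {φ : ℂ → ℂ} {z : ℂ} (hφ : AnalyticAt ℂ φ z) :
    MeromorphicAt (fun w => A.quadCoeff i (φ w)) z := by
  have h := hφ.meromorphicAt
  cases i with
  | vertex v => exact (MeromorphicAt.const _ _).mul h
  | edge d => exact MeromorphicAt.const _ _
  | cell c =>
    exact ((MeromorphicAt.const _ _).div ((MeromorphicAt.const _ _).mul (h.pow 2))).neg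

variable [Finite D]

/-- A patch containing a given point. -/
def patchIndex (p : A.Surface) : P.Patch := (A.exists_glued p).choose

lemma mem_chart_source (p : A.Surface) : p ∈ (A.chart (A.patchIndex p)).source := by
  obtain ⟨z, hz, h⟩ := (A.exists_glued p).choose_spec
  have := (A.isPatchChart_chart _).glued_mem_source hz
  rwa [h] at this

/-- The atlas of the uniformizing coordinates. -/
@[reducible] def chartedSpace : ChartedSpace ℂ A.Surface where
  atlas := range A.chart
  chartAt p := A.chart (A.patchIndex p)
  mem_chart_source := A.mem_chart_source
  chart_mem_atlas _ := ⟨_, rfl⟩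

attribute [local instance] chartedSpace

lemma isManifold : IsManifold 𝓘(ℂ) ω A.Surface := by
  refine isManifold_of_contDiffOn 𝓘(ℂ) ω A.Surface ?_
  rintro _ _ ⟨i, rfl⟩ ⟨j, rfl⟩
  simp only [mfld_simps]
  intro z hz
  have h := (A.isPatchChart_chart i).transition (A.isPatchChart_chart j) hz.1 hz.2
  exact h.1.contDiffAt.contDiffWithinAt

lemma chart_mem_maximalAtlas (i : P.Patch) :
    A.chart i ∈ IsManifold.maximalAtlas 𝓘(ℂ) ω A.Surface :=
  haveI := A.isManifold
  IsManifold.subset_maximalAtlas ⟨i, rfl⟩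

lemma isComplexStructure : A.IsComplexStructure :=
  ⟨A.isManifold, fun i => ⟨_, A.chart_mem_maximalAtlas i, A.isPatchChart_chart i⟩⟩

/-- The coefficient, in a chart, of the quadratic differential on the glued space. -/
def coeff (e : OpenPartialHomeomorph A.Surface ℂ) (z : ℂ) : ℂ :=
  A.quadCoeff (A.patchIndex (e.symm z)) (A.chart (A.patchIndex (e.symm z)) (e.symm z)) *
    deriv (A.chart (A.patchIndex (e.symm z)) ∘ e.symm) z ^ 2

/-- The patch chosen in `coeff` may vary from point to point. Compatibility of the patch expressions
and the chain rule make the value independent of it, so one patch can be fixed near a point. -/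
lemma coeff_eq {e : OpenPartialHomeomorph A.Surface ℂ}
    (he : e ∈ IsManifold.maximalAtlas 𝓘(ℂ) ω A.Surface) {z : ℂ} (hz : z ∈ e.target)
    {i : P.Patch} (hi : e.symm z ∈ (A.chart i).source) :
    A.coeff e z = A.quadCoeff i (A.chart i (e.symm z)) * deriv (A.chart i ∘ e.symm) z ^ 2 := by
  have := A.isManifold
  have hj := A.mem_chart_source (e.symm z)
  rw [coeff]
  generalize A.patchIndex (e.symm z) = j at *
  have hjt := (A.chart j).map_source hj
  have hsymm := (A.chart j).left_inv hj
  obtain ⟨h1, h2⟩ := (A.isPatchChart_chart j).transition (A.isPatchChart_chart i) hjt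
    (by rwa [hsymm])
  rw [h2, hsymm, deriv_transition_comp (e'' := A.chart i) hz hj h1.differentiableAt
    (analyticAt_transition he (A.chart_mem_maximalAtlas j) hz hj).differentiableAt]
  ring

lemma coeff_patchChart {e : OpenPartialHomeomorph A.Surface ℂ}
    (he : e ∈ IsManifold.maximalAtlas 𝓘(ℂ) ω A.Surface) {i : P.Patch} (hi : A.IsPatchChart i e)
    {z : ℂ} (hz : z ∈ A.domain i) : A.coeff e z = A.quadCoeff i z := by
  have hc := A.isPatchChart_chart i
  have hsymm := hi.symm_eq_glued hz
  rw [A.coeff_eq he (by rwa [hi.1]) (i := i) (by rw [hsymm]; exact hc.glued_mem_source hz), hsymm,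
    hc.apply_glued hz]
  have : (A.chart i ∘ e.symm) =ᶠ[𝓝 z] id := by
    filter_upwards [(A.isOpen_domain i).mem_nhds hz] with w hw
    rw [Function.comp_apply, hi.symm_eq_glued hw, hc.apply_glued hw, id]
  rw [this.deriv_eq, deriv_id]
  ring

/-- The quadratic differential on the glued space. -/
def quadraticDifferential : MeromorphicQuadraticDifferential A.Surface where
  coeff := A.coeff
  meromorphic e he z hz := by
    have := A.isManifold
    have hi := A.mem_chart_source (e.symm z)
    set i := A.patchIndex (e.symm z)
    have h := analyticAt_transition he (A.chart_mem_maximalAtlas i) hz hi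
    refine ((A.meromorphicAt_quadCoeff_comp i h).mul (h.deriv.meromorphicAt.pow 2)).congr ?_
    filter_upwards [mem_nhdsWithin_of_mem_nhds (eventually_symm_mem_source hz hi)] with w hw
    exact (A.coeff_eq he hw.1 hw.2).symm
  compat e he e' he' p hp := by
    have := A.isManifold
    have hz := e.map_source hp.1
    have hsymm := e.left_inv hp.1
    filter_upwards [mem_nhdsWithin_of_mem_nhds (eventually_symm_mem_source (e' := e') hz
      (by rw [hsymm]; exact hp.2))] with w hw
    have hi := A.mem_chart_source (e.symm w)
    set i := A.patchIndex (e.symm w)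
    have ht := e'.map_source hw.2
    have hl := e'.left_inv hw.2
    rw [A.coeff_eq he hw.1 hi, A.coeff_eq he' (i := i) ht (by rwa [hl]), hl,
      deriv_transition_comp (e'' := A.chart i) hw.1 hw.2
        (analyticAt_transition he' (A.chart_mem_maximalAtlas i) ht
          (by rwa [hl])).differentiableAt
        (analyticAt_transition he he' hw.1 hw.2).differentiableAt]
    ring

/-- The order of the quadratic differential in terms of a patch that contains the point. -/
lemma exists_order_eq (p : A.Surface) : ∃ i, ∃ z ∈ A.domain i, A.glued i z = p ∧
    A.quadraticDifferential.order p = meromorphicOrderAt (A.quadCoeff i) z := by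
  have hc := A.isPatchChart_chart (A.patchIndex p)
  obtain ⟨h1, h2⟩ := hc.exists_of_mem_source (A.mem_chart_source p)
  refine ⟨A.patchIndex p, _, h1, h2, meromorphicOrderAt_congr ?_⟩
  filter_upwards [mem_nhdsWithin_of_mem_nhds ((A.isOpen_domain _).mem_nhds h1)] with w hw
  exact A.coeff_patchChart (A.chart_mem_maximalAtlas _) hc hw

lemma order_vertexPoint (v : P.Vertex) :
    A.quadraticDifferential.order (A.vertexPoint v) = (1 : ℤ) := by
  obtain ⟨i, z, hz, he, ho⟩ := A.exists_order_eq (A.vertexPoint v)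
  -- The centre lies in no other patch, so the chosen patch must be this vertex disk.
  obtain ⟨rfl, rfl⟩ := A.of_glued_eq_vertexPoint hz he
  have ha : AnalyticAt ℂ (A.quadCoeff (.vertex v)) 0 := analyticAt_const.mul analyticAt_id
  rw [ho, meromorphicOrderAt_eq_int_iff ha.meromorphicAt]
  exact ⟨fun _ => 9 / 4, analyticAt_const, by norm_num, Eventually.of_forall fun w => by
    simp [quadCoeff, mul_comm]⟩

lemma order_puncture (c : P.Cell) :
    A.quadraticDifferential.order (A.puncture c) = (-2 : ℤ) := by
  obtain ⟨i, z, hz, he, ho⟩ := A.exists_order_eq (A.puncture c)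
  obtain ⟨rfl, rfl⟩ := A.of_glued_eq_puncture hz he
  have hpi : (Real.pi : ℂ) ≠ 0 := by exact_mod_cast Real.pi_ne_zero
  have hL := A.perimeter_ne_zero c
  have hm : MeromorphicAt (A.quadCoeff (.cell c)) 0 :=
    A.meromorphicAt_quadCoeff_comp _ analyticAt_id
  rw [ho, meromorphicOrderAt_eq_int_iff hm]
  refine ⟨fun _ => -((P.perimeter c : ℂ) ^ 2 / (4 * (Real.pi : ℂ) ^ 2)), analyticAt_const,
    neg_ne_zero.2 (div_ne_zero (pow_ne_zero 2 hL)
      (mul_ne_zero (by norm_num) (pow_ne_zero 2 hpi))), Eventually.of_forall fun w => ?_⟩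
  have hpow : w ^ (-2 : ℤ) = (w ^ 2)⁻¹ := by
    rw [zpow_neg]
    norm_cast
  rw [sub_zero, hpow, smul_eq_mul]
  simp only [quadCoeff]
  rw [div_mul_eq_div_div]
  ring

lemma order_eq_zero {p : A.Surface} (h1 : p ∉ range A.vertexPoint) (h2 : p ∉ range A.puncture) :
    A.quadraticDifferential.order p = (0 : ℤ) := by
  obtain ⟨i, z, hz, rfl, ho⟩ := A.exists_order_eq p
  have hpi : (Real.pi : ℂ) ≠ 0 := by exact_mod_cast Real.pi_ne_zero
  have key : AnalyticAt ℂ (A.quadCoeff i) z ∧ A.quadCoeff i z ≠ 0 := by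
    cases i with
    | vertex v =>
      refine ⟨analyticAt_const.mul analyticAt_id, mul_ne_zero (by norm_num) fun h0 => h1 ⟨v, ?_⟩⟩
      rw [h0, glued_vertex_zero]
    | edge d => exact ⟨analyticAt_const, one_ne_zero⟩
    | cell c =>
      have h0 : z ≠ 0 := fun h0 => h2 ⟨c, by rw [h0, glued_cell_zero]⟩
      have hL := A.perimeter_ne_zero c
      have hne : 4 * (Real.pi : ℂ) ^ 2 * z ^ 2 ≠ 0 :=
        mul_ne_zero (mul_ne_zero (by norm_num) (pow_ne_zero 2 hpi)) (pow_ne_zero 2 h0)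
      exact ⟨(analyticAt_const.div (analyticAt_const.mul (analyticAt_id.pow 2)) hne).neg,
        neg_ne_zero.2 (div_ne_zero (pow_ne_zero 2 hL) hne)⟩
  rw [ho, meromorphicOrderAt_eq_int_iff key.1.meromorphicAt]
  exact ⟨_, key.1, key.2, Eventually.of_forall fun w => by simp⟩

end Labelling

end ConicalPolytope

/-! ### Canonicity: isomorphic polytopes and changes of labelling. -/

namespace ConicalPolytope

/-- An isomorphism of ribbon graphs that preserves the lengths of the edges. -/
structure EdgeIsometry {D D' : Type u} (P : ConicalPolytope D) (P' : ConicalPolytope D') where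
  toEquiv : D ≃ D'
  map_rot : ∀ d, toEquiv (P.rot d) = P'.rot (toEquiv d)
  map_opp : ∀ d, toEquiv (P.opp d) = P'.opp (toEquiv d)
  map_length : ∀ d, P'.length (toEquiv d) = P.length d

namespace EdgeIsometry

variable {D D' : Type u} {P : ConicalPolytope D} {P' : ConicalPolytope D'}
  (f : EdgeIsometry P P')

/-- The inverse isomorphism. -/
def symm : EdgeIsometry P' P where
  toEquiv := f.toEquiv.symm
  map_rot d := by rw [Equiv.symm_apply_eq, f.map_rot, Equiv.apply_symm_apply]
  map_opp d := by rw [Equiv.symm_apply_eq, f.map_opp, Equiv.apply_symm_apply]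
  map_length d := by rw [← f.map_length, Equiv.apply_symm_apply]

lemma symm_apply (d : D) : f.symm.toEquiv (f.toEquiv d) = d := f.toEquiv.symm_apply_apply d

lemma map_next (d : D) : f.toEquiv (P.next d) = P'.next (f.toEquiv d) := by
  apply P'.rot.injective
  rw [P'.rot_next, ← f.map_rot, P.rot_next, f.map_opp]

lemma map_next_pow (d : D) (n : ℕ) :
    f.toEquiv ((P.next ^ n) d) = (P'.next ^ n) (f.toEquiv d) := by
  induction n with
  | zero => rfl
  | succ n ih => rw [pow_succ', pow_succ', Equiv.Perm.mul_apply, Equiv.Perm.mul_apply, map_next, ih]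

lemma map_rot_pow (d : D) (n : ℕ) :
    f.toEquiv ((P.rot ^ n) d) = (P'.rot ^ n) (f.toEquiv d) := by
  induction n with
  | zero => rfl
  | succ n ih => rw [pow_succ', pow_succ', Equiv.Perm.mul_apply, Equiv.Perm.mul_apply, map_rot, ih]

lemma vertex_eq {d e : D} (h : P.vertex d = P.vertex e) :
    P'.vertex (f.toEquiv d) = P'.vertex (f.toEquiv e) := by
  obtain ⟨n, rfl⟩ := P.exists_rot_pow h
  rw [map_rot_pow, P'.vertex_eq_iff, Equiv.Perm.sameCycle_pow_right]

variable [Finite D]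

lemma cell_eq {d e : D} (h : P.cell d = P.cell e) :
    P'.cell (f.toEquiv d) = P'.cell (f.toEquiv e) := by
  obtain ⟨n, rfl⟩ := (P.cell_eq_iff.1 h).exists_nat_pow_eq
  rw [map_next_pow, Labelling.cell_next_pow]

lemma perimeter_eq [Finite D'] (d : D) :
    P'.perimeter (P'.cell (f.toEquiv d)) = P.perimeter (P.cell d) := by
  rw [perimeter, perimeter, ← finsum_comp_equiv f.toEquiv]
  refine finsum_congr fun e => ?_
  rw [f.map_length]
  refine finsum_congr_Prop (propext ⟨fun h => ?_, f.cell_eq⟩) fun _ => rfl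
  have := f.symm.cell_eq h
  rwa [symm_apply, symm_apply] at this

end EdgeIsometry

namespace Labelling

variable {D D' : Type u} {P : ConicalPolytope D} {P' : ConicalPolytope D'}
  (A : P.Labelling) (A' : P'.Labelling) (f : EdgeIsometry P P')

/-- The rotation that relates the coordinates of the disks of corresponding 2-cells. -/
def cellRotation (d : D) : ℂ := A'.toCell (f.toEquiv d) 0 / A.toCell d 0

/-- The rotation that relates the coordinates of corresponding vertex disks. -/
def vertexRotation (d : D) : ℂ := A'.phase (f.toEquiv d) / A.phase d

lemma norm_cellRotation (d : D) : ‖cellRotation A A' f d‖ = 1 := by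
  rw [cellRotation, norm_div, norm_toCell_of_im_eq_zero _ rfl, norm_toCell_of_im_eq_zero _ rfl,
    div_one]

lemma toVertex_map (d : D) (z : ℂ) :
    A'.toVertex (f.toEquiv d) z = vertexRotation A A' f d * A.toVertex d z := by
  have := A.phase_ne_zero d
  rw [toVertex_eq, toVertex_eq, vertexRotation]
  field_simp

lemma vertexRotation_eq {d e : D} (h : P.vertex d = P.vertex e) :
    vertexRotation A A' f d = vertexRotation A A' f e := by
  obtain ⟨n, rfl⟩ := P.exists_rot_pow h
  rw [vertexRotation, vertexRotation, f.map_rot_pow, phase_rot_pow, phase_rot_pow,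
    mul_div_mul_left _ _ (Complex.exp_ne_zero _)]

lemma cellRotation_symm (d : D) :
    cellRotation A' A f.symm (f.toEquiv d) * cellRotation A A' f d = 1 := by
  have h1 := A.toCell_ne_zero d 0
  have h2 := A'.toCell_ne_zero (f.toEquiv d) 0
  rw [cellRotation, cellRotation, f.symm_apply]
  field_simp

variable [Finite D] [Finite D']

lemma toCell_map (d : D) (z : ℂ) :
    A'.toCell (f.toEquiv d) z = cellRotation A A' f d * A.toCell d z := by
  rw [cellRotation, div_mul_eq_mul_div, eq_div_iff (A.toCell_ne_zero d 0), toCell_eq, toCell_eq,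
    toCell_eq, toCell_eq, f.perimeter_eq, ← Complex.exp_add, ← Complex.exp_add]
  congr 1
  ring

/-- Passing to the next edge shifts `z` by the same length on both surfaces, so the quotient of the
cell coordinates does not change around the cell. -/
lemma cellRotation_eq {d e : D} (h : P.cell d = P.cell e) :
    cellRotation A A' f d = cellRotation A A' f e := by
  have hnext (d : D) : cellRotation A A' f (P.next d) = cellRotation A A' f d := by
    rw [cellRotation, f.map_next, toCell_next, f.map_length, toCell_map, toCell_next,
      mul_div_cancel_right₀ _ (A.toCell_ne_zero _ _)]
  obtain ⟨n, rfl⟩ := (P.cell_eq_iff.1 h).exists_nat_pow_eq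
  clear h
  induction n with
  | zero => rfl
  | succ n ih => rw [pow_succ', Equiv.Perm.mul_apply, hnext, ih]

/-- Corresponding points of the surfaces glued from isomorphic polytopes. -/
inductive Corresponds : A.Surface → A'.Surface → Prop
  | cell (d : D) (ζ : ℂ) (h : ζ ∈ A.domain (.cell (P.cell d))) :
      Corresponds (A.glued (.cell (P.cell d)) ζ)
        (A'.glued (.cell (P'.cell (f.toEquiv d))) (cellRotation A A' f d * ζ))
  | edge (d : D) (z : ℂ) (h : z ∈ A.domain (.edge d)) :
      Corresponds (A.glued (.edge d) z) (A'.glued (.edge (f.toEquiv d)) z)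
  | vertex (d : D) :
      Corresponds (A.vertexPoint (P.vertex d)) (A'.vertexPoint (P'.vertex (f.toEquiv d)))

variable {A A' f}

omit [Finite D] [Finite D'] in
lemma rotation_mem_cell {d : D} {ζ : ℂ} {c : P.Cell} (h : ζ ∈ A.domain (.cell c)) (c' : P'.Cell) :
    cellRotation A A' f d * ζ ∈ A'.domain (.cell c') := by
  rw [mem_cell] at *
  rwa [norm_mul, norm_cellRotation, one_mul]

omit [Finite D] [Finite D'] in
lemma map_mem_edge {d : D} {z : ℂ} (h : z ∈ A.domain (.edge d)) :
    z ∈ A'.domain (.edge (f.toEquiv d)) := by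
  rwa [mem_edge, f.map_length]

omit [Finite D] [Finite D'] in
lemma Corresponds.symm {p : A.Surface} {q : A'.Surface} (h : Corresponds A A' f p q) :
    Corresponds A' A f.symm q p := by
  cases h with
  | cell d ζ h =>
    have := Corresponds.cell (A := A') (A' := A) (f := f.symm) (f.toEquiv d)
      (cellRotation A A' f d * ζ) (rotation_mem_cell h _)
    rwa [f.symm_apply, ← mul_assoc, cellRotation_symm, one_mul] at this
  | edge d z h =>
    have := Corresponds.edge (A := A') (A' := A) (f := f.symm) (f.toEquiv d) z (map_mem_edge h)
    rwa [f.symm_apply] at this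
  | vertex d =>
    have := Corresponds.vertex (A := A') (A' := A) (f := f.symm) (f.toEquiv d)
    rwa [f.symm_apply] at this

lemma map_edge_eq_map_cell {d e : D} {z ζ : ℂ} (hz : z ∈ A.domain (.edge e))
    (hζ : ζ ∈ A.domain (.cell (P.cell d)))
    (h : A.glued (.edge e) z = A.glued (.cell (P.cell d)) ζ) :
    A'.glued (.edge (f.toEquiv e)) z =
      A'.glued (.cell (P'.cell (f.toEquiv d))) (cellRotation A A' f d * ζ) := by
  have key {e : D} {z : ℂ} (hz : z ∈ A.domain (.edge e)) (hi : 0 < z.im)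
      (hc : P.cell e = P.cell d) (ht : A.toCell e z = ζ) : A'.glued (.edge (f.toEquiv e)) z =
      A'.glued (.cell (P'.cell (f.toEquiv d))) (cellRotation A A' f d * ζ) := by
    rw [A'.glued_edge_cell (map_mem_edge hz) hi, toCell_map A, ht, f.cell_eq hc,
      cellRotation_eq A A' f hc]
  rcases A.of_glued_edge_eq_cell hz hζ h with ⟨hi, hc, ht⟩ | ⟨hi, hc, ht⟩
  · exact key hz hi hc ht
  · rw [A'.glued_flip (map_mem_edge hz), ← f.map_opp, f.map_length]
    exact key (A.flip_mem hz) (by simpa using hi) hc ht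

/-- The three rules agree on overlaps by the coincidence criteria for glued points. Applied to the
inverse isometry as well, this makes the relation the graph of a bijection. -/
lemma Corresponds.unique {p p' : A.Surface} {q q' : A'.Surface} (h : Corresponds A A' f p q)
    (h' : Corresponds A A' f p' q') (hp : p = p') : q = q' := by
  cases h with
  | cell d ζ h =>
    cases h' with
    | cell e ζ' h' =>
      obtain ⟨hc, rfl⟩ := A.eq_of_glued_cell_eq h h' hp
      rw [f.cell_eq hc, cellRotation_eq A A' f hc]
    | edge e z h' => exact (map_edge_eq_map_cell h' h hp.symm).symm
    | vertex e => cases (A.of_glued_eq_vertexPoint h hp).1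
  | edge d z h =>
    cases h' with
    | cell e ζ' h' => exact map_edge_eq_map_cell h h' hp
    | edge e z' h' =>
      rcases A.eq_or_flip_of_glued_edge_eq h h' hp with ⟨rfl, rfl⟩ | ⟨rfl, rfl⟩
      · rfl
      · rw [A'.glued_flip (map_mem_edge h), f.map_opp, f.map_length]
    | vertex e => cases (A.of_glued_eq_vertexPoint h hp).1
  | vertex d =>
    cases h' with
    | cell e ζ' h' => cases (A.of_glued_eq_vertexPoint h' hp.symm).1
    | edge e z' h' => cases (A.of_glued_eq_vertexPoint h' hp.symm).1
    | vertex e => rw [f.vertex_eq (A.vertexPoint_injective hp)]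

variable (A A' f)

omit [Finite D'] in
lemma exists_corresponds (p : A.Surface) : ∃ q, Corresponds A A' f p q := by
  rcases A.exists_cell_or_edge_or_vertex p with ⟨c, ζ, h, rfl⟩ | ⟨d, t, h, rfl⟩ | ⟨v, rfl⟩
  · obtain ⟨d, rfl⟩ := P.exists_cell c
    exact ⟨_, .cell d ζ h⟩
  · exact ⟨_, .edge d t h⟩
  · obtain ⟨d, rfl⟩ := P.exists_vertex v
    exact ⟨_, .vertex d⟩

/-- The bijection between the surfaces glued from isomorphic polytopes. -/
def surfaceEquiv : A.Surface ≃ A'.Surface where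
  toFun p := (exists_corresponds A A' f p).choose
  invFun q := (exists_corresponds A' A f.symm q).choose
  left_inv p := (exists_corresponds A' A f.symm _).choose_spec.unique
    (exists_corresponds A A' f p).choose_spec.symm rfl
  right_inv q := (exists_corresponds A A' f _).choose_spec.unique
    (exists_corresponds A' A f.symm q).choose_spec.symm rfl

lemma corresponds_surfaceEquiv (p : A.Surface) : Corresponds A A' f p (surfaceEquiv A A' f p) :=
  (exists_corresponds A A' f p).choose_spec

lemma corresponds_surfaceEquiv_symm (q : A'.Surface) :
    Corresponds A' A f.symm q ((surfaceEquiv A A' f).symm q) :=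
  (exists_corresponds A' A f.symm q).choose_spec

variable {A A' f}

/-- A map between corresponding points is multiplication by a constant in suitable coordinates
near any point. -/
lemma exists_local_form {g : A.Surface → A'.Surface} (hg : ∀ p, Corresponds A A' f p (g p))
    (p : A.Surface) : ∃ (i : P.Patch) (j : P'.Patch) (z k : ℂ), z ∈ A.domain i ∧
      A.glued i z = p ∧ k * z ∈ A'.domain j ∧
      ∀ᶠ w in 𝓝 z, g (A.glued i w) = A'.glued j (k * w) := by
  rcases A.exists_cell_or_edge_or_vertex p with ⟨c, ζ, h, rfl⟩ | ⟨d, t, h, rfl⟩ | ⟨v, rfl⟩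
  · obtain ⟨d, rfl⟩ := P.exists_cell c
    refine ⟨_, .cell (P'.cell (f.toEquiv d)), ζ, cellRotation A A' f d, h, rfl,
      rotation_mem_cell h _, ?_⟩
    filter_upwards [(A.isOpen_domain _).mem_nhds h] with w hw
    exact (hg _).unique (.cell d w hw) rfl
  · refine ⟨_, .edge (f.toEquiv d), t, 1, h, rfl, by rw [one_mul]; exact map_mem_edge h, ?_⟩
    filter_upwards [(A.isOpen_domain _).mem_nhds h] with w hw
    rw [one_mul]
    exact (hg _).unique (.edge d w hw) rfl
  · obtain ⟨d, rfl⟩ := P.exists_vertex v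
    refine ⟨.vertex (P.vertex d), .vertex (P'.vertex (f.toEquiv d)), 0, vertexRotation A A' f d,
      A.zero_mem_vertex _, A.glued_vertex_zero _, by rw [mul_zero]; exact A'.zero_mem_vertex _, ?_⟩
    filter_upwards [(A.isOpen_domain (.vertex (P.vertex d))).mem_nhds (A.zero_mem_vertex _),
      (A'.isOpen_domain (.vertex (P'.vertex (f.toEquiv d)))).mem_nhds (A'.zero_mem_vertex _)]
      with w h1 h2
    by_cases h0 : w = 0
    · rw [h0, mul_zero, glued_vertex_zero, glued_vertex_zero]
      exact (hg _).unique (.vertex d) rfl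
    obtain ⟨e, z, he, hu, hz, rfl, -⟩ := A.exists_upper_of_mem_vertex h1 h0
    -- The two labellings may have different `δ`; `w` is taken in the smaller disk, and its modulus
    -- depends only on that of `z`.
    have hz' : ‖z‖ < A'.radius := by
      rw [mem_vertex, norm_toVertex, ← A'.norm_toVertex (f.toEquiv e), ← mem_vertex] at h2
      exact (A'.toVertex_mem (P'.vertex (f.toEquiv d))).1 h2
    rw [← vertexRotation_eq A A' f he, ← toVertex_map, ← f.vertex_eq he, ← he]
    rcases hu with hu | hu
    · rw [A.glued_vertex_cell hu hz, A'.glued_vertex_cell hu hz', toCell_map A]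
      exact (hg _).unique (.cell e _ ((A.toCell_mem _).2 hu)) rfl
    · have hm : z ∈ A.domain (.edge e) := by
        refine ⟨hu.2, ?_⟩
        have := abs_lt.1 (A.re_lt_length_of_norm_lt hz e)
        linarith [length_pos (P := P) e]
      rw [← A.glued_edge_vertex hm hz, ← A'.glued_edge_vertex (map_mem_edge hm) hz']
      exact (hg _).unique (.edge e _ hm) rfl

/-- In the patch charts, which belong to any admissible structure, the map is locally multiplication
by a constant. -/
lemma contMDiff_of_corresponds [ChartedSpace ℂ A.Surface] [ChartedSpace ℂ A'.Surface]
    (hA : A.IsComplexStructure) (hA' : A'.IsComplexStructure) {g : A.Surface → A'.Surface}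
    (hg : ∀ p, Corresponds A A' f p (g p)) : ContMDiff 𝓘(ℂ) 𝓘(ℂ) ω g := by
  have := hA.isManifold
  have := hA'.isManifold
  intro p
  obtain ⟨i, j, z, k, hz, rfl, hk, hev⟩ := exists_local_form hg p
  obtain ⟨e, he, hei⟩ := hA.patchChart i
  obtain ⟨e', he', hej⟩ := hA'.patchChart j
  have hs := hei.glued_mem_source hz
  have h1 := contMDiffAt_of_mem_maximalAtlas he hs
  have h2 : ContMDiffAt 𝓘(ℂ) 𝓘(ℂ) ω (fun w : ℂ => k * w) (e (A.glued i z)) :=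
    (contDiff_const.mul contDiff_id).contMDiff.contMDiffAt
  have h3 : ContMDiffAt 𝓘(ℂ) 𝓘(ℂ) ω e'.symm (k * e (A.glued i z)) :=
    contMDiffAt_symm_of_mem_maximalAtlas he' (by rwa [hei.apply_glued hz, hej.1])
  refine ((h3.comp _ h2).comp _ h1).congr_of_eventuallyEq ?_
  have hcont := e.continuousAt hs
  rw [ContinuousAt, hei.apply_glued hz] at hcont
  have hk' : ∀ᶠ w in 𝓝 z, k * w ∈ A'.domain j :=
    (continuous_const.mul continuous_id).continuousAt.eventually
      ((A'.isOpen_domain j).mem_nhds hk)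
  filter_upwards [e.open_source.mem_nhds hs, hcont.eventually hev, hcont.eventually hk']
    with q h1 h2 h3
  obtain ⟨-, h4⟩ := hei.exists_of_mem_source h1
  rw [h4] at h2
  rw [h2, Function.comp_apply, Function.comp_apply, hej.symm_eq_glued h3]

theorem existsUnique_biholomorphic [ChartedSpace ℂ A.Surface] [ChartedSpace ℂ A'.Surface]
    (hA : A.IsComplexStructure) (hA' : A'.IsComplexStructure) (f : EdgeIsometry P P') :
    ∃! g : A.Surface ≃ₜ A'.Surface,
      ContMDiff 𝓘(ℂ) 𝓘(ℂ) ω g ∧ ContMDiff 𝓘(ℂ) 𝓘(ℂ) ω g.symm ∧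
      (∀ (d : D) (z : A.domain (.edge d)) (z' : A'.domain (.edge (f.toEquiv d))), (z' : ℂ) = z →
        g (A.patchMap (.edge d) z) = A'.patchMap (.edge (f.toEquiv d)) z') ∧
      (∀ d, g (A.vertexPoint (P.vertex d)) = A'.vertexPoint (P'.vertex (f.toEquiv d))) ∧
      (∀ d, g (A.puncture (P.cell d)) = A'.puncture (P'.cell (f.toEquiv d))) := by
  have h1 := contMDiff_of_corresponds hA hA' (corresponds_surfaceEquiv A A' f)
  have h2 := contMDiff_of_corresponds hA' hA (corresponds_surfaceEquiv_symm A A' f)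
  refine ⟨⟨surfaceEquiv A A' f, h1.continuous, h2.continuous⟩, ⟨h1, h2, ?_, ?_, ?_⟩, ?_⟩
  · intro d z z' hz
    rw [← glued_coe, ← glued_coe, hz]
    exact (corresponds_surfaceEquiv A A' f _).unique (.edge d z z.2) rfl
  · exact fun d => (corresponds_surfaceEquiv A A' f _).unique (.vertex d) rfl
  · intro d
    have := (corresponds_surfaceEquiv A A' f _).unique
      (.cell d 0 (A.zero_mem_cell _)) (A.glued_cell_zero _).symm
    rwa [mul_zero, glued_cell_zero] at this
  · rintro g ⟨-, -, hg, -, -⟩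
    have := A'.t2Space
    apply Homeomorph.ext
    -- The strips are dense and the target is Hausdorff, so the strip condition already determines
    -- `g`.
    refine congrFun (Continuous.ext_on A.dense_edges g.continuous h1.continuous ?_)
    intro p hp
    obtain ⟨d, z, hz, rfl⟩ := mem_iUnion.1 hp
    have h3 := hg d ⟨z, hz⟩ ⟨z, map_mem_edge hz⟩ rfl
    rw [← glued_of_mem, ← glued_of_mem] at h3
    rw [h3]
    exact ((corresponds_surfaceEquiv A A' f _).unique (.edge d z hz) rfl).symm

end Labelling

end ConicalPolytope

/-! ### Barycentric coordinates on `M` and compactified half-strips of the glued space. -/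

namespace Triangulation

variable {D : Type u} (T : Triangulation D)

instance [Finite D] : CompactSpace T.Realization :=
  inferInstanceAs (CompactSpace (Quot T.SideGlue))

/-- Three reals are barycentric coordinates of a point of a triangle. -/
def IsBary (p q t : ℝ) : Prop := 0 ≤ p ∧ 0 ≤ q ∧ 0 ≤ t ∧ p + q + t = 1

lemma IsBary.mem {p q t : ℝ} (h : IsBary p q t) : ![p, q, t] ∈ stdSimplex ℝ (Fin 3) := by
  refine ⟨fun i => ?_, by simpa [Fin.sum_univ_three] using h.2.2.2⟩
  fin_cases i
  · exact h.1
  · exact h.2.1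
  · exact h.2.2.1

lemma isBary_coe (x : stdSimplex ℝ (Fin 3)) :
    IsBary ((x : Fin 3 → ℝ) 0) ((x : Fin 3 → ℝ) 1) ((x : Fin 3 → ℝ) 2) :=
  ⟨x.2.1 0, x.2.1 1, x.2.1 2, (Fin.sum_univ_three _).symm.trans x.2.2⟩

open Classical in
/-- The point of `M` with barycentric coordinates `p, q, t` in the triangle of `d`, with a default
value when these are not barycentric coordinates. -/
def baryPoint (d : D) (p q t : ℝ) : T.Realization :=
  if h : IsBary p q t then T.point d ⟨_, h.mem⟩ else T.point d ⟨_, IsBary.mem (p := 1) (q := 0)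
    (t := 0) ⟨by norm_num, by norm_num, by norm_num, by norm_num⟩⟩

lemma baryPoint_of_isBary {d : D} {p q t : ℝ} (h : IsBary p q t) :
    T.baryPoint d p q t = T.point d ⟨_, h.mem⟩ := dif_pos h

lemma point_eq_baryPoint (d : D) (x : stdSimplex ℝ (Fin 3)) : T.point d x =
    T.baryPoint d ((x : Fin 3 → ℝ) 0) ((x : Fin 3 → ℝ) 1) ((x : Fin 3 → ℝ) 2) := by
  rw [baryPoint_of_isBary _ (isBary_coe x)]
  congr 1
  ext i
  fin_cases i <;> rfl

lemma baryPoint_rot {d : D} {p q t : ℝ} (h : IsBary p q t) :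
    T.baryPoint (T.rot d) q t p = T.baryPoint d p q t := by
  rw [baryPoint_of_isBary _ h, baryPoint_of_isBary _
    (⟨h.2.1, h.2.2.1, h.1, by linarith [h.2.2.2]⟩ : IsBary q t p)]
  refine (Quot.sound (SideGlue.rotate d _ _ fun i => ?_)).symm
  fin_cases i <;> rfl

lemma baryPoint_opp {d : D} {p q : ℝ} (h : IsBary p q 0) :
    T.baryPoint (T.opp d) q p 0 = T.baryPoint d p q 0 := by
  rw [baryPoint_of_isBary _ h, baryPoint_of_isBary _
    (⟨h.2.1, h.1, le_rfl, by linarith [h.2.2.2]⟩ : IsBary q p 0)]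
  refine (Quot.sound (SideGlue.side d _ _ rfl fun i => ?_)).symm
  fin_cases i <;> rfl

end Triangulation

namespace ConicalPolytope

open Triangulation

variable {D : Type u} {P : ConicalPolytope D}

lemma length_sub_halfLength (d : D) : P.length d - P.halfLength d = P.halfLength (P.opp d) := by
  simp [length]

namespace Labelling

variable (A : P.Labelling)

open Classical in
/-- The compactified closed upper half of the strip of `d`: the point at position `a` along the
edge and at distance `r` from the puncture, where `r = 1` on the edge. -/
def stripPoint (d : D) (a r : ℝ) : A.Surface :=
  if r < 1 then A.glued (.cell (P.cell d)) (r * A.toCell d a)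
  else if a ≤ 0 then A.vertexPoint (P.vertex d)
  else if P.length d ≤ a then A.vertexPoint (P.vertex (P.opp d))
  else A.glued (.edge d) a

lemma stripPoint_of_lt {d : D} {a r : ℝ} (h : r < 1) :
    A.stripPoint d a r = A.glued (.cell (P.cell d)) (r * A.toCell d a) := if_pos h

lemma stripPoint_zero_one (d : D) : A.stripPoint d 0 1 = A.vertexPoint (P.vertex d) := by
  simp [stripPoint]

lemma stripPoint_length_one (d : D) :
    A.stripPoint d (P.length d) 1 = A.vertexPoint (P.vertex (P.opp d)) := by
  rw [stripPoint, if_neg (lt_irrefl _), if_neg (length_pos d).not_ge, if_pos le_rfl]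

lemma stripPoint_one {d : D} {a : ℝ} (h0 : 0 < a) (h1 : a < P.length d) :
    A.stripPoint d a 1 = A.glued (.edge d) a := by
  rw [stripPoint, if_neg (lt_irrefl _), if_neg h0.not_ge, if_neg h1.not_ge]

lemma stripPoint_puncture (d : D) (a : ℝ) : A.stripPoint d a 0 = A.puncture (P.cell d) := by
  rw [stripPoint_of_lt _ one_pos, Complex.ofReal_zero, zero_mul, glued_cell_zero]

lemma ofReal_mem_edge {d : D} {a : ℝ} :
    (a : ℂ) ∈ A.domain (.edge d) ↔ 0 < a ∧ a < P.length d := Iff.rfl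

lemma stripPoint_flip {d : D} {a : ℝ} (h0 : 0 ≤ a) (h1 : a ≤ P.length d) :
    A.stripPoint (P.opp d) (P.length d - a) 1 = A.stripPoint d a 1 := by
  rcases h0.eq_or_lt with rfl | h0
  · rw [sub_zero, stripPoint_zero_one, ← length_opp, stripPoint_length_one, P.opp_opp]
  rcases h1.eq_or_lt with rfl | h1
  · rw [sub_self, stripPoint_zero_one, stripPoint_length_one]
  rw [A.stripPoint_one h0 h1, A.stripPoint_one (by linarith) (by rw [length_opp]; linarith),
    A.glued_flip (A.ofReal_mem_edge.2 ⟨h0, h1⟩), Complex.ofReal_sub]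

lemma norm_mul_toCell {d : D} {a r : ℝ} (h : 0 ≤ r) : ‖(r * A.toCell d a : ℂ)‖ = r := by
  rw [norm_mul, norm_toCell_of_im_eq_zero _ (Complex.ofReal_im a), mul_one, Complex.norm_real,
    Real.norm_of_nonneg h]

lemma mul_toCell_mem {d : D} {a r : ℝ} (c : P.Cell) (h : 0 ≤ r) (h1 : r < 1) :
    (r * A.toCell d a : ℂ) ∈ A.domain (.cell c) := by
  rwa [mem_cell, A.norm_mul_toCell h]

/-- The height above the edge of the points at distance `r` from the puncture. -/
def height (d : D) (r : ℝ) : ℝ := -(P.perimeter (P.cell d) / (2 * Real.pi)) * Real.log r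

lemma height_one (d : D) : height (P := P) d 1 = 0 := by simp [height]

lemma tendsto_height {X : Type*} {l : Filter X} {r : X → ℝ} (d : D) (h : Tendsto r l (𝓝 1)) :
    Tendsto (fun x => height (P := P) d (r x)) l (𝓝 0) := by
  have := ((Real.continuousAt_log one_ne_zero).tendsto.comp h).const_mul
    (-(P.perimeter (P.cell d) / (2 * Real.pi)))
  rwa [Real.log_one, mul_zero] at this

variable [Finite D]

/-- The height is chosen so that raising `z` by it scales the cell coordinate by `r`; this
translates between polar and strip coordinates. -/
lemma toCell_add_height (d : D) (z : ℂ) {r : ℝ} (h : 0 < r) :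
    A.toCell d (z + height (P := P) d r * Complex.I) = r * A.toCell d z := by
  have hL := A.perimeter_ne_zero (P.cell d)
  have hpi : (Real.pi : ℂ) ≠ 0 := by exact_mod_cast Real.pi_ne_zero
  have : (r : ℂ) = Complex.exp (Real.log r) := by
    rw [← Complex.ofReal_exp, Real.exp_log h]
  rw [toCell_eq, toCell_eq, this, ← Complex.exp_add, height]
  congr 1
  push_cast
  field_simp
  linear_combination -(P.perimeter (P.cell d) * Real.log r : ℂ) * Complex.I_sq

lemma height_pos (A : P.Labelling) (d : D) {r : ℝ} (h0 : 0 < r) (h1 : r < 1) :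
    0 < height (P := P) d r := by
  have := A.perimeter_pos (P.cell d)
  rw [height, neg_mul, neg_pos]
  exact mul_neg_of_pos_of_neg (by positivity) (Real.log_neg h0 h1)

lemma stripPoint_next (d : D) (r : ℝ) (h : r ≤ 1) :
    A.stripPoint (P.next d) 0 r = A.stripPoint d (P.length d) r := by
  rcases h.lt_or_eq with h | rfl
  · rw [stripPoint_of_lt _ h, stripPoint_of_lt _ h, toCell_next, P.cell_next, Complex.ofReal_zero,
      add_zero]
  · rw [stripPoint_zero_one, stripPoint_length_one, P.vertex_next]

lemma stripPoint_opp_rot (d : D) (r : ℝ) (h : r ≤ 1) :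
    A.stripPoint (P.opp (P.rot d)) (P.length (P.rot d)) r = A.stripPoint d 0 r := by
  have := A.stripPoint_next (P.opp (P.rot d)) r h
  rw [P.next_opp_rot, length_opp] at this
  exact this.symm

lemma stripPoint_eq_edge {d : D} {a r : ℝ} (ha0 : 0 < a) (ha1 : a < P.length d) (h0 : 0 < r)
    (h1 : r ≤ 1) : A.stripPoint d a r =
      A.glued (.edge d) (a + height (P := P) d r * Complex.I) := by
  rcases h1.lt_or_eq with h1 | rfl
  · rw [stripPoint_of_lt _ h1, ← A.toCell_add_height d _ h0, A.glued_edge_cell]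
    · simpa [mem_edge] using ⟨ha0, ha1⟩
    · simpa using A.height_pos d h0 h1
  · rw [A.stripPoint_one ha0 ha1, height_one]
    simp

lemma stripPoint_eq_vertex {d : D} {a r : ℝ} (ha0 : 0 ≤ a) (h0 : 0 < r) (h1 : r ≤ 1)
    (hn : ‖(a + height (P := P) d r * Complex.I : ℂ)‖ < A.radius) :
    A.stripPoint d a r = A.glued (.vertex (P.vertex d))
      (A.toVertex d (a + height (P := P) d r * Complex.I)) := by
  rcases h1.lt_or_eq with h1 | rfl
  · rw [stripPoint_of_lt _ h1, ← A.toCell_add_height d _ h0, A.glued_vertex_cell _ hn]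
    simpa using A.height_pos d h0 h1
  · rw [height_one, Complex.ofReal_zero, zero_mul, add_zero] at *
    rcases ha0.eq_or_lt with rfl | ha0
    · rw [stripPoint_zero_one, Complex.ofReal_zero, toVertex_zero, glued_vertex_zero]
    · have ha1 : a < P.length d := by
        have := abs_lt.1 (A.re_lt_length_of_norm_lt hn d)
        simp only [Complex.ofReal_re] at this
        linarith [length_pos (P := P) d]
      rw [A.stripPoint_one ha0 ha1, A.glued_edge_vertex ⟨ha0, ha1⟩ hn]

/-- Near its right end, the strip is described by the vertex coordinate of `next d`, with origin
moved to that end. On the edge itself this coordinate is on the negative axis, and `toVertex_rot`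
identifies it with the positive axis of `opp d`. -/
lemma stripPoint_eq_vertex_next {d : D} {b r : ℝ} (hb0 : 0 ≤ b) (h0 : 0 < r) (h1 : r ≤ 1)
    (hn : ‖(-b + height (P := P) d r * Complex.I : ℂ)‖ < A.radius) :
    A.stripPoint d (P.length d - b) r = A.glued (.vertex (P.vertex (P.next d)))
      (A.toVertex (P.next d) (-b + height (P := P) d r * Complex.I)) := by
  rcases h1.lt_or_eq with h1 | rfl
  · have hi : 0 < (-b + height (P := P) d r * Complex.I : ℂ).im := by
      simpa using A.height_pos d h0 h1
    rw [stripPoint_of_lt _ h1, ← A.toCell_add_height d _ h0, A.glued_vertex_cell hi hn,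
      P.cell_next, toCell_next, Complex.ofReal_sub, sub_eq_add_neg, add_assoc]
  · rw [height_one, Complex.ofReal_zero, zero_mul, add_zero] at *
    rcases hb0.eq_or_lt with rfl | hb0
    · rw [sub_zero, stripPoint_length_one, Complex.ofReal_zero, neg_zero, toVertex_zero,
        glued_vertex_zero, P.vertex_next]
    · rw [norm_neg] at hn
      have hb1 : b < P.length d := by
        have := abs_lt.1 (A.re_lt_length_of_norm_lt hn d)
        simp only [Complex.ofReal_re] at this
        linarith [length_pos (P := P) d]
      have hm : (b : ℂ) ∈ A.domain (.edge (P.opp d)) := ⟨hb0, by rwa [length_opp]⟩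
      rw [← A.toVertex_rot (Or.inr ⟨by simp, by simpa using hb0⟩), neg_neg, P.rot_next,
        P.vertex_next, ← A.glued_edge_vertex hm hn, ← A.stripPoint_flip (by linarith) (by linarith),
        sub_sub_cancel, A.stripPoint_one hb0 (by rwa [length_opp])]

/-- The compactified half-strip is parametrized continuously, and at the puncture the position
along the edge need not converge. -/
lemma tendsto_stripPoint {X : Type*} {l : Filter X} {a r : X → ℝ} {d : D} {a₀ r₀ : ℝ}
    (hr : Tendsto r l (𝓝 r₀)) (ha : r₀ ≠ 0 → Tendsto a l (𝓝 a₀))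
    (hev : ∀ᶠ x in l, 0 ≤ a x ∧ a x ≤ P.length d ∧ 0 ≤ r x ∧ r x ≤ 1)
    (ha0 : 0 ≤ a₀) (ha1 : a₀ ≤ P.length d) (hr0 : 0 ≤ r₀) (hr1 : r₀ ≤ 1) :
    Tendsto (fun x => A.stripPoint d (a x) (r x)) l (𝓝 (A.stripPoint d a₀ r₀)) := by
  rcases hr1.lt_or_eq with hlt | rfl
  · have h1 : Tendsto (fun x => (r x * A.toCell d (a x) : ℂ)) l (𝓝 (r₀ * A.toCell d a₀)) := by
      by_cases h0 : r₀ = 0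
      · rw [h0, Complex.ofReal_zero, zero_mul, tendsto_zero_iff_norm_tendsto_zero]
        rw [h0] at hr
        refine hr.congr' ?_
        filter_upwards [hev] with x hx
        rw [A.norm_mul_toCell hx.2.2.1]
      · exact ((Complex.continuous_ofReal.tendsto _).comp hr).mul
          (((A.continuous_toCell d).comp Complex.continuous_ofReal).tendsto _ |>.comp (ha h0))
    rw [stripPoint_of_lt _ hlt]
    refine ((A.continuousAt_glued (A.mul_toCell_mem _ hr0 hlt)).tendsto.comp h1).congr' ?_
    filter_upwards [hr.eventually (gt_mem_nhds hlt)] with x hx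
    rw [stripPoint_of_lt _ hx, Function.comp_apply]
  · replace ha := ha one_ne_zero
    have hy : Tendsto (fun x => (height (P := P) d (r x) * Complex.I : ℂ)) l (𝓝 0) := by
      have := ((Complex.continuous_ofReal.tendsto _).comp (tendsto_height (P := P) d hr)).mul_const
        Complex.I
      rwa [Complex.ofReal_zero, zero_mul] at this
    have hpos : ∀ᶠ x in l, 0 < r x := hr.eventually (lt_mem_nhds one_pos)
    rcases ha0.eq_or_lt with rfl | ha0
    · have hz : Tendsto (fun x => (a x + height (P := P) d (r x) * Complex.I : ℂ)) l (𝓝 0) := by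
        have := ((Complex.continuous_ofReal.tendsto _).comp ha).add hy
        rwa [Complex.ofReal_zero, add_zero] at this
      have hn : ∀ᶠ x in l, ‖(a x + height (P := P) d (r x) * Complex.I : ℂ)‖ < A.radius := by
        have := hz.norm
        rw [norm_zero] at this
        exact this.eventually (gt_mem_nhds A.radius_pos)
      rw [stripPoint_zero_one, ← glued_vertex_zero]
      refine ((A.continuousAt_glued (A.zero_mem_vertex _)).tendsto.comp
        ((A.tendsto_toVertex_zero d).comp hz)).congr' ?_
      filter_upwards [hev, hpos, hn] with x h1 h2 h3
      exact (A.stripPoint_eq_vertex h1.1 h2 h1.2.2.2 h3).symm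
    rcases ha1.eq_or_lt with rfl | ha1
    · have hz : Tendsto (fun x => (-(P.length d - a x : ℝ) +
          height (P := P) d (r x) * Complex.I : ℂ)) l (𝓝 0) := by
        have := (((Complex.continuous_ofReal.tendsto _).comp
          (ha.const_sub (P.length d))).neg).add hy
        rwa [sub_self, Complex.ofReal_zero, neg_zero, add_zero] at this
      have hn : ∀ᶠ x in l, ‖(-(P.length d - a x : ℝ) +
          height (P := P) d (r x) * Complex.I : ℂ)‖ < A.radius := by
        have := hz.norm
        rw [norm_zero] at this
        exact this.eventually (gt_mem_nhds A.radius_pos)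
      rw [stripPoint_length_one, ← P.vertex_next, ← glued_vertex_zero]
      refine ((A.continuousAt_glued (A.zero_mem_vertex _)).tendsto.comp
        ((A.tendsto_toVertex_zero (P.next d)).comp hz)).congr' ?_
      filter_upwards [hev, hpos, hn] with x h1 h2 h3
      have := A.stripPoint_eq_vertex_next (sub_nonneg.2 h1.2.1) h2 h1.2.2.2 h3
      rw [sub_sub_cancel] at this
      exact this.symm
    · have hz : Tendsto (fun x => (a x + height (P := P) d (r x) * Complex.I : ℂ)) l (𝓝 a₀) := by
        have := ((Complex.continuous_ofReal.tendsto _).comp ha).add hy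
        rwa [add_zero] at this
      rw [A.stripPoint_one ha0 ha1]
      refine ((A.continuousAt_glued (A.ofReal_mem_edge.2 ⟨ha0, ha1⟩)).tendsto.comp hz).congr' ?_
      filter_upwards [hev, hpos, ha.eventually (lt_mem_nhds ha0),
        ha.eventually (gt_mem_nhds ha1)] with x h1 h2 h3 h4
      exact (A.stripPoint_eq_edge h3 h4 h2 h1.2.2.2).symm

lemma exists_stripPoint (p : A.Surface) :
    ∃ d a r, 0 ≤ a ∧ a ≤ P.length d ∧ 0 ≤ r ∧ r ≤ 1 ∧ A.stripPoint d a r = p := by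
  rcases A.exists_cell_or_edge_or_vertex p with ⟨c, ζ, h, rfl⟩ | ⟨d, t, h, rfl⟩ | ⟨v, rfl⟩
  · by_cases h0 : ζ = 0
    · obtain ⟨d, rfl⟩ := P.exists_cell c
      exact ⟨d, 0, 0, le_rfl, (length_pos d).le, le_rfl, zero_le_one,
        by rw [h0, stripPoint_puncture, glued_cell_zero]⟩
    · obtain ⟨d, rfl, z, hz0, hz1, rfl⟩ := A.exists_toCell c h0
      have hn : 0 < ‖A.toCell d z‖ := norm_pos_iff.2 h0
      refine ⟨d, z.re, ‖A.toCell d z‖, hz0, hz1.le, hn.le, le_of_lt h, ?_⟩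
      rw [stripPoint_of_lt _ h, ← A.toCell_add_height d _ hn]
      congr 2
      have hp := A.perimeter_pos (P.cell d)
      have hpi := Real.pi_pos
      have : height (P := P) d ‖A.toCell d z‖ = z.im := by
        rw [height, norm_toCell, Real.log_exp]
        field_simp
      rw [this, Complex.re_add_im]
  · rw [ofReal_mem_edge] at h
    exact ⟨d, t, 1, h.1.le, h.2.le, zero_le_one, le_rfl, A.stripPoint_one h.1 h.2⟩
  · obtain ⟨d, rfl⟩ := P.exists_vertex v
    exact ⟨d, 0, 1, le_rfl, (length_pos d).le, zero_le_one, le_rfl, A.stripPoint_zero_one d⟩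

end Labelling

end ConicalPolytope

/-! ### The continuous map from `M`, piece by piece of the barycentric subdivision. -/

namespace ConicalPolytope

open Triangulation

variable {D : Type u} {P : ConicalPolytope D}

/-- The position along the segment from the barycentre to the midpoint of a side of the central
projection, from the end of the side, of the point with barycentric coordinates `p`, `1 - p - t`,
`t` on that side of the segment. -/
def position (p t : ℝ) : ℝ := 2 * (p - t) / (2 * p + t)

lemma position_nonneg {p t : ℝ} (ht : 0 ≤ t) (h : t ≤ p) : 0 ≤ position p t :=
  div_nonneg (by linarith) (by linarith)

lemma position_le_one {p t : ℝ} (ht : 0 ≤ t) (h : t ≤ p) : position p t ≤ 1 :=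
  div_le_one_of_le₀ (by linarith) (by linarith)

lemma position_self (t : ℝ) : position t t = 0 := by simp [position]

lemma position_zero {p : ℝ} (h : p ≠ 0) : position p 0 = 1 := by
  rw [position]
  field_simp
  ring

lemma mul_position {p t : ℝ} (ht : 0 ≤ t) (h : t ≤ p) :
    (2 * p + t) * position p t = 2 * (p - t) := by
  rcases eq_or_ne (2 * p + t) 0 with h0 | h0
  · rw [h0, zero_mul]
    linarith
  · rw [position, mul_div_cancel₀ _ h0]

lemma half_mul_le {d : D} {s : ℝ} (h : s ≤ 1) : P.halfLength d * s ≤ P.halfLength d :=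
  mul_le_of_le_one_right (P.halfLength_pos d).le h

lemma half_mul_nonneg {d : D} {s : ℝ} (h : 0 ≤ s) : 0 ≤ P.halfLength d * s :=
  mul_nonneg (P.halfLength_pos d).le h

namespace Labelling

variable (A : P.Labelling)

/-- The image of the point with barycentric coordinates `p, q, t` in the triangle of `d`, where
the triangle is divided into its 6 barycentric pieces and the point is in one of the two pieces at
the side `d`. -/
def sideMap (d : D) (p q t : ℝ) : A.Surface :=
  if p ≤ q then A.stripPoint d (P.halfLength d * position p t) (2 * p + t)
  else A.stripPoint (P.opp d) (P.length d - P.halfLength d * position q t) (2 * q + t)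

lemma sideMap_of_le {d : D} {p q t : ℝ} (h : p ≤ q) : A.sideMap d p q t =
    A.stripPoint d (P.halfLength d * position p t) (2 * p + t) := if_pos h

lemma sideMap_of_ge {d : D} {p q t : ℝ} (hb : IsBary p q t) (htq : t ≤ q) (h : q ≤ p) :
    A.sideMap d p q t =
      A.stripPoint (P.opp d) (P.length d - P.halfLength d * position q t) (2 * q + t) := by
  rcases h.lt_or_eq with h | rfl
  · exact if_neg h.not_ge
  · have h1 : 2 * q + t = 1 := by linarith [hb.2.2.2]
    rw [sideMap_of_le _ le_rfl, h1, stripPoint_flip _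
      (half_mul_nonneg (position_nonneg hb.2.2.1 htq))
      ((half_mul_le (position_le_one hb.2.2.1 htq)).trans (halfLength_lt d).le)]

/-- The image of the point with barycentric coordinates `p, q, t` in the triangle of `d`. -/
def triangleMap (d : D) (p q t : ℝ) : A.Surface :=
  if t ≤ p ∧ t ≤ q then A.sideMap d p q t
  else if p ≤ q ∧ p ≤ t then A.sideMap (P.rot d) q t p
  else A.sideMap (P.rot (P.rot d)) t p q

lemma triangleMap_of_third {d : D} {p q t : ℝ} (h1 : t ≤ p) (h2 : t ≤ q) :
    A.triangleMap d p q t = A.sideMap d p q t := if_pos ⟨h1, h2⟩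

/-- A point of the side projects to its midpoint, whose positions in the two adjacent triangles are
complementary half-lengths. At an end of the side the position is irrelevant, as the image is the
puncture. -/
lemma sideMap_opp {d : D} {p q : ℝ} (hb : IsBary p q 0) :
    A.sideMap (P.opp d) q p 0 = A.sideMap d p q 0 := by
  have key {d : D} {p q : ℝ} (hb : IsBary p q 0) (h : p ≤ q) :
      A.sideMap (P.opp d) q p 0 = A.sideMap d p q 0 := by
    have hb' : IsBary q p 0 := ⟨hb.2.1, hb.1, le_rfl, by linarith [hb.2.2.2]⟩
    rw [sideMap_of_le _ h, A.sideMap_of_ge hb' hb.1 h, P.opp_opp]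
    by_cases h0 : p = 0
    · rw [h0, mul_zero, add_zero, stripPoint_puncture, stripPoint_puncture]
    · rw [position_zero h0, mul_one, mul_one, length_sub_halfLength, P.opp_opp]
  rcases le_total p q with h | h
  · exact key hb h
  · have hb' : IsBary q p 0 := ⟨hb.2.1, hb.1, le_rfl, by linarith [hb.2.2.2]⟩
    have := key (d := P.opp d) hb' h
    rw [P.opp_opp] at this
    exact this.symm

variable [Finite D]

/-- On the segment from the barycentre to a corner, both positions are at the trivalent vertex: the
start for `d`, the end for `opp (rot d)`. -/
lemma sideMap_rot {d : D} {p q : ℝ} (hb : IsBary p q p) (h : p ≤ q) :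
    A.sideMap (P.rot d) q p p = A.sideMap d p q p := by
  have hb' : IsBary q p p := ⟨hb.2.1, hb.1, hb.1, by linarith [hb.2.2.2]⟩
  rw [sideMap_of_le _ h, A.sideMap_of_ge hb' le_rfl h, position_self, mul_zero, mul_zero, sub_zero,
    stripPoint_opp_rot]
  linarith [hb.2.2.2]

lemma triangleMap_of_first {d : D} {p q t : ℝ} (hb : IsBary p q t) (h1 : p ≤ q) (h2 : p ≤ t) :
    A.triangleMap d p q t = A.sideMap (P.rot d) q t p := by
  by_cases h : t ≤ p ∧ t ≤ q
  · have : t = p := le_antisymm h.1 h2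
    subst this
    rw [A.triangleMap_of_third le_rfl h1, A.sideMap_rot hb h1]
  · rw [triangleMap, if_neg h, if_pos ⟨h1, h2⟩]

lemma triangleMap_of_second {d : D} {p q t : ℝ} (hb : IsBary p q t) (h1 : q ≤ p) (h2 : q ≤ t) :
    A.triangleMap d p q t = A.sideMap (P.rot (P.rot d)) t p q := by
  obtain ⟨hp, hq, ht, hs⟩ := hb
  by_cases h : t ≤ p ∧ t ≤ q
  · have : t = q := le_antisymm h.2 h2
    subst this
    have := A.sideMap_rot (d := P.rot (P.rot d)) (p := t) (q := p)
      ⟨ht, hp, ht, by linarith⟩ h.1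
    rw [P.rot_cube] at this
    rw [A.triangleMap_of_third h.1 le_rfl, this]
  · by_cases h' : p ≤ q ∧ p ≤ t
    · have : p = q := le_antisymm h'.1 h1
      subst this
      rw [A.triangleMap_of_first ⟨hp, hq, ht, hs⟩ le_rfl h2,
        A.sideMap_rot ⟨hp, ht, hp, by linarith⟩ h2]
    · rw [triangleMap, if_neg h, if_neg h']

lemma min_cases_three (p q t : ℝ) :
    (t ≤ p ∧ t ≤ q) ∨ (p ≤ q ∧ p ≤ t) ∨ (q ≤ p ∧ q ≤ t) := by
  rcases le_total p q with h1 | h1 <;> rcases le_total q t with h2 | h2 <;>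
    rcases le_total p t with h3 | h3 <;> grind

lemma triangleMap_rot {d : D} {p q t : ℝ} (hb : IsBary p q t) :
    A.triangleMap (P.rot d) q t p = A.triangleMap d p q t := by
  have hb' : IsBary q t p := ⟨hb.2.1, hb.2.2.1, hb.1, by linarith [hb.2.2.2]⟩
  rcases min_cases_three p q t with ⟨h1, h2⟩ | ⟨h1, h2⟩ | ⟨h1, h2⟩
  · rw [A.triangleMap_of_third h1 h2, A.triangleMap_of_second hb' h2 h1, P.rot_cube]
  · rw [A.triangleMap_of_first hb h1 h2, A.triangleMap_of_third h1 h2]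
  · rw [A.triangleMap_of_second hb h1 h2, A.triangleMap_of_first hb' h2 h1]

lemma continuousOn_sideMap {X : Type*} [TopologicalSpace X] {p q t : X → ℝ} (hp : Continuous p)
    (hq : Continuous q) (ht : Continuous t) (hb : ∀ x, IsBary (p x) (q x) (t x)) (d : D) :
    ContinuousOn (fun x => A.sideMap d (p x) (q x) (t x)) {x | t x ≤ p x ∧ t x ≤ q x} := by
  have hpos {s t : X → ℝ} (hs : Continuous s) (ht : Continuous t) (x : X)
      (h0 : 2 * s x + t x ≠ 0) : Tendsto (fun x => position (s x) (t x)) (𝓝 x)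
        (𝓝 (position (s x) (t x))) :=
    ((continuous_const.mul (hs.sub ht)).tendsto x).div
      (((continuous_const.mul hs).add ht).tendsto x) h0
  have h1 : ContinuousOn (fun x => A.sideMap d (p x) (q x) (t x))
      {x | t x ≤ p x ∧ p x ≤ q x} := by
    refine ContinuousOn.congr (f := fun x => A.stripPoint d (P.halfLength d *
      position (p x) (t x)) (2 * p x + t x)) (fun x hx => ?_) fun x hx => A.sideMap_of_le hx.2
    have bd : ∀ x, t x ≤ p x ∧ p x ≤ q x → 0 ≤ P.halfLength d * position (p x) (t x) ∧
        P.halfLength d * position (p x) (t x) ≤ P.length d ∧ 0 ≤ 2 * p x + t x ∧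
        2 * p x + t x ≤ 1 := by
      intro x hx
      obtain ⟨b1, b2, b3, b4⟩ := hb x
      exact ⟨half_mul_nonneg (position_nonneg b3 hx.1),
        (half_mul_le (position_le_one b3 hx.1)).trans (halfLength_lt d).le,
        by linarith, by linarith [hx.2]⟩
    obtain ⟨c1, c2, c3, c4⟩ := bd x hx
    -- The position is discontinuous only where `2 * p + t` vanishes, at the puncture, and there its
    -- limit is not required.
    refine A.tendsto_stripPoint
      ((((continuous_const.mul hp).add ht).tendsto x).mono_left nhdsWithin_le_nhds)
      (fun h0 => ((hpos hp ht x h0).const_mul _).mono_left nhdsWithin_le_nhds) ?_ c1 c2 c3 c4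
    filter_upwards [self_mem_nhdsWithin] with y hy using bd y hy
  have h2 : ContinuousOn (fun x => A.sideMap d (p x) (q x) (t x))
      {x | t x ≤ q x ∧ q x ≤ p x} := by
    refine ContinuousOn.congr (f := fun x => A.stripPoint (P.opp d) (P.length d -
      P.halfLength d * position (q x) (t x)) (2 * q x + t x)) (fun x hx => ?_)
      fun x hx => A.sideMap_of_ge (hb x) hx.1 hx.2
    have bd : ∀ x, t x ≤ q x ∧ q x ≤ p x →
        0 ≤ P.length d - P.halfLength d * position (q x) (t x) ∧
        P.length d - P.halfLength d * position (q x) (t x) ≤ P.length (P.opp d) ∧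
        0 ≤ 2 * q x + t x ∧ 2 * q x + t x ≤ 1 := by
      intro x hx
      obtain ⟨b1, b2, b3, b4⟩ := hb x
      have := half_mul_nonneg (P := P) (d := d) (position_nonneg b3 hx.1)
      have := (half_mul_le (P := P) (d := d) (position_le_one b3 hx.1)).trans (halfLength_lt d).le
      rw [length_opp]
      exact ⟨by linarith, by linarith, by linarith, by linarith [hx.2]⟩
    obtain ⟨c1, c2, c3, c4⟩ := bd x hx
    refine A.tendsto_stripPoint
      ((((continuous_const.mul hq).add ht).tendsto x).mono_left nhdsWithin_le_nhds)
      (fun h0 => (((hpos hq ht x h0).const_mul _).const_sub _).mono_left nhdsWithin_le_nhds)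
      ?_ c1 c2 c3 c4
    filter_upwards [self_mem_nhdsWithin] with y hy using bd y hy
  refine (h1.union_of_isClosed h2 ((isClosed_le ht hp).inter (isClosed_le hp hq))
    ((isClosed_le ht hq).inter (isClosed_le hq hp))).mono fun x hx => ?_
  rcases le_total (p x) (q x) with h | h
  · exact Or.inl ⟨hx.1, h⟩
  · exact Or.inr ⟨hx.2, h⟩

lemma continuous_triangleMap {X : Type*} [TopologicalSpace X] {p q t : X → ℝ} (hp : Continuous p)
    (hq : Continuous q) (ht : Continuous t) (hb : ∀ x, IsBary (p x) (q x) (t x)) (d : D) :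
    Continuous fun x => A.triangleMap d (p x) (q x) (t x) := by
  have hb1 (x : X) : IsBary (q x) (t x) (p x) :=
    ⟨(hb x).2.1, (hb x).2.2.1, (hb x).1, by linarith [(hb x).2.2.2]⟩
  have hb2 (x : X) : IsBary (t x) (p x) (q x) :=
    ⟨(hb x).2.2.1, (hb x).1, (hb x).2.1, by linarith [(hb x).2.2.2]⟩
  have h1 : ContinuousOn (fun x => A.triangleMap d (p x) (q x) (t x))
      {x | t x ≤ p x ∧ t x ≤ q x} :=
    (A.continuousOn_sideMap hp hq ht hb d).congr fun x hx => A.triangleMap_of_third hx.1 hx.2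
  have h2 : ContinuousOn (fun x => A.triangleMap d (p x) (q x) (t x))
      {x | p x ≤ q x ∧ p x ≤ t x} :=
    (A.continuousOn_sideMap hq ht hp hb1 (P.rot d)).congr
      fun x hx => A.triangleMap_of_first (hb x) hx.1 hx.2
  have h3 : ContinuousOn (fun x => A.triangleMap d (p x) (q x) (t x))
      {x | q x ≤ t x ∧ q x ≤ p x} :=
    (A.continuousOn_sideMap ht hp hq hb2 (P.rot (P.rot d))).congr
      fun x hx => A.triangleMap_of_second (hb x) hx.2 hx.1
  have c1 := (isClosed_le ht hp).inter (isClosed_le ht hq)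
  have c2 := (isClosed_le hp hq).inter (isClosed_le hp ht)
  have c3 := (isClosed_le hq ht).inter (isClosed_le hq hp)
  rw [← continuousOn_univ]
  refine ((h1.union_of_isClosed h2 c1 c2).union_of_isClosed h3 (c1.union c2) c3).mono
    fun x _ => ?_
  rcases min_cases_three (p x) (q x) (t x) with h | h | h
  · exact Or.inl (Or.inl h)
  · exact Or.inl (Or.inr h)
  · exact Or.inr h.symm

/-- The map from the triangulated surface to the glued space. -/
def surfaceMap : P.Realization → A.Surface :=
  Quot.lift (fun y : Σ _ : D, stdSimplex ℝ (Fin 3) => A.triangleMap y.1 ((y.2 : Fin 3 → ℝ) 0)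
    ((y.2 : Fin 3 → ℝ) 1) ((y.2 : Fin 3 → ℝ) 2)) <| by
  rintro _ _ (⟨d, x, y, h⟩ | ⟨d, x, y, hx, h⟩)
  · have h0 := h 0
    have h1 := h 1
    have h2 := h 2
    simp only [zero_add, Fin.isValue, show (1 : Fin 3) + 1 = 2 from rfl,
      show (2 : Fin 3) + 1 = 0 from rfl] at h0 h1 h2
    simp only [h0, h1, h2]
    exact (A.triangleMap_rot (isBary_coe x)).symm
  · have h0 := h 0
    have h1 := h 1
    have h2 := h 2
    rw [Equiv.swap_apply_left] at h0
    rw [Equiv.swap_apply_right] at h1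
    rw [Equiv.swap_apply_of_ne_of_ne (by decide) (by decide), hx] at h2
    have hb := isBary_coe x
    simp only [h0, h1, h2, hx] at hb ⊢
    rw [A.triangleMap_of_third hb.1 hb.2.1, A.triangleMap_of_third hb.2.1 hb.1,
      A.sideMap_opp hb]

lemma surfaceMap_baryPoint {d : D} {p q t : ℝ} (h : IsBary p q t) :
    A.surfaceMap (P.baryPoint d p q t) = A.triangleMap d p q t := by
  rw [baryPoint_of_isBary _ h]
  rfl

lemma continuous_surfaceMap : Continuous A.surfaceMap := by
  refine continuous_quot_lift _ (continuous_sigma fun d => ?_)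
  have h (i : Fin 3) : Continuous fun x : stdSimplex ℝ (Fin 3) => (x : Fin 3 → ℝ) i :=
    (continuous_apply i).comp continuous_subtype_val
  exact A.continuous_triangleMap (h 0) (h 1) (h 2) isBary_coe d

end Labelling

end ConicalPolytope

/-! ### The same rectangles on `M`, and bijectivity. -/

namespace Triangulation

variable {D : Type u} (T : Triangulation D)

/-- A point of the piece of the triangle of `d` between the barycentre, the midpoint of the side `d`
and the terminal end of this side. -/
def upperPoint (d : D) (s r : ℝ) : T.Realization :=
  T.baryPoint d (r * (1 / 3 + s / 6)) (1 - r * (2 / 3 - s / 6)) (r * (1 - s) / 3)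

/-- A point of the piece of the triangle of `d` between the barycentre, the midpoint of the side `d`
and the initial end of this side. -/
def lowerPoint (d : D) (s r : ℝ) : T.Realization :=
  T.baryPoint d (1 - r * (2 / 3 - s / 6)) (r * (1 / 3 + s / 6)) (r * (1 - s) / 3)

lemma isBary_piece {s r : ℝ} (hs0 : 0 ≤ s) (hs1 : s ≤ 1) (hr0 : 0 ≤ r) (hr1 : r ≤ 1) :
    IsBary (r * (1 / 3 + s / 6)) (1 - r * (2 / 3 - s / 6)) (r * (1 - s) / 3) := by
  refine ⟨by positivity, ?_, ?_, by ring⟩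
  · nlinarith
  · have : 0 ≤ r * (1 - s) := mul_nonneg hr0 (by linarith)
    linarith

lemma IsBary.swap {p q t : ℝ} (h : IsBary p q t) : IsBary q p t :=
  ⟨h.2.1, h.1, h.2.2.1, by linarith [h.2.2.2]⟩

lemma lowerPoint_one (d : D) (s : ℝ) : T.lowerPoint d s 1 = T.upperPoint d s 1 := by
  rw [lowerPoint, upperPoint]
  congr 1 <;> ring

lemma lowerPoint_rot_zero (d : D) {r : ℝ} (h0 : 0 ≤ r) (h1 : r ≤ 1) :
    T.lowerPoint (T.rot d) 0 r = T.upperPoint d 0 r := by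
  rw [upperPoint, ← T.baryPoint_rot (isBary_piece le_rfl zero_le_one h0 h1), lowerPoint]
  congr 1 <;> ring

lemma lowerPoint_opp_one (d : D) {r : ℝ} (h0 : 0 ≤ r) (h1 : r ≤ 1) :
    T.lowerPoint (T.opp d) 1 r = T.upperPoint d 1 r := by
  have h := isBary_piece zero_le_one le_rfl h0 h1
  have e : r * (1 - 1) / 3 = 0 := by ring
  rw [e] at h
  rw [upperPoint, lowerPoint, e, T.baryPoint_opp h]

lemma upperPoint_apex (d : D) (s : ℝ) : T.upperPoint d s 0 = T.baryPoint d 0 1 0 := by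
  rw [upperPoint]
  congr 1 <;> ring

lemma lowerPoint_apex (d : D) (s : ℝ) : T.lowerPoint (T.opp d) s 0 = T.baryPoint d 0 1 0 := by
  rw [← T.baryPoint_opp ⟨le_rfl, zero_le_one, le_rfl, by norm_num⟩, lowerPoint]
  congr 1 <;> ring

lemma upperPoint_vertex {d e : D} (h : T.vertex d = T.vertex e) :
    T.upperPoint d 0 1 = T.upperPoint e 0 1 := by
  obtain ⟨n, rfl⟩ := T.exists_rot_pow h
  clear h
  induction n with
  | zero => rfl
  | succ n ih =>
    rw [pow_succ', Equiv.Perm.mul_apply, ih, ← T.lowerPoint_rot_zero _ zero_le_one le_rfl,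
      lowerPoint_one]

end Triangulation

namespace ConicalPolytope

open Triangulation

variable {D : Type u} {P : ConicalPolytope D}

open Classical in
/-- The point of the triangulated surface that corresponds to a point of the compactified closed
upper half of a strip. -/
def realizationPoint (P : ConicalPolytope D) (d : D) (a r : ℝ) : P.Realization :=
  if a ≤ P.halfLength d then P.upperPoint d (a / P.halfLength d) r
  else P.lowerPoint (P.opp d) ((P.length d - a) / P.halfLength (P.opp d)) r

lemma realizationPoint_of_le {d : D} {a : ℝ} (r : ℝ) (h : a ≤ P.halfLength d) :
    P.realizationPoint d a r = P.upperPoint d (a / P.halfLength d) r := if_pos h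

lemma realizationPoint_of_ge {d : D} {a r : ℝ} (h0 : 0 ≤ r) (h1 : r ≤ 1)
    (h : P.halfLength d ≤ a) : P.realizationPoint d a r =
      P.lowerPoint (P.opp d) ((P.length d - a) / P.halfLength (P.opp d)) r := by
  rcases h.lt_or_eq with h | rfl
  · exact if_neg h.not_ge
  · rw [realizationPoint_of_le _ le_rfl, length_sub_halfLength,
      div_self (P.halfLength_pos _).ne', div_self (P.halfLength_pos _).ne',
      P.lowerPoint_opp_one d h0 h1]

lemma realizationPoint_zero (d : D) (r : ℝ) :
    P.realizationPoint d 0 r = P.upperPoint d 0 r := by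
  rw [realizationPoint_of_le _ (P.halfLength_pos d).le, zero_div]

lemma realizationPoint_next {d : D} {r : ℝ} (h0 : 0 ≤ r) (h1 : r ≤ 1) :
    P.realizationPoint (P.next d) 0 r = P.realizationPoint d (P.length d) r := by
  rw [realizationPoint_of_ge h0 h1 (halfLength_lt d).le, sub_self, zero_div,
    realizationPoint_zero, ← P.rot_next, P.lowerPoint_rot_zero _ h0 h1]

lemma realizationPoint_flip (d : D) (a : ℝ) :
    P.realizationPoint (P.opp d) (P.length d - a) 1 = P.realizationPoint d a 1 := by
  have hl := length_sub_halfLength (P := P) d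
  rcases le_total a (P.halfLength d) with h | h
  · rw [realizationPoint_of_le _ h, realizationPoint_of_ge zero_le_one le_rfl (by linarith),
      P.opp_opp, length_opp, sub_sub_cancel, P.lowerPoint_one]
  · rw [realizationPoint_of_ge zero_le_one le_rfl h, realizationPoint_of_le _ (by linarith),
      P.lowerPoint_one]

lemma realizationPoint_apex (d : D) (a : ℝ) :
    P.realizationPoint d a 0 = P.baryPoint d 0 1 0 := by
  rw [realizationPoint]
  split_ifs
  · exact P.upperPoint_apex d _
  · exact P.lowerPoint_apex d _

lemma baryPoint_apex_eq [Finite D] {d e : D} (h : P.cell d = P.cell e) :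
    P.baryPoint d 0 1 0 = P.baryPoint e 0 1 0 := by
  obtain ⟨n, rfl⟩ := (P.cell_eq_iff.1 h).exists_nat_pow_eq
  clear h
  induction n with
  | zero => rfl
  | succ n ih =>
    rw [pow_succ', Equiv.Perm.mul_apply, ih, ← realizationPoint_apex (P.next _) 0,
      realizationPoint_next le_rfl zero_le_one, realizationPoint_apex]

lemma exists_realizationPoint_of_le {d : D} {p q t : ℝ} (hb : IsBary p q t) (h1 : t ≤ p)
    (h2 : t ≤ q) : ∃ e a r, 0 ≤ a ∧ a ≤ P.length e ∧ 0 ≤ r ∧ r ≤ 1 ∧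
      P.realizationPoint e a r = P.baryPoint d p q t := by
  obtain ⟨hp, hq, ht, hs⟩ := hb
  rcases le_total p q with h | h
  · have hm := mul_position ht h1
    have hle := half_mul_le (P := P) (d := d) (position_le_one ht h1)
    refine ⟨d, P.halfLength d * position p t, 2 * p + t,
      half_mul_nonneg (position_nonneg ht h1), hle.trans (halfLength_lt d).le, by linarith,
      by linarith, ?_⟩
    rw [realizationPoint_of_le _ hle, mul_div_cancel_left₀ _ (P.halfLength_pos d).ne', upperPoint]
    congr 1
    · linear_combination ((1 : ℝ) / 6) * hm
    · linear_combination ((1 : ℝ) / 6) * hm - hs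
    · linear_combination (-(1 : ℝ) / 3) * hm
  · have hm := mul_position ht h2
    have hle := half_mul_le (P := P) (d := d) (position_le_one ht h2)
    have hl := length_sub_halfLength (P := P) d
    have hnn := half_mul_nonneg (P := P) (d := d) (position_nonneg ht h2)
    have := halfLength_lt (P := P) d
    refine ⟨P.opp d, P.length d - P.halfLength d * position q t, 2 * q + t, by linarith,
      by rw [length_opp]; linarith, by linarith, by linarith, ?_⟩
    rw [realizationPoint_of_ge (by linarith) (by linarith) (by linarith), P.opp_opp, length_opp,
      sub_sub_cancel, mul_div_cancel_left₀ _ (P.halfLength_pos d).ne', lowerPoint]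
    congr 1
    · linear_combination ((1 : ℝ) / 6) * hm - hs
    · linear_combination ((1 : ℝ) / 6) * hm
    · linear_combination (-(1 : ℝ) / 3) * hm

lemma exists_realizationPoint (y : P.Realization) : ∃ d a r, 0 ≤ a ∧ a ≤ P.length d ∧ 0 ≤ r ∧
    r ≤ 1 ∧ P.realizationPoint d a r = y := by
  obtain ⟨⟨d, x⟩, rfl⟩ := Quot.exists_rep y
  change ∃ e a r, 0 ≤ a ∧ a ≤ P.length e ∧ 0 ≤ r ∧ r ≤ 1 ∧
    P.realizationPoint e a r = P.point d x
  rw [P.point_eq_baryPoint]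
  have hb := isBary_coe x
  generalize (x : Fin 3 → ℝ) 0 = p, (x : Fin 3 → ℝ) 1 = q, (x : Fin 3 → ℝ) 2 = t at *
  have hb1 : IsBary q t p := ⟨hb.2.1, hb.2.2.1, hb.1, by linarith [hb.2.2.2]⟩
  have hb2 : IsBary t p q := ⟨hb.2.2.1, hb.1, hb.2.1, by linarith [hb.2.2.2]⟩
  rcases Labelling.min_cases_three p q t with ⟨h1, h2⟩ | ⟨h1, h2⟩ | ⟨h1, h2⟩
  · exact exists_realizationPoint_of_le hb h1 h2
  · rw [← P.baryPoint_rot hb]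
    exact exists_realizationPoint_of_le hb1 h1 h2
  · rw [← P.baryPoint_rot hb, ← P.baryPoint_rot hb1]
    exact exists_realizationPoint_of_le hb2 h2 h1

namespace Labelling

variable (A : P.Labelling) [Finite D]

/-- Central projection and the affine parametrization of a piece are inverse: `2 * p + t` recovers
`r`, and `position` recovers the fraction of the half-edge unless `r = 0`. Hence bijectivity reduces
to comparing parameters. -/
lemma surfaceMap_realizationPoint {d : D} {a r : ℝ} (ha0 : 0 ≤ a) (ha1 : a ≤ P.length d)
    (hr0 : 0 ≤ r) (hr1 : r ≤ 1) :
    A.surfaceMap (P.realizationPoint d a r) = A.stripPoint d a r := by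
  have hpos {s : ℝ} (h0 : r ≠ 0) : position (r * (1 / 3 + s / 6)) (r * (1 - s) / 3) = s := by
    have e : 2 * (r * (1 / 3 + s / 6)) + r * (1 - s) / 3 = r := by ring
    rw [position, e]
    field_simp
    ring
  have ineq {s : ℝ} (hs0 : 0 ≤ s) (hs1 : s ≤ 1) :
      r * (1 - s) / 3 ≤ r * (1 / 3 + s / 6) ∧ r * (1 / 3 + s / 6) ≤ 1 - r * (2 / 3 - s / 6) := by
    have := mul_nonneg hr0 hs0
    constructor <;> nlinarith
  have hl := length_sub_halfLength (P := P) d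
  rcases le_total a (P.halfLength d) with h | h
  · have hd := P.halfLength_pos d
    have hs0 : 0 ≤ a / P.halfLength d := by positivity
    have hs1 : a / P.halfLength d ≤ 1 := (div_le_one hd).2 h
    obtain ⟨i1, i2⟩ := ineq hs0 hs1
    rw [realizationPoint_of_le _ h, upperPoint,
      A.surfaceMap_baryPoint (isBary_piece hs0 hs1 hr0 hr1),
      A.triangleMap_of_third i1 (i1.trans i2), sideMap_of_le _ i2]
    have e : 2 * (r * (1 / 3 + a / P.halfLength d / 6)) + r * (1 - a / P.halfLength d) / 3 = r := by
      ring
    rw [e]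
    rcases eq_or_ne r 0 with h0 | h0
    · rw [h0, stripPoint_puncture, stripPoint_puncture]
    · rw [hpos h0, mul_div_cancel₀ _ hd.ne']
  · have hd := P.halfLength_pos (P.opp d)
    set s := (P.length d - a) / P.halfLength (P.opp d) with hs
    have hs0 : 0 ≤ s := div_nonneg (by linarith) hd.le
    have hs1 : s ≤ 1 := (div_le_one hd).2 (by linarith)
    obtain ⟨i1, i2⟩ := ineq hs0 hs1
    have hb := (isBary_piece hs0 hs1 hr0 hr1).swap
    rw [realizationPoint_of_ge hr0 hr1 h, lowerPoint, A.surfaceMap_baryPoint hb,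
      A.triangleMap_of_third (i1.trans i2) i1, A.sideMap_of_ge hb i1 i2, P.opp_opp]
    have e : 2 * (r * (1 / 3 + s / 6)) + r * (1 - s) / 3 = r := by
      ring
    rw [e]
    rcases eq_or_ne r 0 with h0 | h0
    · rw [h0, stripPoint_puncture, stripPoint_puncture]
    · rw [hpos h0, hs, mul_div_cancel₀ _ hd.ne', length_opp, sub_sub_cancel]

/-- Coincidences of strip parameters in the glued space are only the collapse at a puncture, the
flip on an edge, and the common vertex; each also occurs in `M`. Half-open edges exclude the
coincidence at corners. -/
lemma realizationPoint_eq_of_lt {d d' : D} {a a' r r' : ℝ} (ha0 : 0 ≤ a) (ha1 : a < P.length d)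
    (hr0 : 0 ≤ r) (hr1 : r ≤ 1) (ha0' : 0 ≤ a') (ha1' : a' < P.length d') (hr0' : 0 ≤ r')
    (hr1' : r' ≤ 1) (h : A.stripPoint d a r = A.stripPoint d' a' r') :
    P.realizationPoint d a r = P.realizationPoint d' a' r' := by
  have key : ∀ {d d' : D} {a a' r : ℝ}, 0 ≤ a → a < P.length d → 0 ≤ r → r < 1 → 0 ≤ a' →
      a' < P.length d' → A.stripPoint d a r ≠ A.stripPoint d' a' 1 := by
    intro d d' a a' r ha0 ha1 hr0 hr1 ha0' ha1' h
    have hm := A.mul_toCell_mem (d := d) (a := a) (P.cell d) hr0 hr1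
    rw [stripPoint_of_lt _ hr1] at h
    rcases ha0'.eq_or_lt with rfl | ha0'
    · rw [stripPoint_zero_one] at h
      cases (A.of_glued_eq_vertexPoint hm h).1
    · rw [A.stripPoint_one ha0' ha1'] at h
      rcases A.of_glued_edge_eq_cell (A.ofReal_mem_edge.2 ⟨ha0', ha1'⟩) hm h.symm with h | h
      · simpa using h.1
      · simpa using h.1
  rcases hr1.lt_or_eq with hr | rfl <;> rcases hr1'.lt_or_eq with hr' | rfl
  · rw [stripPoint_of_lt _ hr, stripPoint_of_lt _ hr'] at h
    obtain ⟨hc, he⟩ := A.eq_of_glued_cell_eq (A.mul_toCell_mem _ hr0 hr)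
      (A.mul_toCell_mem _ hr0' hr') h
    have hrr : r = r' := by rw [← A.norm_mul_toCell hr0, he, A.norm_mul_toCell hr0']
    subst hrr
    rcases eq_or_ne r 0 with rfl | h0
    · rw [realizationPoint_apex, realizationPoint_apex, baryPoint_apex_eq hc]
    · have h0' : (r : ℂ) ≠ 0 := by exact_mod_cast h0
      obtain ⟨rfl, h2⟩ := A.toCell_inj hc (by simpa using ha0) (by simpa using ha0')
        (by simpa using ha1) (by simpa using ha1') (mul_left_cancel₀ h0' he)
      rw [Complex.ofReal_inj.1 h2]
  · exact (key ha0 ha1 hr0 hr ha0' ha1' h).elim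
  · exact (key ha0' ha1' hr0' hr' ha0 ha1 h.symm).elim
  · rcases ha0.eq_or_lt with rfl | ha0 <;> rcases ha0'.eq_or_lt with rfl | ha0'
    · rw [stripPoint_zero_one, stripPoint_zero_one] at h
      rw [realizationPoint_zero, realizationPoint_zero,
        P.upperPoint_vertex (A.vertexPoint_injective h)]
    · rw [stripPoint_zero_one, A.stripPoint_one ha0' ha1'] at h
      cases (A.of_glued_eq_vertexPoint (A.ofReal_mem_edge.2 ⟨ha0', ha1'⟩) h.symm).1
    · rw [stripPoint_zero_one, A.stripPoint_one ha0 ha1] at h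
      cases (A.of_glued_eq_vertexPoint (A.ofReal_mem_edge.2 ⟨ha0, ha1⟩) h).1
    · rw [A.stripPoint_one ha0 ha1, A.stripPoint_one ha0' ha1'] at h
      rcases A.eq_or_flip_of_glued_edge_eq (A.ofReal_mem_edge.2 ⟨ha0, ha1⟩)
        (A.ofReal_mem_edge.2 ⟨ha0', ha1'⟩) h with ⟨rfl, h2⟩ | ⟨rfl, h2⟩
      · rw [Complex.ofReal_inj.1 h2]
      · rw [← Complex.ofReal_sub, Complex.ofReal_inj] at h2
        rw [h2, realizationPoint_flip]

omit [Finite D] in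
/-- Every point of the compactified strips is also one that is not at the end of its strip. -/
lemma exists_lt_length {d : D} {a r : ℝ} (ha0 : 0 ≤ a) (ha1 : a ≤ P.length d) (hr0 : 0 ≤ r)
    (hr1 : r ≤ 1) : ∃ e b, 0 ≤ b ∧ b < P.length e ∧
      P.realizationPoint d a r = P.realizationPoint e b r := by
  rcases ha1.lt_or_eq with h | rfl
  · exact ⟨d, a, ha0, h, rfl⟩
  · exact ⟨P.next d, 0, le_rfl, length_pos _, (realizationPoint_next hr0 hr1).symm⟩

lemma bijective_surfaceMap : Function.Bijective A.surfaceMap := by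
  constructor
  · intro y y' h
    obtain ⟨d₀, a₀, r, h1, h2, h3, h4, rfl⟩ := exists_realizationPoint y
    obtain ⟨d₀', a₀', r', h1', h2', h3', h4', rfl⟩ := exists_realizationPoint y'
    obtain ⟨d, a, ha0, ha1, e⟩ := exists_lt_length h1 h2 h3 h4
    obtain ⟨d', a', ha0', ha1', e'⟩ := exists_lt_length h1' h2' h3' h4'
    rw [e, e'] at h ⊢
    rw [A.surfaceMap_realizationPoint ha0 ha1.le h3 h4,
      A.surfaceMap_realizationPoint ha0' ha1'.le h3' h4'] at h
    exact A.realizationPoint_eq_of_lt ha0 ha1 h3 h4 ha0' ha1' h3' h4' h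
  · intro p
    obtain ⟨d, a, r, h1, h2, h3, h4, rfl⟩ := A.exists_stripPoint p
    exact ⟨_, A.surfaceMap_realizationPoint h1 h2 h3 h4⟩

/-- The homeomorphism from the triangulated surface to the glued space. -/
def surfaceHomeomorph : P.Realization ≃ₜ A.Surface :=
  haveI := A.t2Space
  Continuous.homeoOfEquivCompactToT2 (f := Equiv.ofBijective _ A.bijective_surfaceMap)
    A.continuous_surfaceMap

lemma surfaceHomeomorph_point (d : D) (x : stdSimplex ℝ (Fin 3)) :
    A.surfaceHomeomorph (P.point d x) = A.triangleMap d ((x : Fin 3 → ℝ) 0)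
      ((x : Fin 3 → ℝ) 1) ((x : Fin 3 → ℝ) 2) := rfl

lemma compactSpace : CompactSpace A.Surface := A.surfaceHomeomorph.compactSpace

/-- When `q` is strictly largest, the point is in one of the two pieces at the terminal end of `d`,
and its radial parameter, `2 * p + t` or `2 * t + p`, is less than one. -/
lemma triangleMap_mem_cell {d : D} {p q t : ℝ} (hb : IsBary p q t) (h1 : p < q) (h2 : t < q) :
    A.triangleMap d p q t ∈ range (A.patchMap (.cell (P.cell d))) := by
  have hmem {e : D} {a r : ℝ} (hc : P.cell e = P.cell d) (h0 : 0 ≤ r) (h1 : r < 1) :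
      A.stripPoint e a r ∈ range (A.patchMap (.cell (P.cell d))) := by
    rw [stripPoint_of_lt _ h1, hc, A.glued_of_mem (A.mul_toCell_mem _ h0 h1)]
    exact mem_range_self _
  obtain ⟨hp, hq, ht, hs⟩ := hb
  rcases le_total t p with h | h
  · rw [A.triangleMap_of_third h h2.le, sideMap_of_le _ h1.le]
    exact hmem rfl (by linarith) (by linarith)
  · rw [A.triangleMap_of_first ⟨hp, hq, ht, hs⟩ h1.le h,
      A.sideMap_of_ge ⟨hq, ht, hp, by linarith⟩ h h2.le]
    exact hmem (P.cell_opp_rot d) (by linarith) (by linarith)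

end Labelling

end ConicalPolytope

/-! ### The main theorem. -/

theorem proposition5 {D : Type u} [Finite D] (P : ConicalPolytope D) (A : P.Labelling) :
    -- the glued space is a compact connected Riemann surface with punctures, carrying `ψ`
    (CompactSpace A.Surface ∧ T2Space A.Surface ∧ SecondCountableTopology A.Surface ∧
      ConnectedSpace A.Surface ∧
      Function.Injective A.vertexPoint ∧ Function.Injective A.puncture ∧
      IsConnected (Set.range A.puncture)ᶜ ∧
      ∃ _ : ChartedSpace ℂ A.Surface, A.IsComplexStructure ∧
        ∃ ψ : MeromorphicQuadraticDifferential A.Surface,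
          (∀ i, ∀ e ∈ IsManifold.maximalAtlas 𝓘(ℂ) ω A.Surface, A.IsPatchChart i e →
            Set.EqOn (ψ.coeff e) (A.quadCoeff i) (A.domain i)) ∧
          (∀ v, ψ.order (A.vertexPoint v) = (1 : ℤ)) ∧
          (∀ c, ψ.order (A.puncture c) = (-2 : ℤ)) ∧
          (∀ p, p ∉ Set.range A.vertexPoint → p ∉ Set.range A.puncture →
            ψ.order p = (0 : ℤ))) ∧
    -- it is a structure on the triangulated surface `M`, with punctures at the vertices of the
    -- triangulation, and with the 1-skeleton of the polytope as the cores of the strips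
    (∃ h : P.Realization ≃ₜ A.Surface,
      (∀ (d : D) (x : stdSimplex ℝ (Fin 3)), (x : Fin 3 → ℝ) = ![0, 1, 0] →
        h (P.point d x) = A.puncture (P.cell d)) ∧
      (∀ (d : D) (x : stdSimplex ℝ (Fin 3)), (x : Fin 3 → ℝ) = ![1 / 3, 1 / 3, 1 / 3] →
        h (P.point d x) = A.vertexPoint (P.vertex d)) ∧
      (∀ (d : D) (x : stdSimplex ℝ (Fin 3)) (s : ℝ) (z : A.domain (.edge d)), 0 < s → s ≤ 1 →
        (x : Fin 3 → ℝ) = (1 - s) • ![1 / 3, 1 / 3, 1 / 3] + s • ![1 / 2, 1 / 2, 0] →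
        (z : ℂ) = (s * P.halfLength d : ℝ) →
        h (P.point d x) = A.patchMap (.edge d) z) ∧
      (∀ (d : D) (x : stdSimplex ℝ (Fin 3)), (x : Fin 3 → ℝ) 0 < (x : Fin 3 → ℝ) 1 →
        (x : Fin 3 → ℝ) 2 < (x : Fin 3 → ℝ) 1 →
        h (P.point d x) ∈ Set.range (A.patchMap (.cell (P.cell d))))) ∧
    -- it is canonical: isomorphic polytopes, with any choices, give isomorphic surfaces
    (∀ (D' : Type u) (_ : Finite D') (P' : ConicalPolytope D') (A' : P'.Labelling) (f : D ≃ D'),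
      (∀ d, f (P.rot d) = P'.rot (f d)) → (∀ d, f (P.opp d) = P'.opp (f d)) →
      (∀ d, P'.length (f d) = P.length d) →
      ∀ (_ : ChartedSpace ℂ A.Surface) (_ : ChartedSpace ℂ A'.Surface),
        A.IsComplexStructure → A'.IsComplexStructure →
        ∃! g : A.Surface ≃ₜ A'.Surface,
          ContMDiff 𝓘(ℂ) 𝓘(ℂ) ω g ∧ ContMDiff 𝓘(ℂ) 𝓘(ℂ) ω g.symm ∧
          (∀ (d : D) (z : A.domain (.edge d)) (z' : A'.domain (.edge (f d))), (z' : ℂ) = z →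
            g (A.patchMap (.edge d) z) = A'.patchMap (.edge (f d)) z') ∧
          (∀ d, g (A.vertexPoint (P.vertex d)) = A'.vertexPoint (P'.vertex (f d))) ∧
          (∀ d, g (A.puncture (P.cell d)) = A'.puncture (P'.cell (f d)))) := by
  refine ⟨⟨A.compactSpace, A.t2Space, ?_, A.connectedSpace, A.vertexPoint_injective,
    A.puncture_injective, A.isConnected_compl_punctures, A.chartedSpace, A.isComplexStructure,
    A.quadraticDifferential, fun i e he hi z hz => A.coeff_patchChart he hi hz,
    A.order_vertexPoint, A.order_puncture, fun p => A.order_eq_zero⟩,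
    ⟨A.surfaceHomeomorph, ?_, ?_, ?_, ?_⟩, ?_⟩
  · let := A.chartedSpace
    have := A.compactSpace
    exact ChartedSpace.secondCountable_of_sigmaCompact ℂ A.Surface
  · intro d x hx
    rw [A.surfaceHomeomorph_point, hx]
    change A.triangleMap d 0 1 0 = _
    rw [A.triangleMap_of_third le_rfl zero_le_one, A.sideMap_of_le zero_le_one, mul_zero, add_zero,
      A.stripPoint_puncture]
  · intro d x hx
    rw [A.surfaceHomeomorph_point, hx]
    change A.triangleMap d (1 / 3) (1 / 3) (1 / 3) = _
    rw [A.triangleMap_of_third le_rfl le_rfl, A.sideMap_of_le le_rfl,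
      ConicalPolytope.position_self, mul_zero, show (2 * (1 / 3) + 1 / 3 : ℝ) = 1 by norm_num,
      A.stripPoint_zero_one]
  · intro d x s z h0 h1 hx hz
    rw [A.surfaceHomeomorph_point, hx, ← A.glued_coe, hz]
    have hm := z.2
    rw [hz, A.ofReal_mem_edge] at hm
    have e : (1 - s) • ![(1 / 3 : ℝ), 1 / 3, 1 / 3] + s • ![(1 / 2 : ℝ), 1 / 2, 0] =
        ![1 / 3 + s / 6, 1 / 3 + s / 6, (1 - s) / 3] := by
      ext i
      fin_cases i <;> simp <;> ring
    rw [e]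
    change A.triangleMap d (1 / 3 + s / 6) (1 / 3 + s / 6) ((1 - s) / 3) = _
    -- On the half-edge the radial parameter is one and the position is `s`, whence constant speed.
    have hr : 2 * (1 / 3 + s / 6) + (1 - s) / 3 = 1 := by ring
    have hs : ConicalPolytope.position (1 / 3 + s / 6) ((1 - s) / 3) = s := by
      rw [ConicalPolytope.position, hr]
      ring
    rw [A.triangleMap_of_third (by linarith) (by linarith), A.sideMap_of_le le_rfl, hr, hs,
      mul_comm, A.stripPoint_one hm.1 hm.2]
  · intro d x h1 h2
    rw [A.surfaceHomeomorph_point]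
    exact A.triangleMap_mem_cell (Triangulation.isBary_coe x) h1 h2
  · intro D' _ P' A' f hrot hopp hlen _ _ hA hA'
    exact ConicalPolytope.Labelling.existsUnique_biholomorphic hA hA' ⟨f, hrot, hopp, hlen⟩

end
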